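/- **Setting.** Let $T>0$, let $\Omega_x=(\alpha,\beta)$ be a bounded interval, let $\Omega_v\subset\mathbb R^2$ be bounded and open with $\Omega_v=\operatorname{int}\overline{\Omega_v}$, and put $\Omega=\Omega_x\times\Omega_v$, $Q_T=[0,T]\times\Omega$, $\nabla=(\partial_x,\partial_{v_1},\partial_{v_2})$, $\hat v=v/\sqrt{1+|v|^2}$. *Mesh.* Let $0=t_0<\dots<t_M=T$, $I_m=(t_{m-1},t_m]$, $S_m=I_m\times\Omega$; let $\{\tau_x\}$ be a subdivision of $\overline{\Omega_x}$ into intervals and $\{\tau_v\}$ a conforming triangulation of $\overline{\Omega_v}$. The elements are $K=I_m\times\tau_x\times\tau_v$, and $h>0$ is the mesh parameter. The mesh is shape regular with constant $\sigma>0$: $\operatorname{diam}K\le h$ for every $K$, every $I_m$ and every $\tau_x$ has length at least $\sigma h$, and every $\tau_v$ contains a disc of radius $\sigma h$. Fix an integer $k\ge1$. $V_h$ is the space of functions $w$ on $\bigcup_m S_m$ whose restriction to each slab $S_m$ is in $H^1(S_m)$, vanishes on $\partial\Omega$, and belongs to $P_k(I_m)\times P_k(\tau_x)\times P_k(\tau_v)$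 on each element; jumps are allowed across the levels $t_m$. $\tilde V_h$ is the analogous space of triples of functions of $(t,x)$, with components in $P_k(I_m)\times P_k(\tau_x)$, vanishing on $\partial\Omega_x$. Write $(\cdot,\cdot)_m$ for the $L_2$ inner product over $S_m$ (over $I_m\times\Omega_x$ for fields), $\langle\cdot,\cdot\rangle_m$ for the $L_2$ inner product over $\Omega$ (over $\Omega_x$ for fields) at time $t_m$, and $w_\pm(t)=\lim_{s\to0^\pm}w(t+s)$. *Data.* $0\le f^0\in C_0^1(\Omega)$, $\rho_b\in C_0^\infty(\Omega_x)$ with $\int(\int f^0\,dv-\rho_b)\,dx=0$, $E_2^0,B^0\in C_0^2(\Omega_x)$, $E_1^0(x)=\int_{-\infty}^x(\int f^0(y,v)\,dv-\rho_b(y))\,dy$. *Discrete iteration.* Start from any $f^{h,0}\in V_h$. For $i\ge1$ let $W^{h,i}=(E_1^{h,i},E_2^{h,i},B^{h,i})\in\tilde V_h$ satisfy, for $m=1,\dots,M$ and all $g\in\tilde V_h$, $$(\mathcal M W^{h,i},\hat g+\delta'\mathcal M g)_m+\langle W^{h,i}_+,g_+\rangle_{m-1}=(b^{h,i-1},\hat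 g+\delta'\mathcal M g)_m+\langle W^{h,i}_-,g_+\rangle_{m-1},$$ where $\delta'\in\mathbb R$, $\mathcal M(g_1,g_2,g_3)=(\partial_xg_1,\ \partial_tg_1,\ \partial_tg_2+\partial_xg_3,\ \partial_tg_3+\partial_xg_2)$, $\hat g=(g_1,g_1,g_2,g_3)$, $W^{h,i}_-(0)=(E_1^0,E_2^0,B^0)$ and $$b^{h,i-1}=\Big(\int_{\Omega_v}f^{h,i-1}dv-\rho_b,\ -\int_{\Omega_v}\hat v_1f^{h,i-1}dv,\ -\int_{\Omega_v}\hat v_2f^{h,i-1}dv,\ 0\Big).$$ Put $G=G(f^{h,i-1})=(\hat v_1,\ E_1^{h,i}+\hat v_2B^{h,i},\ E_2^{h,i}-\hat v_1B^{h,i})$, and let $f^{h,i}\in V_h$ satisfy, with $\delta=c\,h$, $c>0$, and $f^{h,i}_-(0)=f^0$, for $m=1,\dots,M$ and all $g\in V_h$, $$(f^{h,i}_t+G\cdot\nabla f^{h,i},\ g+\delta(g_t+G\cdot\nabla g))_m+\langle f^{h,i}_+,g_+\rangle_{m-1}=\langle f^{h,i}_-,g_+\rangle_{m-1}.$$ *Exact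 solution, error, residuals.* Let $f^i$ be a Lipschitz continuous function on $Q_T$, with support in $[0,T]\times K_0$ for some compact $K_0\subset\Omega$, such that $f^i_t+G\cdot\nabla f^i=0$ a.e. in $Q_T$ and $f^i(0,\cdot)=f^0$. Let $e^i=f^i-f^{h,i}$, with $f^{h,i}(T,\cdot)=f^{h,i}_-(T,\cdot)$, and let $$R_1^i=f^{h,i}_t+G\cdot\nabla f^{h,i},\qquad R_2^i|_{S_m}=\big(f^{h,i}_+(t_{m-1},\cdot)-f^{h,i}_-(t_{m-1},\cdot)\big)/h .$$ *Negative norms.* For $U\subseteq\Omega$ let $\|u\|_{H^{-1}(U)}=\sup\{\int u\chi\,/\,\|\chi\|_{H^1}:\ 0\ne\chi\in C_0^\infty(U)\}$, where $\|\chi\|_{H^1}^2=\|\chi\|_{L_2}^2+\|\nabla\chi\|_{L_2}^2$. Let $\Omega'\subseteq\Omega$ be the set of those $z\in\Omega$ for which the characteristic $\dot\gamma=G(t,\gamma)$, $\gamma(T)=z$, stays in $\Omega$ for all $t\in[0,T]$. Thus, for $\chi\in C_0^\infty(\Omega')$, the solution $\Psi$ of the dual problem $-\Psi_t-G\cdot\nabla\Psi=0$,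 $\Psi(T,\cdot)=\chi$, vanishes near $\partial\Omega$ at all times. **Theorem.** For all $T,\Omega_x,\Omega_v,k,\sigma,c$ as above and all $L\in\mathbb R$, $r>0$ there is a constant $C$, depending only on these, such that for every mesh that is shape regular with constant $\sigma$, every choice of $\delta'$ and of the data, every discrete iteration as above, every $i\ge1$ for which the discrete fields satisfy $|W_j^{h,i}(t,x)-W_j^{h,i}(t,y)|\le L|x-y|$ ($j=1,2,3$) on each slab, and every exact solution $f^i$ as above: 1. $$\|e^i(T,\cdot)\|_{H^{-1}(\Omega')}\le C\Big(\|hR_1^i\|_{L_2(Q_T)}\big(2+\|G\|_{L_\infty(Q_T)}\big)+\|hR_2^i\|_{L_2(Q_T)}\Big).$$ 2. If every point $(x,v_1,v_2)\in\Omega$ at which $e^i(T,\cdot)$ does not vanish is the centre of a cube $\{|x'-x|<r,\ |v_1'-v_1|<r,\ |v_2'-v_2|<r\}$ contained in $\Omega'$, then $$\|e^i(T,\cdot)\|_{H^{-1}(\Omega)}\le C\Big(\|hR_1^i\|_{L_2(Q_T)}\big(2+\|G\|_{L_\infty(Q_T)}\big)+\|hR_2^i\|_{L_2(Q_T)}\Big).$$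 -/

import Mathlib

open Set MeasureTheory
open scoped ENNReal NNReal

/-! ### Phase space, relativistic velocity, differential operators -/

/-- A point `(x, v₁, v₂)` of phase space. The velocity variable is the pair `(v₁, v₂)`. -/
abbrev Phase := ℝ × ℝ × ℝ

/-- The phase domain `Ω = Ω_x × Ω_v` with `Ω_x = (α, β)`. -/
def phaseDomain (α β : ℝ) (Ωv : Set (ℝ × ℝ)) : Set Phase := Ioo α β ×ˢ Ωv

/-- The space-time cylinder `Q_T = [0, T] × Ω`. -/
def cylinder (T α β : ℝ) (Ωv : Set (ℝ × ℝ)) : Set (ℝ × Phase) :=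
  Icc 0 T ×ˢ phaseDomain α β Ωv

/-- First component of the relativistic velocity `v / (1 + |v|²)^{1/2}`. -/
noncomputable def vhat₁ (v : ℝ × ℝ) : ℝ := v.1 / Real.sqrt (1 + v.1 ^ 2 + v.2 ^ 2)

/-- Second component of the relativistic velocity `v / (1 + |v|²)^{1/2}`. -/
noncomputable def vhat₂ (v : ℝ × ℝ) : ℝ := v.2 / Real.sqrt (1 + v.1 ^ 2 + v.2 ^ 2)

/-- `∂_x χ`. -/
noncomputable def dX (χ : Phase → ℝ) (z : Phase) : ℝ := deriv (fun y => χ (y, z.2)) z.1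

/-- `∂_{v₁} χ`. -/
noncomputable def dV₁ (χ : Phase → ℝ) (z : Phase) : ℝ :=
  deriv (fun y => χ (z.1, y, z.2.2)) z.2.1

/-- `∂_{v₂} χ`. -/
noncomputable def dV₂ (χ : Phase → ℝ) (z : Phase) : ℝ :=
  deriv (fun y => χ (z.1, z.2.1, y)) z.2.2

/-- The transport operator `∂_t w + G · ∇ w`, where `∇ = (∂_x, ∂_{v₁}, ∂_{v₂})`. -/
noncomputable def transport (G : ℝ × Phase → Phase) (w : ℝ × Phase → ℝ) (q : ℝ × Phase) : ℝ :=
  deriv (fun s => w (s, q.2)) q.1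
    + (G q).1 * dX (fun z => w (q.1, z)) q.2
    + (G q).2.1 * dV₁ (fun z => w (q.1, z)) q.2
    + (G q).2.2 * dV₂ (fun z => w (q.1, z)) q.2

/-- The drift `(v̂₁, E₁ + v̂₂ B, E₂ - v̂₁ B)` of the fields `W = (E₁, E₂, B)`. -/
noncomputable def drift (W : ℝ × ℝ → ℝ × ℝ × ℝ) (q : ℝ × Phase) : Phase :=
  (vhat₁ q.2.2,
    (W (q.1, q.2.1)).1 + vhat₂ q.2.2 * (W (q.1, q.2.1)).2.2,
    (W (q.1, q.2.1)).2.1 - vhat₁ q.2.2 * (W (q.1, q.2.1)).2.2)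

/-! ### The finite element mesh -/

/-- A subdivision of `[0, T] × Ω_x × Ω_v` into elements `K = I_m × τ_x × τ_v`: time intervals
`I_m = (t m, t (m + 1)]`, space intervals `τ_x = [x j, x (j + 1)]`, and the triangles `τ_v` of a
conforming triangulation of the closure of `Ω_v`. The number `h` is the mesh parameter. -/
structure PhaseMesh (T α β : ℝ) (Ωv : Set (ℝ × ℝ)) where
  M : ℕ
  t : ℕ → ℝ
  t_zero : t 0 = 0
  t_last : t M = T
  t_lt : ∀ m < M, t m < t (m + 1)
  N : ℕ
  x : ℕ → ℝ
  x_zero : x 0 = α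
  x_last : x N = β
  x_lt : ∀ j < N, x j < x (j + 1)
  tri : Geometry.SimplicialComplex ℝ (ℝ × ℝ)
  tri_finite : tri.faces.Finite
  tri_space : tri.space = closure Ωv
  h : ℝ
  h_pos : 0 < h

namespace PhaseMesh

variable {T α β : ℝ} {Ωv : Set (ℝ × ℝ)}

/-- The vertex sets of the triangles. -/
def triangles (𝒯 : PhaseMesh T α β Ωv) : Set (Finset (ℝ × ℝ)) :=
  {s | s ∈ 𝒯.tri.faces ∧ s.card = 3}

/-- Shape regularity with constant `σ`, for the mesh parameter `h`: every element has Euclidean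
diameter at most `h` (the diameter of a triangle is attained at two vertices), its two intervals
have length at least `σ h`, and its triangle contains a disc of radius `σ h`. -/
def ShapeRegular (𝒯 : PhaseMesh T α β Ωv) (σ : ℝ) : Prop :=
  (∀ m < 𝒯.M, ∀ j < 𝒯.N, ∀ s ∈ 𝒯.triangles, ∀ v ∈ s, ∀ w ∈ s,
    (𝒯.t (m + 1) - 𝒯.t m) ^ 2 + (𝒯.x (j + 1) - 𝒯.x j) ^ 2
      + ((v.1 - w.1) ^ 2 + (v.2 - w.2) ^ 2) ≤ 𝒯.h ^ 2) ∧
  (∀ m < 𝒯.M, σ * 𝒯.h ≤ 𝒯.t (m + 1) - 𝒯.t m) ∧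
  (∀ j < 𝒯.N, σ * 𝒯.h ≤ 𝒯.x (j + 1) - 𝒯.x j) ∧
  (∀ s ∈ 𝒯.triangles, ∃ c : ℝ × ℝ, ∀ v : ℝ × ℝ,
    (v.1 - c.1) ^ 2 + (v.2 - c.2) ^ 2 ≤ (σ * 𝒯.h) ^ 2 →
      v ∈ convexHull ℝ (s : Set (ℝ × ℝ)))

/-- The slab `S_m = I_m × Ω`. -/
def slab (𝒯 : PhaseMesh T α β Ωv) (m : ℕ) : Set (ℝ × Phase) :=
  Ioc (𝒯.t m) (𝒯.t (m + 1)) ×ˢ phaseDomain α β Ωv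

/-- The space-time slab `I_m × Ω_x`. -/
def fieldSlab (𝒯 : PhaseMesh T α β Ωv) (m : ℕ) : Set (ℝ × ℝ) :=
  Ioc (𝒯.t m) (𝒯.t (m + 1)) ×ˢ Ioo α β

/-- A slabwise function is a family `u`, where `u m` is the continuous representative on the
closed slab `[t m, t (m + 1)] × ⋯`. `glue` is the corresponding function on `(0, T] × ⋯`, equal to
`u m` for times in `I_m`. -/
noncomputable def glue (𝒯 : PhaseMesh T α β Ωv) {X Y : Type*} [AddCommMonoid Y]
    (u : ℕ → ℝ × X → Y) (q : ℝ × X) : Y :=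
  ∑ m ∈ Finset.range 𝒯.M, (Ioc (𝒯.t m) (𝒯.t (m + 1))).indicator (fun _ => u m q) q.1

/-- The trace from below at the time level `t m`; at `t 0` it is the initial datum. The trace from
above is `u m (t m, ·)`. -/
def traceBelow (𝒯 : PhaseMesh T α β Ωv) {X Y : Type*} (u₀ : X → Y) (u : ℕ → ℝ × X → Y) :
    ℕ → X → Y
  | 0 => u₀
  | m + 1 => fun z => u m (𝒯.t (m + 1), z)

/-- The space `V_h`: on each slab a continuous function that vanishes on `∂Ω` and is, on every
element, a polynomial in `P_k(I_m) × P_k(τ_x) × P_k(τ_v)`. (A piecewise polynomial function is in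
`H¹` of the slab exactly if it is continuous.) -/
def MemV (𝒯 : PhaseMesh T α β Ωv) (k : ℕ) (w : ℕ → ℝ × Phase → ℝ) : Prop :=
  ∀ m < 𝒯.M,
    ContinuousOn (w m) (Icc (𝒯.t m) (𝒯.t (m + 1)) ×ˢ closure (phaseDomain α β Ωv)) ∧
    (∀ t ∈ Icc (𝒯.t m) (𝒯.t (m + 1)), ∀ z ∈ frontier (phaseDomain α β Ωv), w m (t, z) = 0) ∧
    (∀ j < 𝒯.N, ∀ s ∈ 𝒯.triangles, ∃ c : ℕ → ℕ → ℕ → ℕ → ℝ,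
      ∀ t ∈ Icc (𝒯.t m) (𝒯.t (m + 1)), ∀ x ∈ Icc (𝒯.x j) (𝒯.x (j + 1)),
        ∀ v ∈ convexHull ℝ (s : Set (ℝ × ℝ)),
          w m (t, x, v) =
            ∑ a ∈ Finset.range (k + 1), ∑ b ∈ Finset.range (k + 1),
              ∑ d ∈ Finset.range (k + 1), ∑ e ∈ Finset.range (k + 1 - d),
                c a b d e * (t ^ a * x ^ b * (v.1 ^ d * v.2 ^ e)))

/-- The space of discrete fields: triples, on each slab continuous, zero on `∂Ω_x`, and on every
element with components in `P_k(I_m) × P_k(τ_x)`. -/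
def MemFieldV (𝒯 : PhaseMesh T α β Ωv) (k : ℕ) (W : ℕ → ℝ × ℝ → ℝ × ℝ × ℝ) : Prop :=
  ∀ m < 𝒯.M,
    ContinuousOn (W m) (Icc (𝒯.t m) (𝒯.t (m + 1)) ×ˢ Icc α β) ∧
    (∀ t ∈ Icc (𝒯.t m) (𝒯.t (m + 1)), W m (t, α) = 0 ∧ W m (t, β) = 0) ∧
    (∀ j < 𝒯.N, ∃ c : ℕ → ℕ → ℝ × ℝ × ℝ,
      ∀ t ∈ Icc (𝒯.t m) (𝒯.t (m + 1)), ∀ x ∈ Icc (𝒯.x j) (𝒯.x (j + 1)),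
        W m (t, x) = ∑ a ∈ Finset.range (k + 1), ∑ b ∈ Finset.range (k + 1),
          (t ^ a * x ^ b) • c a b)

end PhaseMesh

/-! ### The streamline diffusion iteration -/

/-- `M₁ U_t + M₂ U_x` for `U = (E₁, E₂, B)`, that is
`(∂_x E₁, ∂_t E₁, ∂_t E₂ + ∂_x B, ∂_t B + ∂_x E₂)`. -/
noncomputable def maxwellOp (U : ℝ × ℝ → ℝ × ℝ × ℝ) (p : ℝ × ℝ) : Fin 4 → ℝ :=
  let Ut := deriv (fun s => U (s, p.2)) p.1
  let Ux := deriv (fun y => U (p.1, y)) p.2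
  ![Ux.1, Ut.1, Ut.2.1 + Ux.2.2, Ut.2.2 + Ux.2.1]

/-- `ĝ = (g₁, g₁, g₂, g₃)`. -/
def hatTriple (g : ℝ × ℝ × ℝ) : Fin 4 → ℝ := ![g.1, g.1, g.2.1, g.2.2]

/-- The Euclidean inner product of two triples. -/
def tripleInner (a c : ℝ × ℝ × ℝ) : ℝ := a.1 * c.1 + a.2.1 * c.2.1 + a.2.2 * c.2.2

/-- The right-hand side `b = (ρ, -j₁, -j₂, 0)` computed from the density `f`, where
`ρ = ∫ f dv - ρ_b` and `j = ∫ v̂ f dv`, with integrals over `Ω_v`. -/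
noncomputable def maxwellSource (Ωv : Set (ℝ × ℝ)) (ρb : ℝ → ℝ) (f : ℝ × Phase → ℝ)
    (p : ℝ × ℝ) : Fin 4 → ℝ :=
  ![(∫ v in Ωv, f (p.1, p.2, v)) - ρb p.2,
    -∫ v in Ωv, vhat₁ v * f (p.1, p.2, v),
    -∫ v in Ωv, vhat₂ v * f (p.1, p.2, v),
    0]

/-- The initial fields `(E₁⁰, E₂⁰, B⁰)`, with `E₁⁰(x) = ∫_{-∞}^x (∫ f⁰(y, v) dv - ρ_b(y)) dy`. -/
noncomputable def initialField (f₀ : Phase → ℝ) (ρb E₂₀ B₀ : ℝ → ℝ) (x : ℝ) : ℝ × ℝ × ℝ :=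
  (∫ y in Iic x, ((∫ v : ℝ × ℝ, f₀ (y, v)) - ρb y), E₂₀ x, B₀ x)

/-- The assumptions on the data: `0 ≤ f⁰ ∈ C₀¹(Ω)`; the background density `ρ_b` is smooth, has
compact support in `Ω_x`, and is neutralizing; `E₂⁰, B⁰ ∈ C₀²(Ω_x)`. -/
structure IsAdmissibleData (α β : ℝ) (Ωv : Set (ℝ × ℝ)) (f₀ : Phase → ℝ)
    (ρb E₂₀ B₀ : ℝ → ℝ) : Prop where
  f_nonneg : ∀ z, 0 ≤ f₀ z
  f_smooth : ContDiff ℝ 1 f₀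
  f_compact : HasCompactSupport f₀
  f_support : tsupport f₀ ⊆ phaseDomain α β Ωv
  ρ_smooth : ContDiff ℝ ((⊤ : ℕ∞) : WithTop ℕ∞) ρb
  ρ_compact : HasCompactSupport ρb
  ρ_support : tsupport ρb ⊆ Ioo α β
  neutral : ∫ x, ((∫ v : ℝ × ℝ, f₀ (x, v)) - ρb x) = 0
  E_smooth : ContDiff ℝ 2 E₂₀
  E_compact : HasCompactSupport E₂₀
  E_support : tsupport E₂₀ ⊆ Ioo α β
  B_smooth : ContDiff ℝ 2 B₀
  B_compact : HasCompactSupport B₀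
  B_support : tsupport B₀ ⊆ Ioo α β

namespace PhaseMesh

variable {T α β : ℝ} {Ωv : Set (ℝ × ℝ)}

/-- `W` is a streamline diffusion approximation of the Maxwell equations with right-hand side `b`
and initial fields `W₀`. -/
def SolvesMaxwellSD (𝒯 : PhaseMesh T α β Ωv) (k : ℕ) (δ : ℝ) (b : ℕ → ℝ × ℝ → Fin 4 → ℝ)
    (W₀ : ℝ → ℝ × ℝ × ℝ) (W : ℕ → ℝ × ℝ → ℝ × ℝ × ℝ) : Prop :=
  𝒯.MemFieldV k W ∧
  ∀ m < 𝒯.M, ∀ g : ℕ → ℝ × ℝ → ℝ × ℝ × ℝ, 𝒯.MemFieldV k g →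
    (∫ p in 𝒯.fieldSlab m,
        maxwellOp (W m) p ⬝ᵥ (hatTriple (g m p) + δ • maxwellOp (g m) p))
      + (∫ x in Ioo α β,
          tripleInner (W m (𝒯.t m, x)) (g m (𝒯.t m, x)))
    = (∫ p in 𝒯.fieldSlab m,
        b m p ⬝ᵥ (hatTriple (g m p) + δ • maxwellOp (g m) p))
      + (∫ x in Ioo α β,
          tripleInner (𝒯.traceBelow W₀ W m x) (g m (𝒯.t m, x)))

/-- `w` is a streamline diffusion approximation of the Vlasov equation `∂_t f + G · ∇ f = 0` with
initial datum `f₀`; `G m` is the drift on the slab `S_m`. -/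
def SolvesVlasovSD (𝒯 : PhaseMesh T α β Ωv) (k : ℕ) (δ : ℝ) (G : ℕ → ℝ × Phase → Phase)
    (f₀ : Phase → ℝ) (w : ℕ → ℝ × Phase → ℝ) : Prop :=
  𝒯.MemV k w ∧
  ∀ m < 𝒯.M, ∀ g : ℕ → ℝ × Phase → ℝ, 𝒯.MemV k g →
    (∫ q in 𝒯.slab m,
        transport (G m) (w m) q * (g m q + δ * transport (G m) (g m) q))
      + (∫ z in phaseDomain α β Ωv, w m (𝒯.t m, z) * g m (𝒯.t m, z))
    = ∫ z in phaseDomain α β Ωv, 𝒯.traceBelow f₀ w m z * g m (𝒯.t m, z)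

/-- The iteration: from an arbitrary `f^{h,0} ∈ V_h`, the fields `W^{h,i+1}` are computed from
`f^{h,i}` by the scheme for the Maxwell equations (stabilization `δ'`), and `f^{h,i+1}` is computed
from the fields `W^{h,i+1}` by the scheme for the Vlasov equation (stabilization `δ`). -/
def IsIteration (𝒯 : PhaseMesh T α β Ωv) (k : ℕ) (δ δ' : ℝ) (f₀ : Phase → ℝ)
    (ρb E₂₀ B₀ : ℝ → ℝ) (fh : ℕ → ℕ → ℝ × Phase → ℝ)
    (Wh : ℕ → ℕ → ℝ × ℝ → ℝ × ℝ × ℝ) : Prop :=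
  𝒯.MemV k (fh 0) ∧
  ∀ i,
    𝒯.SolvesMaxwellSD k δ' (fun m => maxwellSource Ωv ρb (fh i m))
      (initialField f₀ ρb E₂₀ B₀) (Wh (i + 1)) ∧
    𝒯.SolvesVlasovSD k δ (fun m => drift (Wh (i + 1) m)) f₀ (fh (i + 1))

/-- The residual `R₁ = ∂_t w + G · ∇ w`. -/
noncomputable def residual₁ (𝒯 : PhaseMesh T α β Ωv) (G : ℕ → ℝ × Phase → Phase)
    (w : ℕ → ℝ × Phase → ℝ) : ℝ × Phase → ℝ :=
  𝒯.glue (fun m => transport (G m) (w m))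

/-- The residual `R₂`: on the slab `S_m` it is the jump of `w` at the beginning of the slab,
divided by `h`. -/
noncomputable def residual₂ (𝒯 : PhaseMesh T α β Ωv) (f₀ : Phase → ℝ)
    (w : ℕ → ℝ × Phase → ℝ) : ℝ × Phase → ℝ :=
  𝒯.glue (fun m q => (w m (𝒯.t m, q.2) - 𝒯.traceBelow f₀ w m q.2) / 𝒯.h)

end PhaseMesh

/-! ### The exact solution, characteristics, negative norm -/

/-- `f` is an exact (strong) solution of `∂_t f + G · ∇ f = 0` in `Q_T` with initial datum `f₀` and
with support in a compact subset of `Ω`: it is Lipschitz continuous, and the equation holds almost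
everywhere. -/
def IsExactVlasov (T α β : ℝ) (Ωv : Set (ℝ × ℝ)) (G : ℝ × Phase → Phase) (f₀ : Phase → ℝ)
    (f : ℝ × Phase → ℝ) : Prop :=
  (∃ Λ : ℝ≥0, LipschitzOnWith Λ f (cylinder T α β Ωv)) ∧
  (∀ z ∈ phaseDomain α β Ωv, f (0, z) = f₀ z) ∧
  (∃ K : Set Phase, IsCompact K ∧ K ⊆ phaseDomain α β Ωv ∧
    ∀ t ∈ Icc 0 T, ∀ z ∈ phaseDomain α β Ωv, z ∉ K → f (t, z) = 0) ∧
  (∀ᵐ q ∂(volume.restrict (cylinder T α β Ωv)), transport G f q = 0)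

/-- The points of `Ω` whose characteristic, started at time `T` and followed backwards, stays in
`Ω` during `[0, T]`. A characteristic is a continuous solution of the integrated equation
`γ' = G(t, γ)`. -/
def backwardDomain (T : ℝ) (Ω : Set Phase) (G : ℝ × Phase → Phase) : Set Phase :=
  {z | ∃ γ : ℝ → Phase, ContinuousOn γ (Icc 0 T) ∧
    ∀ t ∈ Icc 0 T, γ t ∈ Ω ∧ γ t = z - ∫ s in t..T, G (s, γ s)}

/-- The norm of `H¹`: square root of the sum of squares of the `L₂` norms of `χ` and `∇χ`. -/
noncomputable def h1Norm (χ : Phase → ℝ) : ℝ :=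
  Real.sqrt (∫ z, (χ z ^ 2 + dX χ z ^ 2 + dV₁ χ z ^ 2 + dV₂ χ z ^ 2))

/-- The norm of `H⁻¹(U)`: the supremum of `(u, χ) / ‖χ‖_{H¹}` over `χ ∈ C₀^∞(U)` (with `0 / 0 = 0`
for `χ = 0`). -/
noncomputable def hMinusOneNorm (U : Set Phase) (u : Phase → ℝ) : ℝ≥0∞ :=
  ⨆ (χ : Phase → ℝ) (_ : ContDiff ℝ ((⊤ : ℕ∞) : WithTop ℕ∞) χ) (_ : HasCompactSupport χ)
    (_ : tsupport χ ⊆ U),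
    ENNReal.ofReal (∫ z, u z * χ z) / ENNReal.ofReal (h1Norm χ)

/-- The Euclidean length of a phase space vector. -/
noncomputable def euclLength (g : Phase) : ℝ := Real.sqrt (g.1 ^ 2 + g.2.1 ^ 2 + g.2.2 ^ 2)

namespace PhaseMesh

variable {T α β : ℝ} {Ωv : Set (ℝ × ℝ)}

/-- The numerical error at the final time, `e(T, ·) = f(T, ·) - f^h(T, ·)`; since `T` belongs to
the last interval `(t (M - 1), t M]`, the discrete function is evaluated from the last slab. -/
noncomputable def finalError (𝒯 : PhaseMesh T α β Ωv) (f : ℝ × Phase → ℝ)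
    (w : ℕ → ℝ × Phase → ℝ) (z : Phase) : ℝ :=
  f (T, z) - 𝒯.glue w (T, z)

/-- `‖h R₁‖_{L₂(Q_T)} (2 + ‖G‖_{L_∞(Q_T)}) + ‖h R₂‖_{L₂(Q_T)}`. -/
noncomputable def errorBound (𝒯 : PhaseMesh T α β Ωv) (G : ℕ → ℝ × Phase → Phase)
    (f₀ : Phase → ℝ) (w : ℕ → ℝ × Phase → ℝ) : ℝ≥0∞ :=
  eLpNorm (fun q => 𝒯.h * 𝒯.residual₁ G w q) 2 (volume.restrict (cylinder T α β Ωv))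
      * (2 + eLpNorm (fun q => euclLength (𝒯.glue G q)) ⊤
          (volume.restrict (cylinder T α β Ωv)))
    + eLpNorm (fun q => 𝒯.h * 𝒯.residual₂ f₀ w q) 2 (volume.restrict (cylinder T α β Ωv))

end PhaseMesh

/-! ### Flows of bounded Lipschitz time-dependent vector fields -/

section Flow

variable {E : Type*} [NormedAddCommGroup E] [NormedSpace ℝ E]

theorem dist_integralCurve_le {v : ℝ → E → E} {K : ℝ≥0} (hK : ∀ t, LipschitzWith K (v t))
    {γ₁ γ₂ : ℝ → E} (h₁ : ∀ t, HasDerivAt γ₁ (v t (γ₁ t)) t)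
    (h₂ : ∀ t, HasDerivAt γ₂ (v t (γ₂ t)) t) (s t : ℝ) :
    dist (γ₁ t) (γ₂ t) ≤ dist (γ₁ s) (γ₂ s) * Real.exp (K * |t - s|) := by
  have key : ∀ (v : ℝ → E → E) (γ₁ γ₂ : ℝ → E), (∀ t, LipschitzWith K (v t)) →
      (∀ t, HasDerivAt γ₁ (v t (γ₁ t)) t) → (∀ t, HasDerivAt γ₂ (v t (γ₂ t)) t) →
      ∀ s t, s ≤ t → dist (γ₁ t) (γ₂ t) ≤ dist (γ₁ s) (γ₂ s) * Real.exp (K * |t - s|) := by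
    intro v γ₁ γ₂ hK h₁ h₂ s t hst
    rw [abs_of_nonneg (sub_nonneg.2 hst)]
    exact dist_le_of_trajectories_ODE (a := s) (b := t) hK
      (fun x _ => (h₁ x).continuousAt.continuousWithinAt)
      (fun x _ => (h₁ x).hasDerivWithinAt)
      (fun x _ => (h₂ x).continuousAt.continuousWithinAt)
      (fun x _ => (h₂ x).hasDerivWithinAt) le_rfl t ⟨hst, le_rfl⟩
  rcases le_total s t with hst | hst
  · exact key v γ₁ γ₂ hK h₁ h₂ s t hst
  · have hneg : ∀ γ : ℝ → E, (∀ t, HasDerivAt γ (v t (γ t)) t) →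
        ∀ t, HasDerivAt (fun τ => γ (-τ)) (-(v (-t) (γ (-t)))) t := by
      intro γ hγ t
      have h := (hγ (-t)).scomp t (hasDerivAt_neg t)
      rw [neg_one_smul] at h
      exact h
    have := key (fun τ x => -(v (-τ) x)) (fun τ => γ₁ (-τ)) (fun τ => γ₂ (-τ))
      (fun τ => (hK (-τ)).neg) (hneg γ₁ h₁) (hneg γ₂ h₂) (-s) (-t) (neg_le_neg hst)
    simp only [neg_neg] at this
    rwa [show -t - -s = -(t - s) by ring, abs_neg] at this

/-- `φ s t` maps the value at time `s` of a solution of `γ' = v(t, γ)` to its value at time `t`. -/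
structure IsFlow (v : ℝ → E → E) (K B : ℝ≥0) (φ : ℝ → ℝ → E → E) : Prop where
  self : ∀ s z, φ s s z = z
  hasDerivAt : ∀ s t z, HasDerivAt (fun τ => φ s τ z) (v t (φ s t z)) t
  comp : ∀ r s t z, φ s t (φ r s z) = φ r t z
  lipschitz : ∀ s t, LipschitzWith (Real.exp (K * |t - s|)).toNNReal (φ s t)
  dist_le : ∀ s t t' z, ‖φ s t z - φ s t' z‖ ≤ B * |t - t'|

theorem exists_integralCurve [CompleteSpace E] {v : ℝ → E → E} {K B : ℝ≥0}
    (hc : ∀ z, Continuous fun t => v t z)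
    (hK : ∀ t, LipschitzWith K (v t)) (hB : ∀ t z, ‖v t z‖ ≤ B) (s : ℝ) (z : E) :
    ∃ γ : ℝ → E, γ s = z ∧ ∀ t, HasDerivAt γ (v t (γ t)) t := by
  have loc : ∀ n : ℕ, ∃ γ : ℝ → E, γ s = z ∧
      ∀ t ∈ Icc (s - (n + 1)) (s + (n + 1)),
        HasDerivWithinAt γ (v t (γ t)) (Icc (s - (n + 1)) (s + (n + 1))) t := by
    intro n
    have hmem : s ∈ Icc (s - ((n : ℝ) + 1)) (s + (n + 1)) := by
      constructor <;> linarith [n.cast_nonneg (α := ℝ)]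
    have hpl : IsPicardLindelof v (tmin := s - ((n : ℝ) + 1)) (tmax := s + (n + 1)) ⟨s, hmem⟩ z
        (B * (n + 1)) 0 B K :=
      { lipschitzOnWith := fun t _ => (hK t).lipschitzOnWith
        continuousOn := fun x _ => (hc x).continuousOn
        norm_le := fun t _ x _ => hB t x
        mul_max_le := by
          simp }
    exact IsPicardLindelof.exists_eq_forall_mem_Icc_hasDerivWithinAt₀ hpl
  choose γ h0 hd using loc
  have hd' : ∀ n : ℕ, ∀ t ∈ Ioo (s - ((n : ℝ) + 1)) (s + (n + 1)), HasDerivAt (γ n) (v t (γ n t)) t :=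
    fun n t ht => (hd n t (Ioo_subset_Icc_self ht)).hasDerivAt (Icc_mem_nhds ht.1 ht.2)
  have huniq : ∀ n m : ℕ, n ≤ m → EqOn (γ n) (γ m) (Icc (s - ((n : ℝ) + 1)) (s + (n + 1))) := by
    intro n m hnm
    have hnm' : (n : ℝ) ≤ m := by exact_mod_cast hnm
    have hsub : Icc (s - ((n : ℝ) + 1)) (s + (n + 1)) ⊆ Icc (s - ((m : ℝ) + 1)) (s + (m + 1)) :=
      Icc_subset_Icc (by linarith) (by linarith)
    have hsub' : Ioo (s - ((n : ℝ) + 1)) (s + (n + 1)) ⊆ Ioo (s - ((m : ℝ) + 1)) (s + (m + 1)) :=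
      Ioo_subset_Ioo (by linarith) (by linarith)
    refine ODE_solution_unique_of_mem_Icc (v := v) (s := fun _ => univ) (K := K) (t₀ := s)
      (fun t _ => (hK t).lipschitzOnWith) ?_ (fun t ht => (hd n t ht).continuousWithinAt) (hd' n)
      (fun _ _ => trivial) (fun t ht => ((hd m t (hsub ht)).continuousWithinAt).mono hsub)
      (fun t ht => hd' m t (hsub' ht)) (fun _ _ => trivial) ((h0 n).trans (h0 m).symm)
    constructor <;> linarith [n.cast_nonneg (α := ℝ)]
  refine ⟨fun t => γ ⌈|t - s|⌉₊ t, h0 _, fun t => ?_⟩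
  set N : ℕ := ⌈|t - s|⌉₊ + 1
  have hN : ∀ t' ∈ Ioo (t - 1) (t + 1), ⌈|t' - s|⌉₊ ≤ N := by
    intro t' ht'
    apply Nat.ceil_le.2
    have h1 := Nat.le_ceil |t - s|
    have h2 : |t' - s| ≤ |t' - t| + |t - s| := abs_sub_le _ _ _
    have h3 : |t' - t| ≤ 1 := abs_le.2 ⟨by linarith [ht'.1], by linarith [ht'.2]⟩
    push_cast [N]
    linarith
  have hIcc : ∀ t' : ℝ, t' ∈ Icc (s - ((⌈|t' - s|⌉₊ : ℝ) + 1)) (s + (⌈|t' - s|⌉₊ + 1)) := by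
    intro t'
    have h1 := Nat.le_ceil |t' - s|
    have h2 := abs_le.1 h1
    constructor <;> linarith
  have heq : ∀ t' ∈ Ioo (t - 1) (t + 1), γ ⌈|t' - s|⌉₊ t' = γ N t' := fun t' ht' =>
    huniq _ _ (hN t' ht') (hIcc t')
  have htN : t ∈ Ioo (s - ((N : ℝ) + 1)) (s + (N + 1)) := by
    have h2 := abs_le.1 (Nat.le_ceil |t - s|)
    push_cast [N]
    constructor <;> linarith
  have hev : (fun t => γ ⌈|t - s|⌉₊ t) =ᶠ[nhds t] γ N :=
    Filter.eventually_of_mem (Ioo_mem_nhds (by linarith) (by linarith)) heq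
  have := (hd' N t htN).congr_of_eventuallyEq hev
  rwa [← heq t ⟨by linarith, by linarith⟩] at this

theorem exists_isFlow [CompleteSpace E] {v : ℝ → E → E} {K B : ℝ≥0}
    (hc : ∀ z, Continuous fun t => v t z)
    (hK : ∀ t, LipschitzWith K (v t)) (hB : ∀ t z, ‖v t z‖ ≤ B) :
    ∃ φ, IsFlow v K B φ := by
  choose γ h0 hd using exists_integralCurve hc hK hB
  refine ⟨fun s t z => γ s z t, h0, fun s t z => hd s z t, fun r s t z => ?_, fun s t => ?_,
    fun s t t' z => ?_⟩
  · have := dist_integralCurve_le hK (hd s (γ r z s)) (hd r z) s t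
    rw [h0, dist_self, zero_mul] at this
    exact dist_le_zero.1 this
  · refine LipschitzWith.of_dist_le_mul fun x y => ?_
    have := dist_integralCurve_le hK (hd s x) (hd s y) s t
    rwa [h0, h0, mul_comm, ← Real.coe_toNNReal _ (Real.exp_pos _).le] at this
  · have := convex_univ.norm_image_sub_le_of_norm_hasDerivWithin_le
      (f := γ s z) (f' := fun t => v t (γ s z t)) (C := B)
      (fun x _ => (hd s z x).hasDerivWithinAt) (fun x _ => hB _ _) (mem_univ t') (mem_univ t)
    simpa using this

namespace IsFlow

variable {v : ℝ → E → E} {K B : ℝ≥0} {φ : ℝ → ℝ → E → E}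

theorem comp_cancel (h : IsFlow v K B φ) (s t : ℝ) (z : E) : φ s t (φ t s z) = z := by
  rw [h.comp, h.self]

theorem continuous_snd (h : IsFlow v K B φ) (s : ℝ) :
    Continuous fun p : ℝ × E => φ s p.1 p.2 := by
  refine continuous_prod_of_continuous_lipschitzWith (fun p : ℝ × E => φ s p.1 p.2) B
    (fun t => (h.lipschitz s t).continuous) (fun z => LipschitzWith.of_dist_le_mul fun t t' => ?_)
  simpa [dist_eq_norm] using h.dist_le s t t' z

theorem continuous_fst (h : IsFlow v K B φ) (t : ℝ) :
    Continuous fun p : ℝ × E => φ p.1 t p.2 := by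
  rw [continuous_iff_continuousAt]
  rintro ⟨s, z⟩
  have heq : (fun p : ℝ × E => φ p.1 t p.2) = fun p => φ s t (φ p.1 s p.2) := by
    funext p
    rw [h.comp]
  rw [heq]
  refine (h.lipschitz s t).continuous.continuousAt.comp ?_
  have hb : ∀ p : ℝ × E, ‖φ p.1 s p.2 - p.2‖ ≤ B * |s - p.1| := by
    intro p
    simpa [h.self] using h.dist_le p.1 s p.1 p.2
  have hlim : Filter.Tendsto (fun p : ℝ × E => φ p.1 s p.2 - p.2) (nhds (s, z)) (nhds 0) := by
    refine squeeze_zero_norm hb ?_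
    have : Continuous fun p : ℝ × E => (B : ℝ) * |s - p.1| := by fun_prop
    simpa using this.tendsto (s, z)
  have h2 := hlim.add (_root_.continuous_snd.tendsto (s, z))
  simp only [sub_add_cancel, zero_add] at h2
  simpa [ContinuousAt, h.self] using h2

theorem eqOn_of_hasDerivWithinAt (h : IsFlow v K B φ) (hK : ∀ t, LipschitzWith K (v t))
    {γ : ℝ → E} {a b : ℝ} (hγ : ContinuousOn γ (Icc a b))
    (hd : ∀ t ∈ Ioc a b, HasDerivWithinAt γ (v t (γ t)) (Iic t) t) :
    ∀ t ∈ Icc a b, γ t = φ b t (γ b) :=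
  ODE_solution_unique_of_mem_Icc_left (v := v) (s := fun _ => univ) (K := K)
    (fun t _ => (hK t).lipschitzOnWith) hγ hd (fun _ _ => trivial)
    (fun t _ => (h.hasDerivAt b t (γ b)).continuousAt.continuousWithinAt)
    (fun t _ => (h.hasDerivAt b t (γ b)).hasDerivWithinAt) (fun _ _ => trivial)
    (h.self b (γ b)).symm

end IsFlow

end Flow

/-! ### The relativistic velocity -/

/-- The Lorentz factor `(1 + |v|²)^{1/2}`. -/
noncomputable def lorentz (v : ℝ × ℝ) : ℝ := Real.sqrt (1 + v.1 ^ 2 + v.2 ^ 2)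

theorem one_le_lorentz (v : ℝ × ℝ) : 1 ≤ lorentz v :=
  Real.one_le_sqrt.2 (by nlinarith [sq_nonneg v.1, sq_nonneg v.2])

theorem lorentz_sq (v : ℝ × ℝ) : lorentz v ^ 2 = 1 + v.1 ^ 2 + v.2 ^ 2 :=
  Real.sq_sqrt (by positivity)

theorem lorentz_pos (v : ℝ × ℝ) : 0 < lorentz v := one_pos.trans_le (one_le_lorentz v)

theorem hasFDerivAt_lorentz (v : ℝ × ℝ) :
    HasFDerivAt lorentz ((v.1 / lorentz v) • ContinuousLinearMap.fst ℝ ℝ ℝ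
      + (v.2 / lorentz v) • ContinuousLinearMap.snd ℝ ℝ ℝ) v := by
  have h1 : HasFDerivAt (fun v : ℝ × ℝ => 1 + v.1 ^ 2 + v.2 ^ 2)
      ((2 * v.1) • ContinuousLinearMap.fst ℝ ℝ ℝ + (2 * v.2) • ContinuousLinearMap.snd ℝ ℝ ℝ) v := by
    have ha := ((hasFDerivAt_fst (𝕜 := ℝ) (p := v)).pow 2)
    have hb := ((hasFDerivAt_snd (𝕜 := ℝ) (p := v)).pow 2)
    convert! (ha.const_add 1).add hb using 2 <;> simp
  have h2 := h1.sqrt (by positivity)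
  refine h2.congr_fderiv ?_
  have : Real.sqrt (1 + v.1 ^ 2 + v.2 ^ 2) = lorentz v := rfl
  have h0 := (lorentz_pos v).ne'
  ext <;> simp [this] <;> field_simp

theorem hasFDerivAt_vhat₁ (v : ℝ × ℝ) :
    HasFDerivAt vhat₁ (((1 + v.2 ^ 2) / lorentz v ^ 3) • ContinuousLinearMap.fst ℝ ℝ ℝ
      + (-(v.1 * v.2) / lorentz v ^ 3) • ContinuousLinearMap.snd ℝ ℝ ℝ) v := by
  have h := (hasFDerivAt_fst (𝕜 := ℝ) (p := v)).mul
    ((hasDerivAt_inv (lorentz_pos v).ne').comp_hasFDerivAt v (hasFDerivAt_lorentz v))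
  have h0 := (lorentz_pos v).ne'
  have hs := lorentz_sq v
  refine HasFDerivAt.congr_fderiv (f := fun v : ℝ × ℝ => v.1 * (lorentz v)⁻¹) h ?_
  ext
  · simp
    field_simp
    linear_combination hs
  · simp
    field_simp

theorem hasFDerivAt_vhat₂ (v : ℝ × ℝ) :
    HasFDerivAt vhat₂ ((-(v.1 * v.2) / lorentz v ^ 3) • ContinuousLinearMap.fst ℝ ℝ ℝ
      + ((1 + v.1 ^ 2) / lorentz v ^ 3) • ContinuousLinearMap.snd ℝ ℝ ℝ) v := by
  have h := (hasFDerivAt_snd (𝕜 := ℝ) (p := v)).mul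
    ((hasDerivAt_inv (lorentz_pos v).ne').comp_hasFDerivAt v (hasFDerivAt_lorentz v))
  have h0 := (lorentz_pos v).ne'
  have hs := lorentz_sq v
  refine HasFDerivAt.congr_fderiv (f := fun v : ℝ × ℝ => v.2 * (lorentz v)⁻¹) h ?_
  ext
  · simp
    field_simp
  · simp
    field_simp
    linear_combination hs

theorem abs_vhat₁_le (v : ℝ × ℝ) : |vhat₁ v| ≤ 1 := by
  change |v.1 / lorentz v| ≤ 1
  rw [abs_div, abs_of_pos (lorentz_pos v), div_le_one (lorentz_pos v)]
  exact Real.abs_le_sqrt (by nlinarith [sq_nonneg v.2])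

theorem abs_vhat₂_le (v : ℝ × ℝ) : |vhat₂ v| ≤ 1 := by
  change |v.2 / lorentz v| ≤ 1
  rw [abs_div, abs_of_pos (lorentz_pos v), div_le_one (lorentz_pos v)]
  exact Real.abs_le_sqrt (by nlinarith [sq_nonneg v.1])

theorem norm_smul_fst_add_smul_snd_le {a b : ℝ} (ha : |a| ≤ 1) (hb : |b| ≤ 1) :
    ‖a • ContinuousLinearMap.fst ℝ ℝ ℝ + b • ContinuousLinearMap.snd ℝ ℝ ℝ‖ ≤ 2 := by
  refine (norm_add_le _ _).trans ?_
  rw [norm_smul, norm_smul]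
  have h1 := ContinuousLinearMap.norm_fst_le ℝ ℝ ℝ
  have h2 := ContinuousLinearMap.norm_snd_le ℝ ℝ ℝ
  calc _ ≤ (1 : ℝ) * 1 + 1 * 1 := by gcongr <;> assumption
    _ = 2 := by norm_num

theorem abs_div_lorentz_cube_le {a : ℝ} {v : ℝ × ℝ} (h : |a| ≤ 1 + v.1 ^ 2 + v.2 ^ 2) :
    |a / lorentz v ^ 3| ≤ 1 := by
  have h0 := lorentz_pos v
  rw [abs_div, abs_of_pos (pow_pos h0 3), div_le_one (pow_pos h0 3)]
  have := one_le_lorentz v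
  have hs := lorentz_sq v
  calc |a| ≤ lorentz v ^ 2 := by rw [hs]; exact h
    _ ≤ lorentz v ^ 3 := pow_le_pow_right₀ this (by norm_num)

theorem lipschitzWith_vhat₁ : LipschitzWith 2 vhat₁ := by
  refine lipschitzWith_of_nnnorm_fderiv_le (𝕜 := ℝ)
    (fun v => (hasFDerivAt_vhat₁ v).differentiableAt) fun v => ?_
  rw [(hasFDerivAt_vhat₁ v).fderiv]
  refine norm_smul_fst_add_smul_snd_le (abs_div_lorentz_cube_le ?_) (abs_div_lorentz_cube_le ?_)
  · rw [abs_of_nonneg (by positivity)]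
    nlinarith [sq_nonneg v.1]
  · rw [abs_le]
    constructor <;> nlinarith [sq_nonneg (v.1 - v.2), sq_nonneg (v.1 + v.2)]

theorem lipschitzWith_vhat₂ : LipschitzWith 2 vhat₂ := by
  refine lipschitzWith_of_nnnorm_fderiv_le (𝕜 := ℝ)
    (fun v => (hasFDerivAt_vhat₂ v).differentiableAt) fun v => ?_
  rw [(hasFDerivAt_vhat₂ v).fderiv]
  refine norm_smul_fst_add_smul_snd_le (abs_div_lorentz_cube_le ?_) (abs_div_lorentz_cube_le ?_)
  · rw [abs_le]
    constructor <;> nlinarith [sq_nonneg (v.1 - v.2), sq_nonneg (v.1 + v.2)]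
  · rw [abs_of_nonneg (by positivity)]
    nlinarith [sq_nonneg v.2]

theorem abs_vhat₁_sub_le (v w : ℝ × ℝ) : |vhat₁ v - vhat₁ w| ≤ 2 * ‖v - w‖ := by
  simpa [dist_eq_norm] using lipschitzWith_vhat₁.dist_le_mul v w

theorem abs_vhat₂_sub_le (v w : ℝ × ℝ) : |vhat₂ v - vhat₂ w| ≤ 2 * ‖v - w‖ := by
  simpa [dist_eq_norm] using lipschitzWith_vhat₂.dist_le_mul v w

/-! ### A volume-contracting one-step approximation of the drift flow -/

/-- The velocity step `v ↦ v + (e₁ + b v̂₂, e₂ - b v̂₁)`. -/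
noncomputable def velocityStep (e : ℝ × ℝ × ℝ) (v : ℝ × ℝ) : ℝ × ℝ :=
  (v.1 + (e.1 + vhat₂ v * e.2.2), v.2 + (e.2.1 - vhat₁ v * e.2.2))

theorem velocityStep_injective {e : ℝ × ℝ × ℝ} (he : |e.2.2| < 1 / 4) :
    Function.Injective (velocityStep e) := by
  intro v w h
  have h1 := congrArg Prod.fst h
  have h2 := congrArg Prod.snd h
  simp only [velocityStep] at h1 h2
  have e1 : v.1 - w.1 = -(vhat₂ v - vhat₂ w) * e.2.2 := by linear_combination h1
  have e2 : v.2 - w.2 = (vhat₁ v - vhat₁ w) * e.2.2 := by linear_combination h2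
  have hle : ‖v - w‖ ≤ 2 * ‖v - w‖ * |e.2.2| := by
    refine norm_prod_le_iff.2 ⟨?_, ?_⟩
    · rw [Prod.fst_sub, e1, Real.norm_eq_abs, abs_mul, abs_neg]
      exact mul_le_mul_of_nonneg_right (abs_vhat₂_sub_le v w) (abs_nonneg _)
    · rw [Prod.snd_sub, e2, Real.norm_eq_abs, abs_mul]
      exact mul_le_mul_of_nonneg_right (abs_vhat₁_sub_le v w) (abs_nonneg _)
  have h0 : ‖v - w‖ ≤ 0 := by nlinarith [norm_nonneg (v - w)]
  exact sub_eq_zero.1 (norm_le_zero_iff.1 h0)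

theorem hasFDerivAt_velocityStep (e : ℝ × ℝ × ℝ) (v : ℝ × ℝ) :
    HasFDerivAt (velocityStep e) ((Matrix.toLin (.finTwoProd ℝ) (.finTwoProd ℝ)
      !![1 + -(v.1 * v.2) / lorentz v ^ 3 * e.2.2, (1 + v.1 ^ 2) / lorentz v ^ 3 * e.2.2;
        -((1 + v.2 ^ 2) / lorentz v ^ 3 * e.2.2),
        1 - -(v.1 * v.2) / lorentz v ^ 3 * e.2.2]).toContinuousLinearMap) v := by
  rw [Matrix.toLin_finTwoProd_toContinuousLinearMap]
  have h := ((hasFDerivAt_fst (𝕜 := ℝ) (p := v)).add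
      (((hasFDerivAt_vhat₂ v).mul_const e.2.2).const_add e.1)).prodMk
    ((hasFDerivAt_snd (𝕜 := ℝ) (p := v)).add
      (((hasFDerivAt_vhat₁ v).mul_const e.2.2).const_sub e.2.1))
  refine HasFDerivAt.congr_fderiv h ?_
  ext <;> simp <;> ring

theorem one_le_det_velocityStep (e : ℝ × ℝ × ℝ) (v : ℝ × ℝ) :
    1 ≤ ((Matrix.toLin (.finTwoProd ℝ) (.finTwoProd ℝ)
      !![1 + -(v.1 * v.2) / lorentz v ^ 3 * e.2.2, (1 + v.1 ^ 2) / lorentz v ^ 3 * e.2.2;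
        -((1 + v.2 ^ 2) / lorentz v ^ 3 * e.2.2),
        1 - -(v.1 * v.2) / lorentz v ^ 3 * e.2.2]).toContinuousLinearMap).det := by
  simp only [LinearMap.det_toContinuousLinearMap, LinearMap.det_toLin, Matrix.det_fin_two_of]
  have h0 := (lorentz_pos v).ne'
  have hs := lorentz_sq v
  have : (1 + -(v.1 * v.2) / lorentz v ^ 3 * e.2.2) * (1 - -(v.1 * v.2) / lorentz v ^ 3 * e.2.2)
      - (1 + v.1 ^ 2) / lorentz v ^ 3 * e.2.2 * -((1 + v.2 ^ 2) / lorentz v ^ 3 * e.2.2)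
      = 1 + (e.2.2 / lorentz v ^ 2) ^ 2 := by
    field_simp
    linear_combination (-e.2.2 ^ 2) * hs
  rw [this]
  nlinarith [sq_nonneg (e.2.2 / lorentz v ^ 2)]

theorem lintegral_velocityStep_le {e : ℝ × ℝ × ℝ} (he : |e.2.2| < 1 / 4) (g : ℝ × ℝ → ℝ≥0∞) :
    ∫⁻ v, g (velocityStep e v) ≤ ∫⁻ v, g v := by
  have h := lintegral_image_eq_lintegral_abs_det_fderiv_mul volume MeasurableSet.univ
    (fun v _ => (hasFDerivAt_velocityStep e v).hasFDerivWithinAt)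
    (velocityStep_injective he).injOn g
  rw [Measure.restrict_univ] at h
  calc ∫⁻ v, g (velocityStep e v) ≤ _ := lintegral_mono fun v => ?_
    _ = _ := h.symm
    _ ≤ ∫⁻ v, g v := setLIntegral_le_lintegral _ _
  have h1 := one_le_det_velocityStep e v
  rw [abs_of_nonneg (one_pos.le.trans h1)]
  exact le_mul_of_one_le_left (zero_le) (ENNReal.one_le_ofReal.2 h1)

/-- A velocity step with frozen position followed by the free transport of the position. -/
noncomputable def phaseStep (τ : ℝ) (e : ℝ → ℝ × ℝ × ℝ) (z : Phase) : Phase :=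
  (z.1 + τ * vhat₁ (velocityStep (e z.1) z.2), velocityStep (e z.1) z.2)

theorem continuous_vhat₁ : Continuous vhat₁ := lipschitzWith_vhat₁.continuous

theorem continuous_vhat₂ : Continuous vhat₂ := lipschitzWith_vhat₂.continuous

theorem lintegral_phaseStep_le {τ : ℝ} {e : ℝ → ℝ × ℝ × ℝ} (hc : Continuous e)
    (he : ∀ x, |(e x).2.2| < 1 / 4) {g : Phase → ℝ≥0∞} (hg : Measurable g) :
    ∫⁻ z, g (phaseStep τ e z) ≤ ∫⁻ z, g z := by
  have c1 := continuous_vhat₁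
  have c2 := continuous_vhat₂
  have hm1 : Measurable fun z : Phase => g (z.1 + τ * vhat₁ z.2, z.2) :=
    hg.comp (by fun_prop)
  have hm2 : Measurable fun z : Phase => velocityStep (e z.1) z.2 := by
    unfold velocityStep
    exact Continuous.measurable (by fun_prop)
  have hm3 : Measurable fun z : Phase => g (phaseStep τ e z) :=
    hm1.comp (measurable_fst.prodMk hm2)
  rw [Measure.volume_eq_prod, lintegral_prod _ hm3.aemeasurable]
  calc ∫⁻ x, ∫⁻ v, g (phaseStep τ e (x, v))
      ≤ ∫⁻ x, ∫⁻ v, g (x + τ * vhat₁ v, v) := lintegral_mono fun x =>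
        lintegral_velocityStep_le (he x) fun v => g (x + τ * vhat₁ v, v)
    _ = ∫⁻ v, ∫⁻ x, g (x + τ * vhat₁ v, v) := lintegral_lintegral_swap hm1.aemeasurable
    _ = ∫⁻ v, ∫⁻ x, g (x, v) := lintegral_congr fun v =>
        lintegral_add_right_eq_self (fun x => g (x, v)) _
    _ = _ := (lintegral_prod_symm _ hg.aemeasurable).symm

/-- Fields that are continuous, bounded by `b` and `ℓ`-Lipschitz in the space variable. -/
structure IsLipschitzField (W : ℝ × ℝ → ℝ × ℝ × ℝ) (b ℓ : ℝ≥0) : Prop where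
  continuous : Continuous W
  norm_le : ∀ p, ‖W p‖ ≤ b
  lipschitz : ∀ t x y, ‖W (t, x) - W (t, y)‖ ≤ ℓ * |x - y|

namespace IsLipschitzField

variable {W : ℝ × ℝ → ℝ × ℝ × ℝ} {b ℓ : ℝ≥0}

theorem continuous_drift (h : IsLipschitzField W b ℓ) : Continuous (drift W) := by
  have c1 := continuous_vhat₁
  have c2 := continuous_vhat₂
  have c3 := h.continuous
  unfold drift
  fun_prop

theorem norm_drift_le (h : IsLipschitzField W b ℓ) (q : ℝ × Phase) :
    ‖drift W q‖ ≤ (1 + 2 * b : ℝ≥0) := by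
  have hW := h.norm_le (q.1, q.2.1)
  obtain ⟨h1, h23⟩ := norm_prod_le_iff.1 hW
  obtain ⟨h2, h3⟩ := norm_prod_le_iff.1 h23
  rw [Real.norm_eq_abs] at h1 h2 h3
  have hb : (0 : ℝ) ≤ b := b.2
  have a1 := abs_vhat₁_le q.2.2
  have a2 := abs_vhat₂_le q.2.2
  push_cast
  refine norm_prod_le_iff.2 ⟨?_, norm_prod_le_iff.2 ⟨?_, ?_⟩⟩ <;>
    simp only [drift, Real.norm_eq_abs]
  · linarith
  · have := abs_mul (vhat₂ q.2.2) (W (q.1, q.2.1)).2.2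
    have := mul_le_mul a2 h3 (abs_nonneg _) one_pos.le
    have := abs_add_le (W (q.1, q.2.1)).1 (vhat₂ q.2.2 * (W (q.1, q.2.1)).2.2)
    linarith
  · have := abs_mul (vhat₁ q.2.2) (W (q.1, q.2.1)).2.2
    have := mul_le_mul a1 h3 (abs_nonneg _) one_pos.le
    have := abs_sub (W (q.1, q.2.1)).2.1 (vhat₁ q.2.2 * (W (q.1, q.2.1)).2.2)
    linarith

theorem lipschitzWith_drift (h : IsLipschitzField W b ℓ) (t : ℝ) :
    LipschitzWith (2 + 2 * ℓ + 2 * b) fun z => drift W (t, z) := by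
  refine LipschitzWith.of_dist_le_mul fun z z' => ?_
  rw [dist_eq_norm, dist_eq_norm]
  set d := ‖z - z'‖
  have hd0 : 0 ≤ d := norm_nonneg _
  obtain ⟨hx, hv⟩ := norm_prod_le_iff.1 (le_refl d)
  rw [Prod.snd_sub] at hv
  rw [Prod.fst_sub, Real.norm_eq_abs] at hx
  have hb : (0 : ℝ) ≤ b := b.2
  have hl : (0 : ℝ) ≤ ℓ := ℓ.2
  have hL := (h.lipschitz t z.1 z'.1).trans (mul_le_mul_of_nonneg_left hx hl)
  obtain ⟨h1, h23⟩ := norm_prod_le_iff.1 hL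
  obtain ⟨h2, h3⟩ := norm_prod_le_iff.1 h23
  have h3b := (norm_prod_le_iff.1 (norm_prod_le_iff.1 (h.norm_le (t, z'.1))).2).2
  simp only [Prod.fst_sub, Prod.snd_sub, Real.norm_eq_abs] at h1 h2 h3 h3b
  have a1 := abs_vhat₁_le z.2
  have a2 := abs_vhat₂_le z.2
  have l1 := (abs_vhat₁_sub_le z.2 z'.2).trans (mul_le_mul_of_nonneg_left hv zero_le_two)
  have l2 := (abs_vhat₂_sub_le z.2 z'.2).trans (mul_le_mul_of_nonneg_left hv zero_le_two)
  have key : ∀ p p' β β' : ℝ, |p| ≤ 1 → |p - p'| ≤ 2 * d → |β - β'| ≤ ℓ * d → |β'| ≤ b →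
      |p * β - p' * β'| ≤ ℓ * d + 2 * b * d := by
    intro p p' β β' hp hpp hβ hβ'
    have e : p * β - p' * β' = p * (β - β') + (p - p') * β' := by ring
    rw [e]
    refine (abs_add_le _ _).trans ?_
    rw [abs_mul, abs_mul]
    have := mul_le_mul hp hβ (abs_nonneg _) one_pos.le
    have := mul_le_mul hpp hβ' (abs_nonneg _) (by positivity)
    linarith
  have k2 := key _ _ _ _ a2 l2 h3 h3b
  have k1 := key _ _ _ _ a1 l1 h3 h3b
  have hbd : 0 ≤ b * d := mul_nonneg hb hd0
  have hld : 0 ≤ ℓ * d := mul_nonneg hl hd0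
  push_cast
  refine norm_prod_le_iff.2 ⟨?_, norm_prod_le_iff.2 ⟨?_, ?_⟩⟩ <;>
    simp only [drift, Real.norm_eq_abs, Prod.fst_sub, Prod.snd_sub]
  · refine l1.trans ?_
    nlinarith
  · rw [add_sub_add_comm]
    refine (abs_add_le _ _).trans ?_
    nlinarith
  · rw [sub_sub_sub_comm]
    refine (abs_sub _ _).trans ?_
    nlinarith

end IsLipschitzField

/-- The drift flow of a field. -/
abbrev IsDriftFlow (W : ℝ × ℝ → ℝ × ℝ × ℝ) (b ℓ : ℝ≥0) (φ : ℝ → ℝ → Phase → Phase) : Prop :=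
  IsFlow (fun t z => drift W (t, z)) (2 + 2 * ℓ + 2 * b) (1 + 2 * b) φ

namespace IsLipschitzField

variable {W : ℝ × ℝ → ℝ × ℝ × ℝ} {b ℓ : ℝ≥0} {φ : ℝ → ℝ → Phase → Phase}

theorem exists_isDriftFlow (h : IsLipschitzField W b ℓ) : ∃ φ, IsDriftFlow W b ℓ φ :=
  exists_isFlow (fun z => h.continuous_drift.comp (by fun_prop)) h.lipschitzWith_drift
    fun t z => h.norm_drift_le (t, z)

/-- The fields integrated over a time interval. -/
noncomputable def timeIntegral (W : ℝ × ℝ → ℝ × ℝ × ℝ) (s t x : ℝ) : ℝ × ℝ × ℝ :=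
  (∫ r in s..t, (W (r, x)).1, ∫ r in s..t, (W (r, x)).2.1, ∫ r in s..t, (W (r, x)).2.2)

theorem continuous_timeIntegral (h : IsLipschitzField W b ℓ) (s t : ℝ) :
    Continuous (timeIntegral W s t) := by
  have c := h.continuous
  unfold timeIntegral
  refine Continuous.prodMk ?_ (Continuous.prodMk ?_ ?_) <;>
  · apply intervalIntegral.continuous_parametric_intervalIntegral_of_continuous'
    unfold Function.uncurry
    fun_prop

theorem norm_velocityStep_timeIntegral_sub_le (h : IsLipschitzField W b ℓ) (s t x : ℝ)
    (v : ℝ × ℝ) :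
    ‖velocityStep (timeIntegral W s t x) v - v‖ ≤ (1 + 2 * b) * |t - s| := by
  have c := h.continuous
  have hi : ∀ f : ℝ × ℝ × ℝ → ℝ, Continuous f →
      IntervalIntegrable (fun r => f (W (r, x))) volume s t := fun f hf =>
    Continuous.intervalIntegrable (by fun_prop) _ _
  have hd : ∀ r, ‖drift W (r, x, v)‖ ≤ 1 + 2 * b := fun r => by
    simpa using h.norm_drift_le (r, x, v)
  have e1 : (velocityStep (timeIntegral W s t x) v - v).1
      = ∫ r in s..t, (drift W (r, x, v)).2.1 := by
    simp only [velocityStep, timeIntegral, drift, Prod.fst_sub]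
    rw [intervalIntegral.integral_add (hi _ (by fun_prop))
      ((hi (fun w => w.2.2) (by fun_prop)).const_mul _), intervalIntegral.integral_const_mul]
    ring
  have e2 : (velocityStep (timeIntegral W s t x) v - v).2
      = ∫ r in s..t, (drift W (r, x, v)).2.2 := by
    simp only [velocityStep, timeIntegral, drift, Prod.snd_sub]
    rw [intervalIntegral.integral_sub (hi (fun w => w.2.1) (by fun_prop))
      ((hi (fun w => w.2.2) (by fun_prop)).const_mul _), intervalIntegral.integral_const_mul]
    ring
  refine norm_prod_le_iff.2 ⟨?_, ?_⟩
  · rw [e1]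
    exact intervalIntegral.norm_integral_le_of_norm_le_const fun r _ =>
      (norm_fst_le _).trans ((norm_snd_le _).trans (hd r))
  · rw [e2]
    exact intervalIntegral.norm_integral_le_of_norm_le_const fun r _ =>
      (norm_snd_le _).trans ((norm_snd_le _).trans (hd r))

theorem norm_flow_sub_phaseStep_le (h : IsLipschitzField W b ℓ) (hφ : IsDriftFlow W b ℓ φ)
    (s t : ℝ) (z : Phase) :
    ‖φ s t z - phaseStep (t - s) (timeIntegral W s t) z‖
      ≤ (4 + 2 * ℓ + 2 * b) * (1 + 2 * b) * |t - s| ^ 2 := by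
  have c := h.continuous
  have cd := h.continuous_drift
  set e := timeIntegral W s t z.1 with he
  set v' := velocityStep e z.2 with hv'
  have hb : (0 : ℝ) ≤ b := b.2
  have hl : (0 : ℝ) ≤ ℓ := ℓ.2
  have hstep : ‖v' - z.2‖ ≤ (1 + 2 * b) * |t - s| :=
    h.norm_velocityStep_timeIntegral_sub_le s t z.1 z.2
  have hflow : ∀ r, ‖φ s r z - z‖ ≤ (1 + 2 * b) * |r - s| := fun r => by
    simpa [hφ.self] using hφ.dist_le s r s z
  have hr : ∀ r ∈ uIoc s t, |r - s| ≤ |t - s| := by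
    intro r hr
    exact abs_sub_left_of_mem_uIcc (uIoc_subset_uIcc hr)
  have hcγ : Continuous fun r => φ s r z :=
    continuous_iff_continuousAt.2 fun r => (hφ.hasDerivAt s r z).continuousAt
  have hcd : Continuous fun r => drift W (r, φ s r z) := cd.comp (by fun_prop)
  have hi : ∀ f : ℝ × ℝ × ℝ → ℝ, Continuous f →
      IntervalIntegrable (fun r => f (W (r, z.1))) volume s t := fun f hf =>
    Continuous.intervalIntegrable (by fun_prop) _ _
  have hi' : ∀ f : Phase → ℝ, Continuous f →
      IntervalIntegrable (fun r => f (drift W (r, φ s r z))) volume s t := fun f hf =>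
    (hf.comp hcd).intervalIntegrable _ _
  have hi'' : ∀ f : Phase → ℝ, Continuous f →
      IntervalIntegrable (fun r => f (drift W (r, z))) volume s t := fun f hf =>
    (hf.comp (cd.comp (by fun_prop))).intervalIntegrable _ _
  have ftc : ∀ f : Phase →L[ℝ] ℝ, ∫ r in s..t, f (drift W (r, φ s r z)) = f (φ s t z) - f z := by
    intro f
    have := intervalIntegral.integral_eq_sub_of_hasDerivAt (a := s) (b := t)
      (fun r _ => f.hasFDerivAt.comp_hasDerivAt r (hφ.hasDerivAt s r z)) (hi' f f.continuous)
    simpa [hφ.self] using this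
  let f1 := ContinuousLinearMap.fst ℝ ℝ (ℝ × ℝ)
  let f2 := (ContinuousLinearMap.fst ℝ ℝ ℝ).comp (ContinuousLinearMap.snd ℝ ℝ (ℝ × ℝ))
  let f3 := (ContinuousLinearMap.snd ℝ ℝ ℝ).comp (ContinuousLinearMap.snd ℝ ℝ (ℝ × ℝ))
  have hdd : ∀ r ∈ uIoc s t, ‖drift W (r, φ s r z) - drift W (r, z)‖
      ≤ (2 + 2 * ℓ + 2 * b) * ((1 + 2 * b) * |t - s|) := by
    intro r hrr
    have := (h.lipschitzWith_drift r).dist_le_mul (φ s r z) z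
    rw [dist_eq_norm, dist_eq_norm] at this
    push_cast at this
    refine this.trans ?_
    gcongr
    exact (hflow r).trans (mul_le_mul_of_nonneg_left (hr r hrr) (by positivity))
  have hpow : |t - s| ^ 2 = |t - s| * |t - s| := sq _
  have hA : 0 ≤ (1 + 2 * b) * |t - s| * |t - s| := by positivity
  refine norm_prod_le_iff.2 ⟨?_, norm_prod_le_iff.2 ⟨?_, ?_⟩⟩
  · have e1 : (φ s t z - phaseStep (t - s) (timeIntegral W s t) z).1
        = ∫ r in s..t, (vhat₁ (φ s r z).2 - vhat₁ v') := by
      have h1 : ∫ r in s..t, vhat₁ (φ s r z).2 = (φ s t z).1 - z.1 := ftc f1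
      rw [intervalIntegral.integral_sub (f := fun r => vhat₁ (φ s r z).2)
        (hi' (fun z => z.1) (by fun_prop)) (by simp), h1]
      simp [phaseStep, ← he, ← hv']
      ring
    rw [e1]
    refine (intervalIntegral.norm_integral_le_of_norm_le_const
      (C := 4 * ((1 + 2 * b) * |t - s|)) fun r hrr => ?_).trans ?_
    · rw [Real.norm_eq_abs]
      refine (abs_vhat₁_sub_le _ _).trans ?_
      have e2 : (φ s r z).2 - v' = (φ s r z - z).2 - (v' - z.2) := by simp
      have := norm_sub_le (φ s r z - z).2 (v' - z.2)
      have := (norm_snd_le (φ s r z - z)).trans (hflow r)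
      have h3 : (1 + 2 * (b : ℝ)) * |r - s| ≤ (1 + 2 * b) * |t - s| :=
        mul_le_mul_of_nonneg_left (hr r hrr) (by positivity)
      rw [e2]
      linarith
    · rw [hpow]
      nlinarith [mul_nonneg hl hA, mul_nonneg hb hA]
  · have e1 : (φ s t z - phaseStep (t - s) (timeIntegral W s t) z).2.1
        = ∫ r in s..t, ((drift W (r, φ s r z)).2.1 - (drift W (r, z)).2.1) := by
      have h1 : ∫ r in s..t, (drift W (r, φ s r z)).2.1 = (φ s t z).2.1 - z.2.1 := ftc f2
      rw [intervalIntegral.integral_sub (hi' (fun z => z.2.1) (by fun_prop))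
        (hi'' (fun z => z.2.1) (by fun_prop)), h1]
      simp only [drift]
      rw [intervalIntegral.integral_add (hi _ (by fun_prop))
        ((hi (fun w => w.2.2) (by fun_prop)).const_mul _), intervalIntegral.integral_const_mul]
      simp [phaseStep, velocityStep, timeIntegral]
      ring
    rw [e1]
    refine (intervalIntegral.norm_integral_le_of_norm_le_const fun r hrr =>
      ((norm_fst_le _).trans (norm_snd_le _)).trans (hdd r hrr)).trans ?_
    rw [hpow]
    nlinarith
  · have e1 : (φ s t z - phaseStep (t - s) (timeIntegral W s t) z).2.2
        = ∫ r in s..t, ((drift W (r, φ s r z)).2.2 - (drift W (r, z)).2.2) := by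
      have h1 : ∫ r in s..t, (drift W (r, φ s r z)).2.2 = (φ s t z).2.2 - z.2.2 := ftc f3
      rw [intervalIntegral.integral_sub (hi' (fun z => z.2.2) (by fun_prop))
        (hi'' (fun z => z.2.2) (by fun_prop)), h1]
      simp only [drift]
      rw [intervalIntegral.integral_sub (hi (fun w => w.2.1) (by fun_prop))
        ((hi (fun w => w.2.2) (by fun_prop)).const_mul _), intervalIntegral.integral_const_mul]
      simp [phaseStep, velocityStep, timeIntegral]
      ring
    rw [e1]
    refine (intervalIntegral.norm_integral_le_of_norm_le_const fun r hrr =>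
      ((norm_snd_le _).trans (norm_snd_le _)).trans (hdd r hrr)).trans ?_
    rw [hpow]
    nlinarith

end IsLipschitzField

/-! ### The drift flow preserves volume -/

namespace IsLipschitzField

variable {W : ℝ × ℝ → ℝ × ℝ × ℝ} {b ℓ : ℝ≥0} {φ : ℝ → ℝ → Phase → Phase}

theorem abs_timeIntegral_snd_snd_le (h : IsLipschitzField W b ℓ) (s t x : ℝ) :
    |(timeIntegral W s t x).2.2| ≤ b * |t - s| :=
  intervalIntegral.norm_integral_le_of_norm_le_const fun r _ =>
    (norm_snd_le _).trans ((norm_snd_le _).trans (h.norm_le (r, x)))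

theorem lintegral_comp_flow_le (h : IsLipschitzField W b ℓ) (hφ : IsDriftFlow W b ℓ φ)
    {g : Phase → ℝ} {Λ : ℝ≥0} (hg : LipschitzWith Λ g) {ρ : ℝ}
    (hsupp : ∀ z, ρ < ‖z‖ → g z = 0) (T R : ℝ) :
    ∃ C : ℝ, 0 ≤ C ∧ ∀ s t, |T - t| ≤ R → |T - s| ≤ R → b * |t - s| < 1 / 4 → |t - s| ≤ 1 →
      ∫⁻ z, ENNReal.ofReal (g (φ s T z)) ≤
        (∫⁻ z, ENNReal.ofReal (g (φ t T z))) + ENNReal.ofReal (C * |t - s| ^ 2) := by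
  set K : ℝ≥0 := 2 + 2 * ℓ + 2 * b
  set V : Set Phase := Metric.closedBall 0 (ρ + (1 + 2 * b) * R + (1 + 2 * b))
  have hV : volume V ≠ ∞ := measure_closedBall_lt_top.ne
  set A : ℝ := (4 + 2 * ℓ + 2 * b) * (1 + 2 * b)
  set D : ℝ := Λ * Real.exp (K * R) * A
  have hD : 0 ≤ D := by positivity
  refine ⟨D * volume.real V, by positivity, fun s t ht hs hbt ht1 => ?_⟩
  set G : Phase → ℝ := fun z => g (φ t T z)
  have hGl : LipschitzWith (Λ * (Real.exp (K * |T - t|)).toNNReal) G :=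
    hg.comp (hφ.lipschitz t T)
  have hGs : ∀ z, ρ + (1 + 2 * b) * R < ‖z‖ → G z = 0 := by
    intro z hz
    apply hsupp
    have h1 := hφ.dist_le t T t z
    rw [hφ.self] at h1
    have h2 := norm_sub_norm_le z (φ t T z)
    rw [norm_sub_rev] at h2
    push_cast at h1
    have h3 : (1 + 2 * (b : ℝ)) * |T - t| ≤ (1 + 2 * b) * R :=
      mul_le_mul_of_nonneg_left ht (by positivity)
    linarith
  set F := phaseStep (t - s) (timeIntegral W s t)
  have hpt : ∀ z, ENNReal.ofReal (g (φ s T z)) ≤ ENNReal.ofReal (G (F z))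
      + V.indicator (fun _ => ENNReal.ofReal (D * |t - s| ^ 2)) z := by
    intro z
    have hz : g (φ s T z) = G (φ s t z) := by simp only [G, hφ.comp]
    rw [hz]
    by_cases hzV : z ∈ V
    · rw [indicator_of_mem hzV]
      refine le_trans (ENNReal.ofReal_le_ofReal ?_) ENNReal.ofReal_add_le
      have h1 := (le_abs_self _).trans (hGl.dist_le_mul (φ s t z) (F z))
      rw [dist_eq_norm] at h1
      have h2 := h.norm_flow_sub_phaseStep_le hφ s t z
      have h3 : Real.exp (K * |T - t|) ≤ Real.exp (K * R) :=
        Real.exp_le_exp.2 (mul_le_mul_of_nonneg_left ht K.2)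
      have h4 : ((Λ * (Real.exp (K * |T - t|)).toNNReal : ℝ≥0) : ℝ) ≤ Λ * Real.exp (K * R) := by
        rw [NNReal.coe_mul, Real.coe_toNNReal _ (Real.exp_pos _).le]
        exact mul_le_mul_of_nonneg_left h3 Λ.2
      have h5 := mul_le_mul h4 h2 (norm_nonneg _) (by positivity)
      have h6 : Λ * Real.exp (K * R) * (A * |t - s| ^ 2) = D * |t - s| ^ 2 := by
        simp only [D]
        ring
      linarith
    · rw [indicator_of_notMem hzV, add_zero]
      have h0 : G (φ s t z) = 0 := by
        apply hGs
        have h1 := hφ.dist_le s t s z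
        rw [hφ.self] at h1
        have h2 := norm_sub_norm_le z (φ s t z)
        rw [norm_sub_rev] at h2
        push_cast at h1
        have h3 : (1 + 2 * (b : ℝ)) * |t - s| ≤ (1 + 2 * b) * 1 :=
          mul_le_mul_of_nonneg_left ht1 (by positivity)
        simp only [V, Metric.mem_closedBall, dist_zero_right, not_le] at hzV
        linarith
      rw [h0, ENNReal.ofReal_zero]
      exact zero_le
  have hFc : Measurable fun z => ENNReal.ofReal (G z) :=
    ENNReal.measurable_ofReal.comp hGl.continuous.measurable
  calc ∫⁻ z, ENNReal.ofReal (g (φ s T z))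
      ≤ ∫⁻ z, (ENNReal.ofReal (G (F z))
          + V.indicator (fun _ => ENNReal.ofReal (D * |t - s| ^ 2)) z) := lintegral_mono hpt
    _ = (∫⁻ z, ENNReal.ofReal (G (F z))) + ENNReal.ofReal (D * |t - s| ^ 2) * volume V := by
        rw [lintegral_add_right _ (measurable_const.indicator measurableSet_closedBall),
          lintegral_indicator_const measurableSet_closedBall]
    _ ≤ _ := by
        refine add_le_add ?_ ?_
        · exact lintegral_phaseStep_le (h.continuous_timeIntegral s t)
            (fun x => (h.abs_timeIntegral_snd_snd_le s t x).trans_lt hbt) hFc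
        · rw [← ENNReal.ofReal_toReal hV, ← ENNReal.ofReal_mul (by positivity)]
          apply ENNReal.ofReal_le_ofReal
          simp only [Measure.real]
          nlinarith

theorem lintegral_comp_flow_ne_top (hφ : IsDriftFlow W b ℓ φ)
    {g : Phase → ℝ} {Λ : ℝ≥0} (hg : LipschitzWith Λ g) {ρ : ℝ}
    (hsupp : ∀ z, ρ < ‖z‖ → g z = 0) (s T : ℝ) :
    ∫⁻ z, ENNReal.ofReal (g (φ s T z)) ≠ ∞ := by
  set V : Set Phase := Metric.closedBall 0 (ρ + (1 + 2 * b) * |T - s|)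
  have hc : Continuous fun z => g (φ s T z) := hg.continuous.comp (hφ.lipschitz s T).continuous
  obtain ⟨M, hM⟩ := (isCompact_closedBall (0 : Phase) (ρ + (1 + 2 * b) * |T - s|)).exists_bound_of_continuousOn
    hc.continuousOn
  have hpt : ∀ z, ENNReal.ofReal (g (φ s T z)) ≤ V.indicator (fun _ => ENNReal.ofReal M) z := by
    intro z
    by_cases hz : z ∈ V
    · rw [indicator_of_mem hz]
      exact ENNReal.ofReal_le_ofReal ((le_abs_self _).trans (hM z hz))
    · rw [indicator_of_notMem hz, hsupp, ENNReal.ofReal_zero]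
      have h1 := hφ.dist_le s T s z
      rw [hφ.self] at h1
      have h2 := norm_sub_norm_le z (φ s T z)
      rw [norm_sub_rev] at h2
      push_cast at h1
      simp only [V, Metric.mem_closedBall, dist_zero_right, not_le] at hz
      linarith
  refine ((lintegral_mono hpt).trans_lt ?_).ne
  rw [lintegral_indicator_const measurableSet_closedBall]
  exact ENNReal.mul_lt_top ENNReal.ofReal_lt_top measure_closedBall_lt_top

theorem lintegral_comp_flow_eq (h : IsLipschitzField W b ℓ) (hφ : IsDriftFlow W b ℓ φ)
    {g : Phase → ℝ} {Λ : ℝ≥0} (hg : LipschitzWith Λ g) {ρ : ℝ}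
    (hsupp : ∀ z, ρ < ‖z‖ → g z = 0) (s T : ℝ) :
    ∫⁻ z, ENNReal.ofReal (g (φ s T z)) = ∫⁻ z, ENNReal.ofReal (g z) := by
  have hfin := fun s => lintegral_comp_flow_ne_top hφ hg hsupp s T
  set H : ℝ → ℝ := fun s => (∫⁻ z, ENNReal.ofReal (g (φ s T z))).toReal
  have hd : ∀ t, HasDerivAt H 0 t := by
    intro t
    obtain ⟨C, hC0, hC⟩ := h.lintegral_comp_flow_le hφ hg hsupp T (|T - t| + 1)
    have hreal : ∀ s t', |T - t'| ≤ |T - t| + 1 → |T - s| ≤ |T - t| + 1 → b * |t' - s| < 1 / 4 →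
        |t' - s| ≤ 1 → H s - H t' ≤ C * |t' - s| ^ 2 := by
      intro s t' h1 h2 h3 h4
      have := ENNReal.toReal_mono (ENNReal.add_ne_top.2 ⟨hfin t', ENNReal.ofReal_ne_top⟩)
        (hC s t' h1 h2 h3 h4)
      rw [ENNReal.toReal_add (hfin t') ENNReal.ofReal_ne_top,
        ENNReal.toReal_ofReal (by positivity)] at this
      simp only [H]
      linarith
    rw [hasDerivAt_iff_isLittleO]
    simp only [smul_zero, sub_zero]
    refine Asymptotics.IsBigO.trans_isLittleO ?_
      (Asymptotics.isLittleO_pow_sub_sub t (m := 2) one_lt_two)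
    refine Asymptotics.IsBigO.of_bound C ?_
    have hev1 : ∀ᶠ s in nhds t, b * |t - s| < 1 / 4 := by
      have : Continuous fun s => (b : ℝ) * |t - s| := by fun_prop
      exact this.continuousAt.eventually_lt continuousAt_const (by simp)
    have hev2 : ∀ᶠ s in nhds t, |t - s| < 1 := by
      have : Continuous fun s => |t - s| := by fun_prop
      exact this.continuousAt.eventually_lt continuousAt_const (by simp)
    filter_upwards [hev1, hev2] with s hs1 hs2
    have hTs : |T - s| ≤ |T - t| + 1 := (abs_sub_le T t s).trans (by linarith)
    have hTt : |T - t| ≤ |T - t| + 1 := by linarith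
    have k1 := hreal s t hTt hTs hs1 hs2.le
    have k2 := hreal t s hTs hTt (by rwa [abs_sub_comm]) (by rw [abs_sub_comm]; exact hs2.le)
    rw [abs_sub_comm t s] at k1
    simp only [norm_pow, Real.norm_eq_abs, abs_abs]
    exact abs_le.2 ⟨by linarith, k1⟩
  have hconst := is_const_of_deriv_eq_zero (fun t => (hd t).differentiableAt)
    (fun t => (hd t).deriv) s T
  have := (ENNReal.toReal_eq_toReal_iff' (hfin s) (hfin T)).1 hconst
  rw [this]
  simp only [hφ.self]

theorem measurePreserving_flow (h : IsLipschitzField W b ℓ) (hφ : IsDriftFlow W b ℓ φ)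
    (s t : ℝ) : MeasurePreserving (φ s t) volume volume := by
  let e : Phase ≃ₜ Phase :=
    { toFun := φ s t
      invFun := φ t s
      left_inv := fun z => hφ.comp_cancel t s z
      right_inv := fun z => hφ.comp_cancel s t z
      continuous_toFun := (hφ.lipschitz s t).continuous
      continuous_invFun := (hφ.lipschitz t s).continuous }
  have hcont : Continuous (φ s t) := (hφ.lipschitz s t).continuous
  refine ⟨hcont.measurable, ?_⟩
  have hreg : (Measure.map (φ s t) volume).Regular := Measure.Regular.map e
  refine Measure.OuterRegular.ext_isOpen_isBounded fun U hU hUb => ?_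
  rw [Measure.map_apply hcont.measurable hU.measurableSet]
  obtain ⟨ρ, hρ⟩ := hUb.subset_closedBall 0
  by_cases hUc : (Uᶜ).Nonempty
  swap
  · rw [not_nonempty_iff_eq_empty, compl_empty_iff] at hUc
    rw [hUc, preimage_univ]
  let g : ℕ → Phase → ℝ := fun n z => min 1 (n * Metric.infDist z Uᶜ)
  have hgL : ∀ n : ℕ, LipschitzWith n (g n) := by
    intro n
    have h1 : LipschitzWith n fun z : Phase => (n : ℝ) * Metric.infDist z Uᶜ := by
      refine LipschitzWith.of_dist_le_mul fun x y => ?_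
      rw [Real.dist_eq, ← mul_sub, abs_mul, Nat.abs_cast, NNReal.coe_natCast]
      refine mul_le_mul_of_nonneg_left ?_ n.cast_nonneg
      simpa [Real.dist_eq] using (Metric.lipschitz_infDist_pt Uᶜ).dist_le_mul x y
    exact h1.const_min 1
  have hgs : ∀ n z, ρ < ‖z‖ → g n z = 0 := by
    intro n z hz
    have hzU : z ∈ Uᶜ := fun hzU => by
      have := hρ hzU
      rw [mem_closedBall_zero_iff] at this
      linarith
    simp [g, Metric.infDist_zero_of_mem hzU]
  have hmono : Monotone fun n z => ENNReal.ofReal (g n z) := by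
    intro n m hnm z
    apply ENNReal.ofReal_le_ofReal
    refine min_le_min_left _ (mul_le_mul_of_nonneg_right ?_ Metric.infDist_nonneg)
    exact_mod_cast hnm
  have hsup : ∀ z, ⨆ n, ENNReal.ofReal (g n z) = U.indicator 1 z := by
    intro z
    by_cases hz : z ∈ U
    · rw [indicator_of_mem hz]
      refine le_antisymm (iSup_le fun n => ?_) ?_
      · exact ENNReal.ofReal_le_one.2 (min_le_left _ _)
      · have hpos : 0 < Metric.infDist z Uᶜ :=
          (hU.isClosed_compl.notMem_iff_infDist_pos hUc).1 (by simpa using hz)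
        obtain ⟨n, hn⟩ := exists_nat_ge (1 / Metric.infDist z Uᶜ)
        refine le_iSup_of_le n ?_
        have h1 : g n z = 1 := min_eq_left ((div_le_iff₀ hpos).1 hn)
        rw [h1]
        simp
    · rw [indicator_of_notMem hz]
      have h1 : ∀ n, g n z = 0 := fun n => by simp [g, Metric.infDist_zero_of_mem (mem_compl hz)]
      simp [h1]
  have hgm : ∀ n, Measurable fun z => ENNReal.ofReal (g n z) := fun n =>
    ENNReal.measurable_ofReal.comp (hgL n).continuous.measurable
  have e1 : volume U = ⨆ n, ∫⁻ z, ENNReal.ofReal (g n z) := by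
    rw [← lintegral_iSup hgm hmono, lintegral_congr hsup, lintegral_indicator_one hU.measurableSet]
  have e2 : volume (φ s t ⁻¹' U) = ⨆ n, ∫⁻ z, ENNReal.ofReal (g n (φ s t z)) := by
    rw [← lintegral_iSup (f := fun n z => ENNReal.ofReal (g n (φ s t z)))
      (fun n => (hgm n).comp hcont.measurable) (fun n m hnm z => hmono hnm _),
      lintegral_congr fun z => hsup (φ s t z)]
    exact (lintegral_indicator_one (hcont.measurable hU.measurableSet)).symm
  rw [e1, e2]
  exact iSup_congr fun n => h.lintegral_comp_flow_eq hφ (hgL n) (hgs n) s t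

end IsLipschitzField

/-! ### Functions along Lipschitz paths -/

theorem abs_sub_le_of_closed_cover {ι : Type*} [Finite ι] {θ : ℝ → ℝ} {a b K : ℝ}
    (hθ : ContinuousOn θ (Icc a b)) (C : ι → Set ℝ) (hC : ∀ i, IsClosed (C i))
    (hcov : Icc a b ⊆ ⋃ i, C i)
    (hlip : ∀ i, ∀ s ∈ C i ∩ Icc a b, ∀ t ∈ C i ∩ Icc a b, |θ s - θ t| ≤ K * |s - t|)
    {s t : ℝ} (hs : s ∈ Icc a b) (ht : t ∈ Icc a b) : |θ s - θ t| ≤ K * |s - t| := by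
  wlog hst : s ≤ t generalizing s t
  · rw [abs_sub_comm, abs_sub_comm s t]
    exact this ht hs (le_of_not_ge hst)
  have hsub : Icc s t ⊆ Icc a b := Icc_subset_Icc hs.1 ht.2
  have key := image_le_of_liminf_slope_right_le_deriv_boundary (a := s) (b := t)
    (f := fun r => |θ r - θ s|) (B := fun r => K * (r - s)) (B' := fun _ => K)
    (by
      have := hθ.mono hsub
      fun_prop)
    (by simp) (by fun_prop)
    (fun x _ => by simpa using (((hasDerivAt_id x).sub_const s).const_mul K).hasDerivWithinAt)
    (by
      intro x hx r hr
      have hnear : ∀ᶠ z in nhdsWithin x (Ioi x), z ∈ Icc s t :=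
        Filter.mem_of_superset (Ioo_mem_nhdsGT hx.2)
          fun z hz => ⟨hx.1.trans hz.1.le, hz.2.le⟩
      have hfreq : ∃ i, ∃ᶠ z in nhdsWithin x (Ioi x), z ∈ C i := by
        by_contra hcon
        push Not at hcon
        have h1 := Filter.eventually_all.2 hcon
        obtain ⟨z, hz1, hz2⟩ := (h1.and hnear).exists
        obtain ⟨i, hi⟩ := mem_iUnion.1 (hcov (hsub hz2))
        exact hz1 i hi
      obtain ⟨i, hi⟩ := hfreq
      have hxi : x ∈ C i := (hC i).mem_of_frequently_of_tendsto hi nhdsWithin_le_nhds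
      refine ((hi.and_eventually hnear).and_eventually self_mem_nhdsWithin).mono ?_
      rintro z ⟨⟨hzi, hzI⟩, hzx⟩
      have hzx' : 0 < z - x := sub_pos.2 hzx
      refine lt_of_le_of_lt ?_ hr
      rw [slope_def_field, div_le_iff₀ hzx']
      have h1 := hlip i z ⟨hzi, hsub hzI⟩ x ⟨hxi, hsub (Ico_subset_Icc_self hx)⟩
      rw [abs_of_pos hzx'] at h1
      have h2 := abs_sub_abs_le_abs_sub (θ z - θ s) (θ x - θ s)
      rw [sub_sub_sub_cancel_right] at h2
      linarith)
  have := key (right_mem_Icc.2 hst)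
  rw [abs_sub_comm, abs_sub_comm s t, abs_of_nonneg (sub_nonneg.2 hst)]
  exact this

section Path

variable {E : Type*} [NormedAddCommGroup E] [NormedSpace ℝ E]

theorem abs_comp_sub_le_integral {χ : E → ℝ} (hχ : ContDiff ℝ 1 χ) {ℓ : ℝ≥0}
    {P : ℝ → E} (hP : LipschitzWith ℓ P) :
    |χ (P 1) - χ (P 0)| ≤ ∫ s in (0 : ℝ)..1, ℓ * ‖fderiv ℝ χ (P s)‖ := by
  have hcN : Continuous fun s => (ℓ : ℝ) * ‖fderiv ℝ χ (P s)‖ :=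
    continuous_const.mul ((hχ.continuous_fderiv one_ne_zero).comp hP.continuous).norm
  have hd : ∀ s, ‖deriv (χ ∘ P) s‖ ≤ ℓ * ‖fderiv ℝ χ (P s)‖ := by
    intro s
    refine le_of_forall_pos_le_add fun ε hε => ?_
    set η : ℝ := ε / (ℓ + 1)
    have hη : 0 < η := by positivity
    have h1 : ∀ᶠ y in nhds (P s), ‖χ y - χ (P s)‖ ≤ (‖fderiv ℝ χ (P s)‖ + η) * ‖y - P s‖ := by
      have := (hχ.differentiable one_ne_zero (P s)).hasFDerivAt.isLittleO.def hη
      filter_upwards [this] with y hy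
      have h2 : ‖χ y - χ (P s)‖ ≤ ‖χ y - χ (P s) - fderiv ℝ χ (P s) (y - P s)‖
          + ‖fderiv ℝ χ (P s) (y - P s)‖ := by
        simpa using norm_add_le (χ y - χ (P s) - fderiv ℝ χ (P s) (y - P s))
          (fderiv ℝ χ (P s) (y - P s))
      have h3 := (fderiv ℝ χ (P s)).le_opNorm (y - P s)
      linarith
    have h2 : ∀ᶠ r in nhds s, ‖(χ ∘ P) r - (χ ∘ P) s‖
        ≤ ((‖fderiv ℝ χ (P s)‖ + η) * ℓ) * ‖r - s‖ := by
      filter_upwards [hP.continuous.continuousAt.eventually h1] with r hr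
      refine hr.trans ?_
      rw [mul_assoc]
      refine mul_le_mul_of_nonneg_left ?_ (by positivity)
      simpa [dist_eq_norm] using hP.dist_le_mul r s
    refine (norm_deriv_le_of_lip' (by positivity) h2).trans ?_
    have h3 : η * ℓ ≤ ε := by
      simp only [η]
      rw [div_mul_eq_mul_div, div_le_iff₀ (by positivity)]
      nlinarith
    linarith
  have hac : AbsolutelyContinuousOnInterval (χ ∘ P) 0 1 := by
    obtain ⟨C, hC⟩ := hχ.locallyLipschitz.locallyLipschitzOn.exists_lipschitzOnWith_of_compact
      (isCompact_uIcc.image hP.continuous : IsCompact (P '' uIcc 0 1))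
    exact (hC.comp hP.lipschitzOnWith (mapsTo_image P _)).absolutelyContinuousOnInterval
  have hftc := hac.integral_deriv_eq_sub
  simp only [Function.comp_apply] at hftc
  rw [← hftc]
  exact intervalIntegral.norm_integral_le_of_norm_le zero_le_one
    (Filter.Eventually.of_forall fun s _ => hd s) (hcN.intervalIntegrable _ _)

theorem sq_integral_le_integral_sq {F : ℝ → ℝ} (hF : Continuous F) :
    (∫ s in (0 : ℝ)..1, F s) ^ 2 ≤ ∫ s in (0 : ℝ)..1, F s ^ 2 := by
  set m := ∫ s in (0 : ℝ)..1, F s with hm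
  have h0 : 0 ≤ ∫ s in (0 : ℝ)..1, (F s - m) ^ 2 :=
    intervalIntegral.integral_nonneg zero_le_one fun s _ => sq_nonneg _
  have e : ∀ s, (F s - m) ^ 2 = F s ^ 2 - (2 * m) * F s + m ^ 2 := fun s => by ring
  simp only [e] at h0
  rw [intervalIntegral.integral_add (Continuous.intervalIntegrable (by fun_prop) _ _) (by simp),
    intervalIntegral.integral_sub (Continuous.intervalIntegrable (by fun_prop) _ _)
      (Continuous.intervalIntegrable (by fun_prop) _ _),
    intervalIntegral.integral_const_mul, ← hm] at h0
  simp at h0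
  nlinarith

theorem lintegral_sq_comp_sub_le [FiniteDimensional ℝ E] [MeasurableSpace E] [BorelSpace E]
    {μ : Measure E} [SFinite μ] {χ : E → ℝ} (hχ : ContDiff ℝ 1 χ) {ℓ : ℝ≥0} {P : ℝ → E → E}
    (hPc : Continuous fun p : ℝ × E => P p.1 p.2) (hP : ∀ z, LipschitzWith ℓ fun s => P s z)
    (hm : ∀ s, MeasurePreserving (P s) μ μ) :
    ∫⁻ z, ENNReal.ofReal ((χ (P 1 z) - χ (P 0 z)) ^ 2) ∂μ
      ≤ ENNReal.ofReal (ℓ ^ 2) * ∫⁻ z, ENNReal.ofReal (‖fderiv ℝ χ z‖ ^ 2) ∂μ := by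
  have hcf := hχ.continuous_fderiv one_ne_zero
  have hcN : Continuous fun z => ‖fderiv ℝ χ z‖ := hcf.norm
  have hpt : ∀ z, ENNReal.ofReal ((χ (P 1 z) - χ (P 0 z)) ^ 2)
      ≤ ∫⁻ s in Ioc (0 : ℝ) 1, ENNReal.ofReal (ℓ ^ 2) * ENNReal.ofReal (‖fderiv ℝ χ (P s z)‖ ^ 2) := by
    intro z
    have hc : Continuous fun s => (ℓ : ℝ) * ‖fderiv ℝ χ (P s z)‖ :=
      continuous_const.mul (hcN.comp (hP z).continuous)
    have hi : IntegrableOn (fun s => ((ℓ : ℝ) * ‖fderiv ℝ χ (P s z)‖) ^ 2) (Ioc 0 1) :=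
      (hc.pow 2).integrableOn_Ioc
    have h1 := abs_comp_sub_le_integral hχ (hP z)
    have h2 := (sq_le_sq' (by linarith [neg_abs_le (χ (P 1 z) - χ (P 0 z))])
      ((le_abs_self _).trans h1)).trans (sq_integral_le_integral_sq hc)
    refine (ENNReal.ofReal_le_ofReal h2).trans (le_of_eq ?_)
    rw [intervalIntegral.integral_of_le zero_le_one, ofReal_integral_eq_lintegral_ofReal
      hi (Filter.Eventually.of_forall fun s => sq_nonneg _)]
    refine lintegral_congr fun s => ?_
    rw [mul_pow, ENNReal.ofReal_mul (by positivity)]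
  refine (lintegral_mono hpt).trans ?_
  have hmeas : Measurable fun p : E × ℝ =>
      ENNReal.ofReal (ℓ ^ 2) * ENNReal.ofReal (‖fderiv ℝ χ (P p.2 p.1)‖ ^ 2) := by
    have : Continuous fun p : E × ℝ => ‖fderiv ℝ χ (P p.2 p.1)‖ ^ 2 :=
      (hcN.comp (hPc.comp continuous_swap)).pow 2
    exact (ENNReal.measurable_ofReal.comp this.measurable).const_mul _
  rw [lintegral_lintegral_swap hmeas.aemeasurable]
  have hin : ∀ s, ∫⁻ z, ENNReal.ofReal (ℓ ^ 2) * ENNReal.ofReal (‖fderiv ℝ χ (P s z)‖ ^ 2) ∂μ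
      = ENNReal.ofReal (ℓ ^ 2) * ∫⁻ z, ENNReal.ofReal (‖fderiv ℝ χ z‖ ^ 2) ∂μ := by
    intro s
    have hmz : Measurable fun z => ENNReal.ofReal (‖fderiv ℝ χ z‖ ^ 2) :=
      ENNReal.measurable_ofReal.comp (hcN.pow 2).measurable
    rw [lintegral_const_mul (f := fun z => ENNReal.ofReal (‖fderiv ℝ χ (P s z)‖ ^ 2)) _
      (hmz.comp (hm s).measurable), (hm s).lintegral_comp hmz]
  simp only [hin]
  simp

end Path

/-! ### Geometry of the mesh -/

theorem exists_mem_Icc_of_partition {x : ℕ → ℝ} {N : ℕ} {y : ℝ} (hN : x 0 < x N) (hy : y ∈ Icc (x 0) (x N)) :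
    ∃ j < N, y ∈ Icc (x j) (x (j + 1)) := by
  by_contra hcon
  push Not at hcon
  have h : ∀ j ≤ N, x j ≤ y := by
    intro j
    induction j with
    | zero => exact fun _ => hy.1
    | succ j ih =>
      intro hj
      have h1 := hcon j hj
      have h2 := ih (by omega)
      simp only [mem_Icc, not_and, not_le] at h1
      exact (h1 h2).le
  have hyN : y = x N := le_antisymm hy.2 (h N le_rfl)
  rcases N with _ | N
  · exact lt_irrefl _ hN
  · exact hcon N (Nat.lt_succ_self N) ⟨h N (Nat.le_succ N), hyN.le⟩

theorem exists_barycentric {s : Finset (ℝ × ℝ)} (hi : AffineIndependent ℝ ((↑) : s → ℝ × ℝ))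
    (hc : s.card = 3) :
    ∃ β : ℝ × ℝ → (ℝ × ℝ) →ᵃ[ℝ] ℝ, (∀ v, ∑ a ∈ s, β a v = 1) ∧ (∀ v, ∑ a ∈ s, β a v • a = v) ∧
      (∀ v, v ∈ convexHull ℝ (s : Set (ℝ × ℝ)) ↔ ∀ a ∈ s, 0 ≤ β a v) ∧
      (∀ a ∈ s, ∀ b ∈ s, β a b = if a = b then 1 else 0) ∧ ∀ a ∉ s, β a = 0 := by
  classical
  have htop : affineSpan ℝ (range ((↑) : s → ℝ × ℝ)) = ⊤ := by
    rw [hi.affineSpan_eq_top_iff_card_eq_finrank_add_one]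
    simp [hc]
  let B : AffineBasis s ℝ (ℝ × ℝ) := ⟨(↑), hi, htop⟩
  have hB : ∀ i, B i = (i : ℝ × ℝ) := fun _ => rfl
  refine ⟨fun a => if h : a ∈ s then B.coord ⟨a, h⟩ else 0, fun v => ?_, fun v => ?_, fun v => ?_,
    fun a ha b hb => ?_, fun a ha => by simp [ha]⟩
  · rw [← B.sum_coord_apply_eq_one v, ← Finset.sum_coe_sort s]
    simp
  · conv_rhs => rw [← B.linear_combination_coord_eq_self v]
    rw [← Finset.sum_coe_sort s]
    simp [hB]
  · have h1 := B.convexHull_eq_nonneg_coord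
    have h2 : range B = (s : Set (ℝ × ℝ)) := by
      ext w
      simp [hB]
    rw [h2] at h1
    rw [h1]
    simp only [mem_ofPred_eq, Subtype.forall]
    exact forall₂_congr fun a ha => by simp [ha]
  · simp only [ha, dif_pos]
    have := B.coord_apply ⟨a, ha⟩ ⟨b, hb⟩
    rw [hB] at this
    simpa using this

theorem affineMap_sum_smul {s : Finset (ℝ × ℝ)} (f : (ℝ × ℝ) →ᵃ[ℝ] ℝ) {w : ℝ × ℝ → ℝ}
    (hw : ∑ a ∈ s, w a = 1) : f (∑ a ∈ s, w a • a) = ∑ a ∈ s, w a * f a := by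
  have hdec : ∀ v, f v = f.linear v + f 0 := fun v => by
    simpa using congrFun f.decomp v
  rw [hdec, map_sum]
  simp only [map_smul, smul_eq_mul]
  have : ∀ a ∈ s, w a * f a = w a * f.linear a + w a * f 0 := fun a _ => by rw [hdec a]; ring
  rw [Finset.sum_congr rfl this, Finset.sum_add_distrib, ← Finset.sum_mul, hw, one_mul]

namespace PhaseMesh

variable {T α β : ℝ} {Ωv : Set (ℝ × ℝ)} (𝒯 : PhaseMesh T α β Ωv)

theorem triangles_finite : 𝒯.triangles.Finite := 𝒯.tri_finite.subset fun _ h => h.1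

theorem convexHull_subset_closure {s : Finset (ℝ × ℝ)} (hs : s ∈ 𝒯.triangles) :
    convexHull ℝ (s : Set (ℝ × ℝ)) ⊆ closure Ωv :=
  𝒯.tri_space ▸ 𝒯.tri.convexHull_subset_space hs.1

theorem isCompact_convexHull (s : Finset (ℝ × ℝ)) : IsCompact (convexHull ℝ (s : Set (ℝ × ℝ))) :=
  Set.Finite.isCompact_convexHull (𝕜 := ℝ) s.finite_toSet

theorem volume_convexHull_of_card_le_two {s : Finset (ℝ × ℝ)} (hs : s.card ≤ 2) :
    volume (convexHull ℝ (s : Set (ℝ × ℝ))) = 0 := by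
  refine measure_mono_null (convexHull_subset_affineSpan (𝕜 := ℝ) (s : Set (ℝ × ℝ))) ?_
  refine Measure.addHaar_affineSubspace _ _ fun htop => ?_
  rcases s.eq_empty_or_nonempty with rfl | hne
  · simp at htop
  · have h1 := finrank_vectorSpan_range_le ℝ ((↑) : s → ℝ × ℝ) (n := s.card - 1)
      (by have := hne.card_pos; simp; omega)
    have h2 : vectorSpan ℝ (range ((↑) : s → ℝ × ℝ)) = ⊤ := by
      rw [← direction_affineSpan]
      have : range ((↑) : s → ℝ × ℝ) = (s : Set (ℝ × ℝ)) := by ext; simp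
      rw [this, htop, AffineSubspace.direction_top]
    rw [h2, finrank_top] at h1
    simp at h1
    omega

theorem closure_eq_iUnion_triangles (hreg : Ωv = interior (closure Ωv)) :
    closure Ωv = ⋃ s ∈ 𝒯.triangles, convexHull ℝ (s : Set (ℝ × ℝ)) := by
  have hclosed : IsClosed (⋃ s ∈ 𝒯.triangles, convexHull ℝ (s : Set (ℝ × ℝ))) :=
    𝒯.triangles_finite.isClosed_biUnion fun s _ => (isCompact_convexHull s).isClosed
  refine Subset.antisymm (closure_minimal ?_ hclosed)
    (iUnion₂_subset fun s hs => 𝒯.convexHull_subset_closure hs)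
  by_contra hcon
  have hΩo : IsOpen Ωv := by
    rw [hreg]
    exact isOpen_interior
  have hO : IsOpen (Ωv \ ⋃ s ∈ 𝒯.triangles, convexHull ℝ (s : Set (ℝ × ℝ))) :=
    hΩo.sdiff hclosed
  have hne : (Ωv \ ⋃ s ∈ 𝒯.triangles, convexHull ℝ (s : Set (ℝ × ℝ))).Nonempty := by
    obtain ⟨v, hv, hv'⟩ := not_subset.1 hcon
    exact ⟨v, hv, hv'⟩
  refine (hO.measure_pos volume hne).ne' ?_
  refine measure_mono_null (t := ⋃ s ∈ {s ∈ 𝒯.tri.faces | s.card ≤ 2},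
    convexHull ℝ (s : Set (ℝ × ℝ))) ?_ ?_
  · rintro v ⟨hv, hv'⟩
    have hv2 : v ∈ 𝒯.tri.space := 𝒯.tri_space ▸ subset_closure hv
    obtain ⟨s, hs, hvs⟩ := 𝒯.tri.mem_space_iff.1 hv2
    have hcard : s.card ≤ 3 := by
      have := (𝒯.tri.indep hs).card_le_finrank_succ
      have h2 := Submodule.finrank_le (vectorSpan ℝ (range ((↑) : s → ℝ × ℝ)))
      simp at this h2
      omega
    have hne3 : s.card ≠ 3 := fun h3 => hv' (mem_iUnion₂.2 ⟨s, ⟨hs, h3⟩, hvs⟩)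
    exact mem_iUnion₂.2 ⟨s, ⟨hs, by omega⟩, hvs⟩
  · refine (measure_biUnion_null_iff (𝒯.tri_finite.subset fun s h => h.1).countable).2
      fun s hs => volume_convexHull_of_card_le_two hs.2

theorem exists_triangle_mem (hreg : Ωv = interior (closure Ωv)) {v : ℝ × ℝ}
    (hv : v ∈ closure Ωv) : ∃ s ∈ 𝒯.triangles, v ∈ convexHull ℝ (s : Set (ℝ × ℝ)) := by
  rw [𝒯.closure_eq_iUnion_triangles hreg] at hv
  simpa using hv

theorem exists_interval_mem (hαβ : α < β) {x : ℝ} (hx : x ∈ Icc α β) :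
    ∃ j < 𝒯.N, x ∈ Icc (𝒯.x j) (𝒯.x (j + 1)) := by
  refine exists_mem_Icc_of_partition ?_ ?_ <;> rw [𝒯.x_zero, 𝒯.x_last]
  exacts [hαβ, hx]

theorem x_mem_Icc {j : ℕ} (hj : j ≤ 𝒯.N) : 𝒯.x j ∈ Icc α β := by
  constructor
  · have : ∀ j ≤ 𝒯.N, α ≤ 𝒯.x j := by
      intro j
      induction j with
      | zero => exact fun _ => 𝒯.x_zero.ge
      | succ j ih => exact fun h => (ih (by omega)).trans (𝒯.x_lt j h).le
    exact this j hj
  · have : ∀ k ≤ 𝒯.N, 𝒯.x (𝒯.N - k) ≤ β := by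
      intro k
      induction k with
      | zero => exact fun _ => 𝒯.x_last.le
      | succ k ih =>
        intro h
        have h1 := 𝒯.x_lt (𝒯.N - (k + 1)) (by omega)
        rw [show 𝒯.N - (k + 1) + 1 = 𝒯.N - k by omega] at h1
        exact h1.le.trans (ih (by omega))
    have := this (𝒯.N - j) (by omega)
    rwa [Nat.sub_sub_self hj] at this

/-- The interior of the space-velocity element `τ_x × τ_v`. -/
def elementInterior (j : ℕ) (s : Finset (ℝ × ℝ)) : Set Phase :=
  Ioo (𝒯.x j) (𝒯.x (j + 1)) ×ˢ interior (convexHull ℝ (s : Set (ℝ × ℝ)))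

theorem isOpen_elementInterior (j : ℕ) (s : Finset (ℝ × ℝ)) : IsOpen (𝒯.elementInterior j s) :=
  isOpen_Ioo.prod isOpen_interior

theorem elementInterior_subset (hreg : Ωv = interior (closure Ωv)) {j : ℕ} (hj : j < 𝒯.N)
    {s : Finset (ℝ × ℝ)} (hs : s ∈ 𝒯.triangles) :
    𝒯.elementInterior j s ⊆ phaseDomain α β Ωv := by
  refine prod_mono (Ioo_subset_Ioo (𝒯.x_mem_Icc hj.le).1 (𝒯.x_mem_Icc hj).2) ?_
  conv_rhs => rw [hreg]
  exact interior_mono (𝒯.convexHull_subset_closure hs)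

theorem ae_mem_elementInterior (hαβ : α < β) (hreg : Ωv = interior (closure Ωv)) :
    ∀ᵐ z : Phase, z ∈ phaseDomain α β Ωv →
      ∃ j < 𝒯.N, ∃ s ∈ 𝒯.triangles, z ∈ 𝒯.elementInterior j s := by
  have h1 : ∀ᵐ x : ℝ, ∀ j, x ≠ 𝒯.x j := by
    rw [ae_all_iff]
    exact fun j => by simp [ae_iff]
  have h2 : ∀ᵐ v : ℝ × ℝ, ∀ s ∈ 𝒯.triangles, v ∉ frontier (convexHull ℝ (s : Set (ℝ × ℝ))) := by
    rw [ae_ball_iff 𝒯.triangles_finite.countable]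
    intro s _
    exact measure_eq_zero_iff_ae_notMem.1 ((convex_convexHull ℝ _).addHaar_frontier volume)
  have h1' : ∀ᵐ z : Phase, ∀ j, z.1 ≠ 𝒯.x j := by
    rw [Measure.volume_eq_prod]
    exact Measure.quasiMeasurePreserving_fst.ae h1
  have h2' : ∀ᵐ z : Phase, ∀ s ∈ 𝒯.triangles, z.2 ∉ frontier (convexHull ℝ (s : Set (ℝ × ℝ))) := by
    rw [Measure.volume_eq_prod]
    exact Measure.quasiMeasurePreserving_snd.ae h2
  filter_upwards [h1', h2'] with z hz1 hz2 hz
  obtain ⟨j, hj, hx⟩ := 𝒯.exists_interval_mem hαβ (Ioo_subset_Icc_self hz.1)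
  obtain ⟨s, hs, hv⟩ := 𝒯.exists_triangle_mem hreg (subset_closure hz.2)
  refine ⟨j, hj, s, hs, ⟨lt_of_le_of_ne hx.1 (hz1 j).symm, lt_of_le_of_ne hx.2 (hz1 (j + 1))⟩, ?_⟩
  have := hz2 s hs
  rw [frontier, (isCompact_convexHull s).isClosed.closure_eq] at this
  by_contra hcon
  exact this ⟨hv, hcon⟩

/-- Barycentric coordinates on the triangle `s`, extended to affine functions on the plane. -/
noncomputable def bary (s : Finset (ℝ × ℝ)) : ℝ × ℝ → (ℝ × ℝ) →ᵃ[ℝ] ℝ := by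
  classical
  exact if h : s ∈ 𝒯.triangles then (exists_barycentric (𝒯.tri.indep h.1) h.2).choose else 0

variable {𝒯} {s s' : Finset (ℝ × ℝ)}

theorem bary_spec (hs : s ∈ 𝒯.triangles) :
    (∀ v, ∑ a ∈ s, 𝒯.bary s a v = 1) ∧ (∀ v, ∑ a ∈ s, 𝒯.bary s a v • a = v) ∧
      (∀ v, v ∈ convexHull ℝ (s : Set (ℝ × ℝ)) ↔ ∀ a ∈ s, 0 ≤ 𝒯.bary s a v) ∧
      (∀ a ∈ s, ∀ b ∈ s, 𝒯.bary s a b = if a = b then 1 else 0) ∧ ∀ a ∉ s, 𝒯.bary s a = 0 := by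
  have h := (exists_barycentric (𝒯.tri.indep hs.1) hs.2).choose_spec
  simp only [bary, hs, dif_pos]
  exact h

theorem bary_eq_of_sum (hs : s ∈ 𝒯.triangles) {r : Finset (ℝ × ℝ)} (hr : r ⊆ s)
    {w : ℝ × ℝ → ℝ} (hw : ∑ a ∈ r, w a = 1) (a : ℝ × ℝ) :
    𝒯.bary s a (∑ b ∈ r, w b • b) = if a ∈ r then w a else 0 := by
  classical
  obtain ⟨-, -, -, h4, h5⟩ := bary_spec hs
  rw [affineMap_sum_smul _ hw]
  by_cases ha : a ∈ s
  · rw [Finset.sum_congr rfl fun b hb => by rw [h4 a ha b (hr hb)]]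
    simp
  · rw [h5 a ha, if_neg fun h => ha (hr h)]
    simp

theorem bary_eq_bary (hs : s ∈ 𝒯.triangles) (hs' : s' ∈ 𝒯.triangles) {v : ℝ × ℝ}
    (hv : v ∈ convexHull ℝ (s : Set (ℝ × ℝ))) (hv' : v ∈ convexHull ℝ (s' : Set (ℝ × ℝ)))
    (a : ℝ × ℝ) : 𝒯.bary s a v = 𝒯.bary s' a v := by
  classical
  have h := 𝒯.tri.inter_subset_convexHull hs.1 hs'.1 ⟨hv, hv'⟩
  rw [← Finset.coe_inter, Finset.convexHull_eq] at h
  obtain ⟨w, -, hw1, rfl⟩ := h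
  rw [Finset.centerMass_eq_of_sum_1 _ _ hw1]
  simp only [id]
  rw [bary_eq_of_sum hs Finset.inter_subset_left hw1,
    bary_eq_of_sum hs' Finset.inter_subset_right hw1]

theorem abs_bary_le_one (hs : s ∈ 𝒯.triangles) {v : ℝ × ℝ}
    (hv : v ∈ convexHull ℝ (s : Set (ℝ × ℝ))) (a : ℝ × ℝ) :
    0 ≤ 𝒯.bary s a v ∧ 𝒯.bary s a v ≤ 1 := by
  obtain ⟨h1, -, h3, -, h5⟩ := bary_spec hs
  by_cases ha : a ∈ s
  · refine ⟨(h3 v).1 hv a ha, ?_⟩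
    rw [← h1 v]
    exact Finset.single_le_sum (f := fun a => 𝒯.bary s a v) (fun b hb => (h3 v).1 hv b hb) ha
  · simp [h5 a ha]

theorem abs_bary_linear_le {σ : ℝ} (hσ : 0 < σ) (hreg : 𝒯.ShapeRegular σ) (hs : s ∈ 𝒯.triangles)
    (a : ℝ × ℝ) : |(𝒯.bary s a).linear (1, 0)| ≤ 1 / (σ * 𝒯.h) ∧
      |(𝒯.bary s a).linear (0, 1)| ≤ 1 / (σ * 𝒯.h) := by
  obtain ⟨c, hc⟩ := hreg.2.2.2 s hs
  have hρ : 0 < σ * 𝒯.h := mul_pos hσ 𝒯.h_pos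
  have key : ∀ e : ℝ × ℝ, e.1 ^ 2 + e.2 ^ 2 = 1 → |(𝒯.bary s a).linear e| ≤ 1 / (σ * 𝒯.h) := by
    intro e he
    have hp : c + (σ * 𝒯.h) • e ∈ convexHull ℝ (s : Set (ℝ × ℝ)) := by
      apply hc
      simp only [Prod.fst_add, Prod.snd_add, Prod.smul_fst, Prod.smul_snd, smul_eq_mul]
      nlinarith
    have hm : c ∈ convexHull ℝ (s : Set (ℝ × ℝ)) := hc c (by simp; positivity)
    obtain ⟨p0, p1⟩ := abs_bary_le_one hs hp a
    obtain ⟨m0, m1⟩ := abs_bary_le_one hs hm a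
    have e1 : 𝒯.bary s a (c + (σ * 𝒯.h) • e)
        = (σ * 𝒯.h) * (𝒯.bary s a).linear e + 𝒯.bary s a c := by
      have := (𝒯.bary s a).map_vadd c ((σ * 𝒯.h) • e)
      simp only [vadd_eq_add, map_smul, smul_eq_mul] at this
      rw [← this, add_comm]
    have e2 : (σ * 𝒯.h) * (𝒯.bary s a).linear e
        = 𝒯.bary s a (c + (σ * 𝒯.h) • e) - 𝒯.bary s a c := by linarith
    have e3 : |(𝒯.bary s a).linear e| * (σ * 𝒯.h) = |σ * 𝒯.h * (𝒯.bary s a).linear e| := by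
      rw [abs_mul (σ * 𝒯.h), abs_of_pos hρ, mul_comm]
    rw [le_div_iff₀ hρ, e3, e2]
    exact abs_le.2 ⟨by linarith, by linarith⟩
  exact ⟨key _ (by norm_num), key _ (by norm_num)⟩

end PhaseMesh

/-! ### Piecewise (bi)linear interpolation on the mesh -/

namespace PhaseMesh

section ElementPolynomial

/-- Functions given on an element by a polynomial of `P_k × P_k × P_k`. -/
def IsElementPoly (k : ℕ) (f : ℝ × Phase → ℝ) : Prop :=
  ∃ c : ℕ → ℕ → ℕ → ℕ → ℝ, ∀ (t x : ℝ) (v : ℝ × ℝ), f (t, x, v) =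
    ∑ a ∈ Finset.range (k + 1), ∑ b ∈ Finset.range (k + 1),
      ∑ d ∈ Finset.range (k + 1), ∑ e ∈ Finset.range (k + 1 - d),
        c a b d e * (t ^ a * x ^ b * (v.1 ^ d * v.2 ^ e))

variable {k : ℕ} {f g : ℝ × Phase → ℝ}

theorem IsElementPoly.add (hf : IsElementPoly k f) (hg : IsElementPoly k g) :
    IsElementPoly k fun q => f q + g q := by
  obtain ⟨c, hc⟩ := hf
  obtain ⟨c', hc'⟩ := hg
  refine ⟨fun a b d e => c a b d e + c' a b d e, fun t x v => ?_⟩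
  simp only [hc, hc', ← Finset.sum_add_distrib, ← add_mul]

theorem IsElementPoly.const_mul (r : ℝ) (hf : IsElementPoly k f) :
    IsElementPoly k fun q => r * f q := by
  obtain ⟨c, hc⟩ := hf
  refine ⟨fun a b d e => r * c a b d e, fun t x v => ?_⟩
  simp only [hc, Finset.mul_sum, mul_assoc]

theorem IsElementPoly.sum {ι : Type*} (s : Finset ι) {f : ι → ℝ × Phase → ℝ}
    (hf : ∀ i ∈ s, IsElementPoly k (f i)) : IsElementPoly k fun q => ∑ i ∈ s, f i q := by
  classical
  induction s using Finset.induction_on with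
  | empty => exact ⟨fun _ _ _ _ => 0, fun t x v => by simp⟩
  | insert i s his ih =>
    simp only [Finset.sum_insert his]
    exact (hf i (Finset.mem_insert_self i s)).add
      (ih fun j hj => hf j (Finset.mem_insert_of_mem hj))

theorem isElementPoly_monomial {b d e : ℕ} (hb : b ≤ k) (hde : d + e ≤ k) :
    IsElementPoly k fun q => q.2.1 ^ b * (q.2.2.1 ^ d * q.2.2.2 ^ e) := by
  refine ⟨fun a' b' d' e' => if a' = 0 then if b' = b then if d' = d then if e' = e then 1
    else 0 else 0 else 0 else 0, fun t x v => ?_⟩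
  rw [Finset.sum_eq_single 0 (fun a' _ ha' => by simp [ha']) (by simp),
    Finset.sum_eq_single b (fun b' _ hb' => by simp [hb']) (by simp; omega),
    Finset.sum_eq_single d (fun d' _ hd' => by simp [hd']) (by simp; omega),
    Finset.sum_eq_single e (fun e' _ he' => by simp [he']) (by simp; omega)]
  simp

theorem isElementPoly_bilinear (hk : 1 ≤ k) (b₀ b₁ b₂ p₀ p₁ : ℝ) :
    IsElementPoly k fun q => (b₀ + b₁ * q.2.2.1 + b₂ * q.2.2.2) * (p₀ + p₁ * q.2.1) := by
  have m := fun (b d e : ℕ) (hb : b ≤ k) (hde : d + e ≤ k) =>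
    isElementPoly_monomial (k := k) hb hde
  have h := (((((m 0 0 0 (by omega) (by omega)).const_mul (b₀ * p₀)).add
    ((m 0 1 0 (by omega) (by omega)).const_mul (b₁ * p₀))).add
    ((m 0 0 1 (by omega) (by omega)).const_mul (b₂ * p₀))).add
    (((m 1 0 0 (by omega) (by omega)).const_mul (b₀ * p₁)).add
    ((m 1 1 0 (by omega) (by omega)).const_mul (b₁ * p₁)))).add
    ((m 1 0 1 (by omega) (by omega)).const_mul (b₂ * p₁))
  convert h using 2
  ring

end ElementPolynomial

variable {T α β : ℝ} {Ωv : Set (ℝ × ℝ)} (𝒯 : PhaseMesh T α β Ωv)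

/-- The continuous ramp that is `0` left of `τ_j` and `1` right of it. -/
noncomputable def ramp (j : ℕ) (x : ℝ) : ℝ :=
  max 0 (min 1 ((x - 𝒯.x j) / (𝒯.x (j + 1) - 𝒯.x j)))

/-- The continuous piecewise linear function with value `V j` at the mesh point `x j`. -/
noncomputable def spline (V : ℕ → ℝ) (x : ℝ) : ℝ :=
  V 0 + ∑ j ∈ Finset.range 𝒯.N, (V (j + 1) - V j) * 𝒯.ramp j x

theorem x_le_x {i j : ℕ} (hij : i ≤ j) (hj : j ≤ 𝒯.N) : 𝒯.x i ≤ 𝒯.x j := by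
  induction j, hij using Nat.le_induction with
  | base => exact le_rfl
  | succ j _ ih => exact (ih (by omega)).trans (𝒯.x_lt j hj).le

theorem spline_eq (V : ℕ → ℝ) {j : ℕ} (hj : j < 𝒯.N) {x : ℝ}
    (hx : x ∈ Icc (𝒯.x j) (𝒯.x (j + 1))) :
    𝒯.spline V x = V j + (V (j + 1) - V j) * ((x - 𝒯.x j) / (𝒯.x (j + 1) - 𝒯.x j)) := by
  have hlen : ∀ i < 𝒯.N, 0 < 𝒯.x (i + 1) - 𝒯.x i := fun i hi => sub_pos.2 (𝒯.x_lt i hi)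
  have hleft : ∀ i < j, 𝒯.ramp i x = 1 := by
    intro i hi
    have h1 := 𝒯.x_le_x (show i + 1 ≤ j from hi) hj.le
    have h2 : 1 ≤ (x - 𝒯.x i) / (𝒯.x (i + 1) - 𝒯.x i) := by
      rw [one_le_div (hlen i (hi.trans hj))]
      linarith [hx.1]
    simp [ramp, min_eq_left h2]
  have hright : ∀ i < 𝒯.N, j < i → 𝒯.ramp i x = 0 := by
    intro i hi hji
    have h1 := 𝒯.x_le_x (show j + 1 ≤ i from hji) hi.le
    have h2 : (x - 𝒯.x i) / (𝒯.x (i + 1) - 𝒯.x i) ≤ 0 :=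
      div_nonpos_of_nonpos_of_nonneg (by linarith [hx.2]) (hlen i hi).le
    exact max_eq_left ((min_le_right _ _).trans h2)
  have hmid : 𝒯.ramp j x = (x - 𝒯.x j) / (𝒯.x (j + 1) - 𝒯.x j) := by
    have h0 : 0 ≤ (x - 𝒯.x j) / (𝒯.x (j + 1) - 𝒯.x j) :=
      div_nonneg (sub_nonneg.2 hx.1) (hlen j hj).le
    have h1 : (x - 𝒯.x j) / (𝒯.x (j + 1) - 𝒯.x j) ≤ 1 := by
      rw [div_le_one (hlen j hj)]
      linarith [hx.2]
    rw [ramp, min_eq_right h1, max_eq_right h0]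
  have hsplit : ∑ i ∈ Finset.range 𝒯.N, (V (i + 1) - V i) * 𝒯.ramp i x
      = ∑ i ∈ Finset.range (j + 1), (V (i + 1) - V i) * 𝒯.ramp i x := by
    refine (Finset.sum_subset (Finset.range_mono (Nat.succ_le_of_lt hj)) fun i hi hi' => ?_).symm
    rw [Finset.mem_range] at hi hi'
    rw [hright i hi (by omega), mul_zero]
  rw [spline, hsplit, Finset.sum_range_succ, hmid, Finset.sum_congr rfl fun i hi => by
    rw [hleft i (Finset.mem_range.1 hi), mul_one], Finset.sum_range_sub]
  ring

theorem continuous_spline (V : ℕ → ℝ) : Continuous (𝒯.spline V) := by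
  unfold spline ramp
  fun_prop

/-- The vertices of the triangles. -/
noncomputable def vertexFinset : Finset (ℝ × ℝ) := by
  classical
  exact 𝒯.triangles_finite.toFinset.biUnion id

/-- The piecewise linear nodal basis function of the vertex `a`. -/
noncomputable def hatFunction (a v : ℝ × ℝ) : ℝ := by
  classical
  exact if h : ∃ s ∈ 𝒯.triangles, v ∈ convexHull ℝ (s : Set (ℝ × ℝ)) then
    𝒯.bary h.choose a v else 0

/-- The interpolant of the nodal values `U j a` at the nodes `(x j, a)`. -/
noncomputable def interp (U : ℕ → ℝ × ℝ → ℝ) (z : Phase) : ℝ :=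
  ∑ a ∈ 𝒯.vertexFinset, 𝒯.hatFunction a z.2 * 𝒯.spline (fun j => U j a) z.1

/-- The polynomial that agrees with `interp` on the element `τ_j × s`. -/
noncomputable def elementInterp (U : ℕ → ℝ × ℝ → ℝ) (j : ℕ) (s : Finset (ℝ × ℝ)) (z : Phase) : ℝ :=
  ∑ a ∈ s, 𝒯.bary s a z.2 *
    (U j a + (U (j + 1) a - U j a) * ((z.1 - 𝒯.x j) / (𝒯.x (j + 1) - 𝒯.x j)))

variable {𝒯} {s : Finset (ℝ × ℝ)} {j : ℕ} {U : ℕ → ℝ × ℝ → ℝ}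

theorem hatFunction_eq (hs : s ∈ 𝒯.triangles) {v : ℝ × ℝ}
    (hv : v ∈ convexHull ℝ (s : Set (ℝ × ℝ))) (a : ℝ × ℝ) :
    𝒯.hatFunction a v = 𝒯.bary s a v := by
  have h : ∃ s ∈ 𝒯.triangles, v ∈ convexHull ℝ (s : Set (ℝ × ℝ)) := ⟨s, hs, hv⟩
  rw [hatFunction, dif_pos h]
  exact bary_eq_bary h.choose_spec.1 hs h.choose_spec.2 hv a

theorem interp_eq (hj : j < 𝒯.N) (hs : s ∈ 𝒯.triangles) {z : Phase}
    (hx : z.1 ∈ Icc (𝒯.x j) (𝒯.x (j + 1))) (hv : z.2 ∈ convexHull ℝ (s : Set (ℝ × ℝ))) :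
    𝒯.interp U z = 𝒯.elementInterp U j s z := by
  classical
  have hsub : s ⊆ 𝒯.vertexFinset := by
    intro a ha
    simp only [vertexFinset, Finset.mem_biUnion, Finite.mem_toFinset, id]
    exact ⟨s, hs, ha⟩
  rw [interp, elementInterp, ← Finset.sum_subset hsub]
  · refine Finset.sum_congr rfl fun a _ => ?_
    rw [hatFunction_eq hs hv, spline_eq _ _ hj hx]
  · intro a _ ha
    rw [hatFunction_eq hs hv, (bary_spec hs).2.2.2.2 a ha]
    simp

theorem continuous_bary (s : Finset (ℝ × ℝ)) (a : ℝ × ℝ) : Continuous (𝒯.bary s a) :=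
  AffineMap.continuous_of_finiteDimensional _

theorem bary_apply (s : Finset (ℝ × ℝ)) (a v : ℝ × ℝ) :
    𝒯.bary s a v = 𝒯.bary s a 0 + (𝒯.bary s a).linear (1, 0) * v.1
      + (𝒯.bary s a).linear (0, 1) * v.2 := by
  have h1 := congrFun (𝒯.bary s a).decomp v
  have h2 : v = v.1 • ((1 : ℝ), (0 : ℝ)) + v.2 • ((0 : ℝ), (1 : ℝ)) := by
    ext <;> simp
  have h3 : (𝒯.bary s a).linear v = v.1 * (𝒯.bary s a).linear (1, 0)
      + v.2 * (𝒯.bary s a).linear (0, 1) := by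
    conv_lhs => rw [h2]
    rw [map_add, map_smul, map_smul, smul_eq_mul, smul_eq_mul]
  simp only [Pi.add_apply] at h1
  rw [h1, h3]
  ring

theorem continuousOn_hatFunction (hreg : Ωv = interior (closure Ωv)) (a : ℝ × ℝ) :
    ContinuousOn (𝒯.hatFunction a) (closure Ωv) := by
  rw [𝒯.closure_eq_iUnion_triangles hreg, biUnion_eq_iUnion]
  have hfin : Finite 𝒯.triangles := 𝒯.triangles_finite
  refine (locallyFinite_of_finite _).continuousOn_iUnion
    (fun s => (isCompact_convexHull s.1).isClosed) fun s => ?_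
  exact (continuous_bary s.1 a).continuousOn.congr fun v hv => hatFunction_eq s.2 hv a

theorem closure_phaseDomain (hαβ : α < β) :
    closure (phaseDomain α β Ωv) = Icc α β ×ˢ closure Ωv := by
  rw [phaseDomain, closure_prod_eq, closure_Ioo hαβ.ne]

theorem continuousOn_interp (hαβ : α < β) (hreg : Ωv = interior (closure Ωv)) :
    ContinuousOn (𝒯.interp U) (closure (phaseDomain α β Ωv)) := by
  rw [closure_phaseDomain hαβ]
  refine continuousOn_finsetSum _ fun a _ => ContinuousOn.mul ?_ ?_
  · exact (continuousOn_hatFunction hreg a).comp continuousOn_snd fun z hz => hz.2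
  · exact ((𝒯.continuous_spline _).comp continuous_fst).continuousOn

theorem isElementPoly_elementInterp {k : ℕ} (hk : 1 ≤ k) :
    IsElementPoly k fun q => 𝒯.elementInterp U j s q.2 := by
  refine IsElementPoly.sum s fun a _ => ?_
  set d := 𝒯.x (j + 1) - 𝒯.x j
  convert isElementPoly_bilinear hk (𝒯.bary s a 0) ((𝒯.bary s a).linear (1, 0))
    ((𝒯.bary s a).linear (0, 1)) (U j a - (U (j + 1) a - U j a) * 𝒯.x j / d)
    ((U (j + 1) a - U j a) / d) using 2 with q
  rw [bary_apply s a q.2.2]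
  ring

theorem M_pos (hT : 0 < T) : 0 < 𝒯.M := by
  rcases Nat.eq_zero_or_pos 𝒯.M with h | h
  · have h1 := 𝒯.t_last
    rw [h, 𝒯.t_zero] at h1
    exact absurd h1 hT.ne
  · exact h

theorem norm_sub_vertex_le {σ : ℝ} (hT : 0 < T) (hsh : 𝒯.ShapeRegular σ) (hj : j < 𝒯.N)
    (hs : s ∈ 𝒯.triangles) {v a : ℝ × ℝ} (hv : v ∈ convexHull ℝ (s : Set (ℝ × ℝ))) (ha : a ∈ s) :
    ‖v - a‖ ≤ 𝒯.h := by
  have hh := 𝒯.h_pos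
  have hsub : (s : Set (ℝ × ℝ)) ⊆ Metric.closedBall a 𝒯.h := by
    intro w hw
    have h := hsh.1 0 (M_pos hT) j hj s hs w hw a ha
    rw [Metric.mem_closedBall, dist_eq_norm]
    refine norm_prod_le_iff.2 ⟨?_, ?_⟩ <;>
    · rw [Real.norm_eq_abs]
      refine abs_le_of_sq_le_sq ?_ hh.le
      simp only [Prod.fst_sub, Prod.snd_sub]
      nlinarith [sq_nonneg (𝒯.t (0 + 1) - 𝒯.t 0), sq_nonneg (𝒯.x (j + 1) - 𝒯.x j),
        sq_nonneg (w.1 - a.1), sq_nonneg (w.2 - a.2)]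
  have := convexHull_min hsub (convex_closedBall a 𝒯.h) hv
  rwa [Metric.mem_closedBall, dist_eq_norm] at this

theorem x_length_le {σ : ℝ} (hT : 0 < T) (hsh : 𝒯.ShapeRegular σ) (hj : j < 𝒯.N)
    (hs : s ∈ 𝒯.triangles) : 𝒯.x (j + 1) - 𝒯.x j ≤ 𝒯.h := by
  obtain ⟨a, ha⟩ := 𝒯.tri.nonempty_of_mem_faces hs.1
  have h := hsh.1 0 (M_pos hT) j hj s hs a ha a ha
  refine (le_abs_self _).trans (abs_le_of_sq_le_sq ?_ 𝒯.h_pos.le)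
  nlinarith [sq_nonneg (𝒯.t (0 + 1) - 𝒯.t 0)]

theorem norm_sub_node_le {σ : ℝ} (hT : 0 < T) (hsh : 𝒯.ShapeRegular σ) (hj : j < 𝒯.N)
    (hs : s ∈ 𝒯.triangles) {z : Phase} (hx : z.1 ∈ Icc (𝒯.x j) (𝒯.x (j + 1)))
    (hv : z.2 ∈ convexHull ℝ (s : Set (ℝ × ℝ))) {a : ℝ × ℝ} (ha : a ∈ s) :
    ‖z - (𝒯.x j, a)‖ ≤ 𝒯.h ∧ ‖z - (𝒯.x (j + 1), a)‖ ≤ 𝒯.h := by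
  have h1 := norm_sub_vertex_le hT hsh hj hs hv ha
  have h2 := x_length_le hT hsh hj hs
  constructor <;>
  · refine norm_prod_le_iff.2 ⟨?_, h1⟩
    rw [Real.norm_eq_abs, Prod.fst_sub]
    exact abs_le.2 ⟨by linarith [hx.1, hx.2], by linarith [hx.1, hx.2]⟩

theorem memV_interp {σ : ℝ} {k : ℕ} (hk : 1 ≤ k) (hT : 0 < T) (hαβ : α < β)
    (hreg : Ωv = interior (closure Ωv)) (hsh : 𝒯.ShapeRegular σ)
    (hU : ∀ i a, ∀ z ∉ phaseDomain α β Ωv, ‖z - (𝒯.x i, a)‖ ≤ 𝒯.h → U i a = 0) :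
    𝒯.MemV k fun _ q => 𝒯.interp U q.2 := by
  have hΩo : IsOpen (phaseDomain α β Ωv) := by
    have : IsOpen Ωv := by
      rw [hreg]
      exact isOpen_interior
    exact isOpen_Ioo.prod this
  intro m _
  refine ⟨?_, fun t _ z hz => ?_, fun j hj s hs => ?_⟩
  · exact (continuousOn_interp hαβ hreg).comp continuousOn_snd fun q hq => hq.2
  · rw [hΩo.frontier_eq, closure_phaseDomain hαβ] at hz
    obtain ⟨j, hj, hx⟩ := 𝒯.exists_interval_mem hαβ hz.1.1
    obtain ⟨s, hs, hv⟩ := 𝒯.exists_triangle_mem hreg hz.1.2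
    simp only
    rw [interp_eq hj hs hx hv, elementInterp]
    refine Finset.sum_eq_zero fun a ha => ?_
    obtain ⟨h1, h2⟩ := norm_sub_node_le hT hsh hj hs hx hv ha
    rw [hU j a z hz.2 h1, hU (j + 1) a z hz.2 h2]
    simp
  · obtain ⟨c, hc⟩ := isElementPoly_elementInterp (𝒯 := 𝒯) (U := U) (j := j) (s := s) hk
    refine ⟨c, fun t _ x hx v hv => ?_⟩
    simp only
    rw [interp_eq hj hs hx hv]
    exact hc t x v

theorem interp_bounds {σ : ℝ} (hσ : 0 < σ) (hsh : 𝒯.ShapeRegular σ) (hj : j < 𝒯.N)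
    (hs : s ∈ 𝒯.triangles) {z : Phase} (hz : z ∈ 𝒯.elementInterior j s) {c d : ℝ}
    (hd : ∀ a ∈ s, |U j a - c| ≤ d ∧ |U (j + 1) a - c| ≤ d) :
    |𝒯.interp U z - c| ≤ d ∧ |dX (𝒯.interp U) z| ≤ 3 * d / (σ * 𝒯.h) ∧
      |dV₁ (𝒯.interp U) z| ≤ 3 * d / (σ * 𝒯.h) ∧ |dV₂ (𝒯.interp U) z| ≤ 3 * d / (σ * 𝒯.h) := by
  have hρ : 0 < σ * 𝒯.h := mul_pos hσ 𝒯.h_pos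
  set len := 𝒯.x (j + 1) - 𝒯.x j with hlen
  have hlen0 : σ * 𝒯.h ≤ len := hsh.2.2.1 j hj
  have hlenp : 0 < len := hρ.trans_le hlen0
  obtain ⟨b1, b2, b3, b4, b5⟩ := bary_spec hs
  have hx : z.1 ∈ Icc (𝒯.x j) (𝒯.x (j + 1)) := Ioo_subset_Icc_self hz.1
  have hv : z.2 ∈ convexHull ℝ (s : Set (ℝ × ℝ)) := interior_subset hz.2
  have hb0 := (b3 z.2).1 hv
  set θ := (z.1 - 𝒯.x j) / len with hθ
  have hθ0 : 0 ≤ θ := div_nonneg (sub_nonneg.2 hx.1) hlenp.le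
  have hθ1 : θ ≤ 1 := by
    rw [hθ, div_le_one hlenp]
    linarith [hx.2]
  have hq : ∀ a ∈ s, |U j a + (U (j + 1) a - U j a) * θ - c| ≤ d := by
    intro a ha
    obtain ⟨h1, h2⟩ := hd a ha
    rw [abs_le] at h1 h2 ⊢
    constructor <;> nlinarith
  have hD : ∀ a ∈ s, |U (j + 1) a - U j a| ≤ 2 * d := by
    intro a ha
    obtain ⟨h1, h2⟩ := hd a ha
    rw [abs_le] at h1 h2 ⊢
    constructor <;> linarith
  have hd0 : 0 ≤ d := by
    obtain ⟨a, ha⟩ := 𝒯.tri.nonempty_of_mem_faces hs.1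
    exact (abs_nonneg _).trans (hq a ha)
  have hev : 𝒯.interp U =ᶠ[nhds z] 𝒯.elementInterp U j s :=
    Filter.eventually_of_mem ((𝒯.isOpen_elementInterior j s).mem_nhds hz) fun y hy =>
      interp_eq hj hs (Ioo_subset_Icc_self hy.1) (interior_subset hy.2)
  have hsum : ∀ q : ℝ × ℝ → ℝ, (∀ a ∈ s, |q a| ≤ d) →
      ∀ ξ : ℝ × ℝ → ℝ, (∀ a ∈ s, |ξ a| ≤ 1 / (σ * 𝒯.h)) →
        |∑ a ∈ s, ξ a * q a| ≤ 3 * d / (σ * 𝒯.h) := by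
    intro q hq ξ hξ
    refine (Finset.abs_sum_le_sum_abs _ _).trans ?_
    have : ∀ a ∈ s, |ξ a * q a| ≤ 1 / (σ * 𝒯.h) * d := fun a ha => by
      rw [abs_mul]
      exact mul_le_mul (hξ a ha) (hq a ha) (abs_nonneg _) (by positivity)
    refine (Finset.sum_le_card_nsmul s _ _ this).trans (le_of_eq ?_)
    rw [hs.2, nsmul_eq_mul]
    push_cast
    ring
  have hderiv : ∀ e : ℝ × ℝ, ∑ a ∈ s, (𝒯.bary s a).linear e = 0 := by
    intro e
    have h0 : ∀ a, 𝒯.bary s a (e + 0) = (𝒯.bary s a).linear e + 𝒯.bary s a 0 :=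
      fun a => (𝒯.bary s a).map_vadd 0 e
    have h1 := b1 (e + 0)
    simp only [h0] at h1
    rw [Finset.sum_add_distrib, b1 0] at h1
    linarith
  have hdv : ∀ e : ℝ × ℝ, (∀ a ∈ s, |(𝒯.bary s a).linear e| ≤ 1 / (σ * 𝒯.h)) →
      |∑ a ∈ s, (𝒯.bary s a).linear e * (U j a + (U (j + 1) a - U j a) * θ)|
        ≤ 3 * d / (σ * 𝒯.h) := by
    intro e he
    have h1 : ∑ a ∈ s, (𝒯.bary s a).linear e * (U j a + (U (j + 1) a - U j a) * θ)
        = ∑ a ∈ s, (𝒯.bary s a).linear e * (U j a + (U (j + 1) a - U j a) * θ - c) := by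
      simp only [mul_sub _ _ c]
      rw [Finset.sum_sub_distrib, ← Finset.sum_mul, hderiv, zero_mul, sub_zero]
    rw [h1]
    exact hsum _ hq _ he
  refine ⟨?_, ?_, ?_, ?_⟩
  · rw [hev.eq_of_nhds, elementInterp]
    have h1 : ∑ a ∈ s, 𝒯.bary s a z.2 * (U j a + (U (j + 1) a - U j a) * θ) - c
        = ∑ a ∈ s, 𝒯.bary s a z.2 * (U j a + (U (j + 1) a - U j a) * θ - c) := by
      simp only [mul_sub _ _ c]
      rw [Finset.sum_sub_distrib, ← Finset.sum_mul, b1, one_mul]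
    rw [h1]
    refine (Finset.abs_sum_le_sum_abs _ _).trans ?_
    calc ∑ a ∈ s, |𝒯.bary s a z.2 * (U j a + (U (j + 1) a - U j a) * θ - c)|
        ≤ ∑ a ∈ s, 𝒯.bary s a z.2 * d := Finset.sum_le_sum fun a ha => by
          rw [abs_mul, abs_of_nonneg (hb0 a ha)]
          exact mul_le_mul_of_nonneg_left (hq a ha) (hb0 a ha)
      _ = d := by rw [← Finset.sum_mul, b1, one_mul]
  · have h1 : HasDerivAt (fun y => 𝒯.elementInterp U j s (y, z.2))
        (∑ a ∈ s, 𝒯.bary s a z.2 * ((U (j + 1) a - U j a) * (1 / len))) z.1 := by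
      refine HasDerivAt.fun_sum fun a _ => ?_
      have h := (((((hasDerivAt_id z.1).sub_const (𝒯.x j)).div_const len).const_mul
        (U (j + 1) a - U j a)).const_add (U j a)).const_mul (𝒯.bary s a z.2)
      exact h
    have h2 : (fun y => 𝒯.interp U (y, z.2)) =ᶠ[nhds z.1] fun y => 𝒯.elementInterp U j s (y, z.2) :=
      (show Continuous fun y : ℝ => (y, z.2) by fun_prop).continuousAt.eventually hev
    rw [dX, h2.deriv_eq, h1.deriv]
    refine (Finset.abs_sum_le_sum_abs _ _).trans ?_
    calc ∑ a ∈ s, |𝒯.bary s a z.2 * ((U (j + 1) a - U j a) * (1 / len))|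
        ≤ ∑ a ∈ s, 𝒯.bary s a z.2 * (2 * d * (1 / (σ * 𝒯.h))) := Finset.sum_le_sum fun a ha => by
          rw [abs_mul, abs_of_nonneg (hb0 a ha), abs_mul, abs_of_pos (one_div_pos.2 hlenp)]
          refine mul_le_mul_of_nonneg_left ?_ (hb0 a ha)
          exact mul_le_mul (hD a ha) (one_div_le_one_div_of_le hρ hlen0) (by positivity)
            (by positivity)
      _ = 2 * d / (σ * 𝒯.h) := by
          rw [← Finset.sum_mul, b1, one_mul]
          ring
      _ ≤ 3 * d / (σ * 𝒯.h) := by gcongr; norm_num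
  · have h1 : HasDerivAt (fun y => 𝒯.elementInterp U j s (z.1, y, z.2.2))
        (∑ a ∈ s, (𝒯.bary s a).linear (1, 0) * (U j a + (U (j + 1) a - U j a) * θ)) z.2.1 := by
      refine HasDerivAt.fun_sum fun a _ => ?_
      have h : HasDerivAt (fun y => 𝒯.bary s a (y, z.2.2)) ((𝒯.bary s a).linear (1, 0)) z.2.1 := by
        rw [funext fun y : ℝ => bary_apply s a (y, z.2.2)]
        simpa using (((hasDerivAt_id z.2.1).const_mul ((𝒯.bary s a).linear (1, 0))).const_add
          (𝒯.bary s a 0)).add_const ((𝒯.bary s a).linear (0, 1) * z.2.2)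
      exact h.mul_const (U j a + (U (j + 1) a - U j a) * θ)
    have h2 : (fun y => 𝒯.interp U (z.1, y, z.2.2)) =ᶠ[nhds z.2.1]
        fun y => 𝒯.elementInterp U j s (z.1, y, z.2.2) :=
      (show Continuous fun y : ℝ => (z.1, y, z.2.2) by fun_prop).continuousAt.eventually hev
    rw [dV₁, h2.deriv_eq, h1.deriv]
    exact hdv _ fun a _ => (abs_bary_linear_le hσ hsh hs a).1
  · have h1 : HasDerivAt (fun y => 𝒯.elementInterp U j s (z.1, z.2.1, y))
        (∑ a ∈ s, (𝒯.bary s a).linear (0, 1) * (U j a + (U (j + 1) a - U j a) * θ)) z.2.2 := by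
      refine HasDerivAt.fun_sum fun a _ => ?_
      have h : HasDerivAt (fun y => 𝒯.bary s a (z.2.1, y)) ((𝒯.bary s a).linear (0, 1)) z.2.2 := by
        rw [funext fun y : ℝ => bary_apply s a (z.2.1, y)]
        simpa using ((hasDerivAt_id z.2.2).const_mul ((𝒯.bary s a).linear (0, 1))).const_add
          (𝒯.bary s a 0 + (𝒯.bary s a).linear (1, 0) * z.2.1)
      exact h.mul_const (U j a + (U (j + 1) a - U j a) * θ)
    have h2 : (fun y => 𝒯.interp U (z.1, z.2.1, y)) =ᶠ[nhds z.2.2]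
        fun y => 𝒯.elementInterp U j s (z.1, z.2.1, y) :=
      (show Continuous fun y : ℝ => (z.1, z.2.1, y) by fun_prop).continuousAt.eventually hev
    rw [dV₂, h2.deriv_eq, h1.deriv]
    exact hdv _ fun a _ => (abs_bary_linear_le hσ hsh hs a).2

end PhaseMesh

/-! ### Exterior balls near the boundary -/

theorem exists_mem_frontier_of_segment {E : Type*} [NormedAddCommGroup E] [NormedSpace ℝ E]
    {Ω : Set E} (hΩ : IsOpen Ω) {z q : E} (hz : z ∈ Ω) (hq : q ∉ Ω) :
    ∃ a ∈ frontier Ω, ‖a - z‖ ≤ ‖z - q‖ := by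
  have hpre : IsPreconnected (segment ℝ z q) := (convex_segment z q).isPreconnected
  have hcon : ∃ a ∈ segment ℝ z q, a ∈ frontier Ω := by
    by_contra hcon
    push Not at hcon
    rw [hΩ.frontier_eq] at hcon
    have hmem : ∀ a ∈ segment ℝ z q, a ∈ Ω ∨ a ∈ (closure Ω)ᶜ := fun a ha => by
      have := hcon a ha
      by_contra h
      push Not at h
      exact this ⟨not_not.1 h.2, h.1⟩
    obtain ⟨a, -, ha1, ha2⟩ := hpre Ω (closure Ω)ᶜ hΩ isClosed_closure.isOpen_compl
      (fun a ha => hmem a ha) ⟨z, left_mem_segment ℝ z q, hz⟩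
      ⟨q, right_mem_segment ℝ z q, (hmem q (right_mem_segment ℝ z q)).resolve_left hq⟩
    exact ha2 (subset_closure ha1)
  obtain ⟨a, ha, hfa⟩ := hcon
  refine ⟨a, hfa, ?_⟩
  have hsub : segment ℝ z q ⊆ Metric.closedBall z ‖z - q‖ :=
    (convex_closedBall z _).segment_subset (by simp) (by simp [dist_eq_norm, norm_sub_rev])
  have := hsub ha
  rwa [Metric.mem_closedBall, dist_eq_norm] at this

namespace PhaseMesh

variable {T α β : ℝ} {Ωv : Set (ℝ × ℝ)}

theorem exists_convex_cover_compl (𝒯 : PhaseMesh T α β Ωv) {S : Set (Finset (ℝ × ℝ))}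
    (hS : S.Finite) (hsub : S ⊆ 𝒯.triangles) :
    ∃ 𝒟 : Set (Set (ℝ × ℝ)), 𝒟.Finite ∧ (∀ D ∈ 𝒟, IsOpen D ∧ Convex ℝ D) ∧
      (⋃ s ∈ S, convexHull ℝ (s : Set (ℝ × ℝ)))ᶜ = ⋃₀ 𝒟 := by
  induction S, hS using Set.Finite.induction_on with
  | empty =>
    refine ⟨{univ}, finite_singleton _, ?_, by simp⟩
    rintro D rfl
    exact ⟨isOpen_univ, convex_univ⟩
  | @insert s S _ _ ih =>
    obtain ⟨𝒟, hfin, hD, hcov⟩ := ih ((subset_insert _ _).trans hsub)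
    have hs : s ∈ 𝒯.triangles := hsub (mem_insert _ _)
    obtain ⟨-, -, b3, -, -⟩ := bary_spec hs
    refine ⟨image2 (fun D a => D ∩ {v | 𝒯.bary s a v < 0}) 𝒟 (s : Set (ℝ × ℝ)),
      hfin.image2 _ s.finite_toSet, ?_, ?_⟩
    · rintro _ ⟨D, hDD, a, ha, rfl⟩
      refine ⟨(hD D hDD).1.inter (isOpen_lt (continuous_bary s a) continuous_const),
        (hD D hDD).2.inter ?_⟩
      exact (convex_Iio (0 : ℝ)).affine_preimage (𝒯.bary s a)
    · ext v
      rw [biUnion_insert, compl_union, hcov]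
      simp only [mem_inter_iff, mem_compl_iff, b3 v, mem_sUnion, mem_image2]
      push Not
      constructor
      · rintro ⟨⟨a, ha, hav⟩, D, hDD, hvD⟩
        exact ⟨_, ⟨D, hDD, a, ha, rfl⟩, hvD, hav⟩
      · rintro ⟨_, ⟨D, hDD, a, ha, rfl⟩, hvD, hav⟩
        exact ⟨⟨a, ha, hav⟩, D, hDD, hvD⟩

theorem exists_exterior_ball (𝒯 : PhaseMesh T α β Ωv) (hb : Bornology.IsBounded Ωv)
    (hreg : Ωv = interior (closure Ωv)) {H : ℝ} (hH : 0 < H) :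
    ∃ ε > 0, ∀ h, 0 < h → h ≤ H → ∀ a ∈ frontier Ωv,
      ∃ p, Metric.ball p (ε * h) ⊆ Ωvᶜ ∧ ‖p - a‖ ≤ h / ε := by
  obtain ⟨𝒟, hfin, hD, hcov⟩ := 𝒯.exists_convex_cover_compl 𝒯.triangles_finite Subset.rfl
  rw [← 𝒯.closure_eq_iUnion_triangles hreg] at hcov
  obtain ⟨ρ, hρ⟩ := hb.closure.exists_norm_le
  have hloc : ∀ D ∈ 𝒟, ∀ᶠ ε in nhdsWithin (0 : ℝ) (Ioi 0), ∀ h, 0 < h → h ≤ H →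
      ∀ a ∈ frontier Ωv, a ∈ closure D →
        ∃ p, Metric.ball p (ε * h) ⊆ Ωvᶜ ∧ ‖p - a‖ ≤ h / ε := by
    intro D hDD
    obtain ⟨hDo, hDc⟩ := hD D hDD
    have hDΩ : D ⊆ Ωvᶜ := by
      have h1 : D ⊆ (closure Ωv)ᶜ := hcov ▸ subset_sUnion_of_mem hDD
      exact h1.trans (compl_subset_compl.2 subset_closure)
    rcases D.eq_empty_or_nonempty with rfl | ⟨p, hp⟩
    · simp
    obtain ⟨r, hr, hball⟩ := Metric.isOpen_iff.1 hDo p hp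
    have hε1 : 0 < r / H := by positivity
    have hε2 : 0 < H / (‖p‖ + |ρ| + 1) := by positivity
    filter_upwards [Ioo_mem_nhdsGT (lt_min hε1 hε2)] with ε hε h hh hhH a ha haD
    have hεr := hε.2.le.trans (min_le_left _ _)
    have hεR := hε.2.le.trans (min_le_right _ _)
    have hε0 : 0 < ε := hε.1
    rw [le_div_iff₀ hH] at hεr
    rw [le_div_iff₀ (by positivity)] at hεR
    have hlam : 0 < h / H := by positivity
    have hlam1 : h / H ≤ 1 := (div_le_one hH).2 hhH
    refine ⟨(1 - h / H) • a + (h / H) • p, fun y hy => ?_, ?_⟩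
    · have hy' : p + (H / h) • (y - ((1 - h / H) • a + (h / H) • p)) ∈ D := by
        apply hball
        rw [Metric.mem_ball, dist_eq_norm, add_sub_cancel_left, norm_smul,
          Real.norm_of_nonneg (by positivity)]
        rw [Metric.mem_ball, dist_eq_norm] at hy
        calc H / h * _ < H / h * (ε * h) := mul_lt_mul_of_pos_left hy (by positivity)
          _ = ε * H := by field_simp
          _ ≤ r := hεr
      have := hDc.combo_closure_interior_mem_interior haD (hDo.interior_eq.symm ▸ hy')
        (sub_nonneg.2 hlam1) hlam (by ring)
      have e : (1 - h / H) • a + (h / H) •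
          (p + (H / h) • (y - ((1 - h / H) • a + (h / H) • p))) = y := by
        have : h / H * (H / h) = 1 := by field_simp
        rw [smul_add, smul_smul, this, one_smul]
        abel
      rw [e] at this
      exact hDΩ (interior_subset this)
    · have e : (1 - h / H) • a + (h / H) • p - a = (h / H) • (p - a) := by module
      rw [e, norm_smul, Real.norm_of_nonneg hlam.le, le_div_iff₀ hε0]
      have h1 : ‖p - a‖ ≤ ‖p‖ + |ρ| + 1 := by
        have := norm_sub_le p a
        have := hρ a (frontier_subset_closure ha)
        have := le_abs_self ρ
        linarith
      calc h / H * ‖p - a‖ * ε ≤ h / H * (‖p‖ + |ρ| + 1) * ε := by gcongr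
        _ = h / H * (ε * (‖p‖ + |ρ| + 1)) := by ring
        _ ≤ h / H * H := by gcongr
        _ = h := by field_simp
  have hall := (Filter.eventually_all_finite hfin).2 hloc
  obtain ⟨ε, hε, hε0⟩ := (hall.and self_mem_nhdsWithin).exists
  refine ⟨ε, hε0, fun h hh hhH a ha => ?_⟩
  have hacl : a ∈ closure (closure Ωv)ᶜ := by
    rw [closure_compl, ← hreg]
    have hΩo : IsOpen Ωv := by
      rw [hreg]
      exact isOpen_interior
    rw [hΩo.frontier_eq] at ha
    exact ha.2
  rw [hcov, hfin.closure_sUnion] at hacl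
  obtain ⟨D, hDD, haD⟩ := mem_iUnion₂.1 hacl
  exact hε D hDD h hh hhH a ha haD

theorem exists_exterior_ball_phase (𝒯 : PhaseMesh T α β Ωv) (hb : Bornology.IsBounded Ωv)
    (hreg : Ωv = interior (closure Ωv)) {H : ℝ} (hH : 0 < H) :
    ∃ ε > 0, ε ≤ 1 ∧ ∀ h, 0 < h → h ≤ H → ∀ z ∈ phaseDomain α β Ωv, ∀ q ∉ phaseDomain α β Ωv,
      ‖z - q‖ ≤ 2 * h →
        ∃ p, Metric.ball p (ε * h) ⊆ (phaseDomain α β Ωv)ᶜ ∧ ‖p - z‖ ≤ h / ε := by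
  obtain ⟨ε₀, hε₀, hext⟩ := 𝒯.exists_exterior_ball hb hreg hH
  have hΩo : IsOpen Ωv := by
    rw [hreg]
    exact isOpen_interior
  set ε := min (min ε₀ 1) (1 / (1 / ε₀ + 3)) with hε
  have hεpos : 0 < ε := by
    simp only [hε]
    positivity
  have hεle : ε ≤ ε₀ := (min_le_left _ _).trans (min_le_left _ _)
  have hεinv : 1 / ε₀ + 3 ≤ 1 / ε := by
    have h1 : ε ≤ 1 / (1 / ε₀ + 3) := min_le_right _ _
    rw [le_div_iff₀ hεpos]
    rwa [le_div_iff₀ (by positivity), mul_comm] at h1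
  refine ⟨ε, hεpos, (min_le_left _ _).trans (min_le_right _ _), fun h hh hhH z hz q hq hzq => ?_⟩
  have hdiv : h / ε₀ + 3 * h ≤ h / ε := by
    have := mul_le_mul_of_nonneg_left hεinv hh.le
    calc h / ε₀ + 3 * h = h * (1 / ε₀ + 3) := by ring
      _ ≤ h * (1 / ε) := this
      _ = h / ε := by ring
  have h3 : 3 * h ≤ h / ε := by
    have : 0 ≤ h / ε₀ := by positivity
    linarith
  have hεh : ε * h ≤ h := by
    have : ε ≤ 1 := (min_le_left _ _).trans (min_le_right _ _)
    nlinarith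
  obtain ⟨hzq1, hzq2⟩ := norm_prod_le_iff.1 hzq
  rw [Prod.fst_sub, Real.norm_eq_abs] at hzq1
  rw [abs_le] at hzq1
  rw [Prod.snd_sub] at hzq2
  have hcase : q.1 ≤ α ∨ β ≤ q.1 ∨ q.2 ∉ Ωv := by
    by_contra hcon
    push Not at hcon
    exact hq ⟨⟨hcon.1, hcon.2.1⟩, hcon.2.2⟩
  have hzx : α < z.1 ∧ z.1 < β := hz.1
  have hfst : ∀ y p : Phase, y ∈ Metric.ball p (ε * h) → |y.1 - p.1| < ε * h := fun y p hy => by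
    rw [Metric.mem_ball, dist_eq_norm] at hy
    simpa [Real.norm_eq_abs] using (norm_fst_le _).trans_lt hy
  rcases hcase with hqα | hqβ | hqv
  · refine ⟨(α - h, z.2), fun y hy hyΩ => ?_, ?_⟩
    · have h1 := abs_lt.1 (hfst _ _ hy)
      have h2 : α < y.1 := hyΩ.1.1
      simp only at h1
      linarith
    · refine norm_prod_le_iff.2 ⟨?_, by simp; positivity⟩
      rw [Prod.fst_sub, Real.norm_eq_abs]
      exact abs_le.2 ⟨by simp only; linarith, by simp only; linarith⟩
  · refine ⟨(β + h, z.2), fun y hy hyΩ => ?_, ?_⟩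
    · have h1 := abs_lt.1 (hfst _ _ hy)
      have h2 : y.1 < β := hyΩ.1.2
      simp only at h1
      linarith
    · refine norm_prod_le_iff.2 ⟨?_, by simp; positivity⟩
      rw [Prod.fst_sub, Real.norm_eq_abs]
      exact abs_le.2 ⟨by simp only; linarith, by simp only; linarith⟩
  · obtain ⟨a, haf, haz⟩ := exists_mem_frontier_of_segment hΩo hz.2 hqv
    obtain ⟨p, hp, hpa⟩ := hext h hh hhH a haf
    refine ⟨(z.1, p), fun y hy hyΩ => ?_, ?_⟩
    · refine hp ?_ hyΩ.2
      rw [Metric.mem_ball, dist_eq_norm] at hy ⊢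
      exact ((norm_snd_le _).trans_lt hy).trans_le (mul_le_mul_of_nonneg_right hεle hh.le)
    · refine norm_prod_le_iff.2 ⟨by simp; positivity, ?_⟩
      have h1 : p - z.2 = (p - a) + (a - z.2) := by abel
      rw [Prod.snd_sub, h1]
      refine (norm_add_le _ _).trans ?_
      linarith

end PhaseMesh

/-! ### Quasi-interpolation by local averages -/

theorem volume_ball_phase (p : Phase) (r : ℝ) :
    volume (Metric.ball p r) = ENNReal.ofReal (2 * r) ^ 3 := by
  obtain ⟨x, v1, v2⟩ := p
  rw [← ball_prod_same, ← ball_prod_same, Measure.volume_eq_prod, Measure.prod_prod,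
    Measure.volume_eq_prod, Measure.prod_prod]
  simp only [Real.volume_ball]
  ring

theorem volume_closedBall_phase (p : Phase) (r : ℝ) :
    volume (Metric.closedBall p r) = ENNReal.ofReal (2 * r) ^ 3 := by
  obtain ⟨x, v1, v2⟩ := p
  rw [← closedBall_prod_same, ← closedBall_prod_same, Measure.volume_eq_prod, Measure.prod_prod,
    Measure.volume_eq_prod, Measure.prod_prod]
  simp only [Real.volume_closedBall]
  ring

theorem sq_average_sub_le {u : Phase → ℝ} (hu : Continuous u) {z p : Phase} {r R : ℝ}
    (hr : 0 < r) (hsub : Metric.ball p r ⊆ Metric.closedBall z R) :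
    ((⨍ y in Metric.ball p r, u y) - u z) ^ 2
      ≤ ((2 * r) ^ 3)⁻¹ * ∫ y in Metric.closedBall z R, (u y - u z) ^ 2 := by
  have hvol : volume (Metric.ball p r) ≠ 0 := (Metric.measure_ball_pos _ _ hr).ne'
  have hvol' : volume (Metric.ball p r) ≠ ∞ := measure_ball_lt_top.ne
  have hint : ∀ f : Phase → ℝ, Continuous f → IntegrableOn f (Metric.closedBall z R) := fun f hf =>
    hf.continuousOn.integrableOn_compact (isCompact_closedBall z R)
  have hreal : volume.real (Metric.ball p r) = (2 * r) ^ 3 := by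
    rw [Measure.real, volume_ball_phase, ENNReal.toReal_pow, ENNReal.toReal_ofReal (by positivity)]
  have h1 : (⨍ y in Metric.ball p r, u y) - u z = ⨍ y in Metric.ball p r, (u y - u z) := by
    rw [setAverage_eq, setAverage_eq, integral_sub ((hint u hu).mono_set hsub)
      (integrableOn_const hvol'), smul_sub, setIntegral_const, smul_smul,
      inv_mul_cancel₀ (by rw [hreal]; positivity), one_smul]
  have h2 := (even_two.convexOn_pow (𝕜 := ℝ)).map_set_average_le (μ := volume)
    (t := Metric.ball p r) (f := fun y => u y - u z) (by fun_prop) isClosed_univ hvol hvol'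
    (by simp) ((hint _ (by fun_prop)).mono_set hsub)
    ((hint (fun y => (u y - u z) ^ 2) (by fun_prop)).mono_set hsub)
  rw [h1]
  refine h2.trans ?_
  rw [setAverage_eq, hreal, smul_eq_mul]
  refine mul_le_mul_of_nonneg_left ?_ (by positivity)
  exact setIntegral_mono_set (hint (fun y => (u y - u z) ^ 2) (by fun_prop))
    (Filter.Eventually.of_forall fun y => sq_nonneg _) hsub.eventuallyLE

theorem lintegral_local_oscillation_le {u : Phase → ℝ} (hu : Continuous u) {D : ℝ≥0∞}
    (hD : ∀ w : Phase, ∫⁻ z, ENNReal.ofReal ((u (z + w) - u z) ^ 2) ≤ ENNReal.ofReal (‖w‖ ^ 2) * D)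
    {R : ℝ} (hR : 0 ≤ R) :
    ∫⁻ z, ENNReal.ofReal (∫ y in Metric.closedBall z R, (u y - u z) ^ 2)
      ≤ ENNReal.ofReal ((2 * R) ^ 3 * R ^ 2) * D := by
  have : (volume : Measure (ℝ × ℝ)).IsAddHaarMeasure :=
    Measure.prod.instIsAddHaarMeasure volume volume
  have : (volume : Measure Phase).IsAddHaarMeasure :=
    Measure.prod.instIsAddHaarMeasure volume volume
  have h1 : ∀ z, ENNReal.ofReal (∫ y in Metric.closedBall z R, (u y - u z) ^ 2)
      = ∫⁻ w in Metric.closedBall 0 R, ENNReal.ofReal ((u (z + w) - u z) ^ 2) := by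
    intro z
    rw [ofReal_integral_eq_lintegral_ofReal
      ((show Continuous fun y => (u y - u z) ^ 2 by fun_prop).continuousOn.integrableOn_compact
        (isCompact_closedBall z R)) (Filter.Eventually.of_forall fun y => sq_nonneg _),
      ← lintegral_indicator measurableSet_closedBall,
      ← lintegral_indicator measurableSet_closedBall,
      ← lintegral_add_left_eq_self _ z]
    refine lintegral_congr fun w => ?_
    have : z + w ∈ Metric.closedBall z R ↔ w ∈ Metric.closedBall 0 R := by
      simp [dist_eq_norm]
    by_cases hw : w ∈ Metric.closedBall 0 R
    · rw [indicator_of_mem hw, indicator_of_mem (this.2 hw)]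
    · rw [indicator_of_notMem hw, indicator_of_notMem fun h => hw (this.1 h)]
  simp only [h1]
  have hmeas : Measurable fun p : Phase × Phase => ENNReal.ofReal ((u (p.1 + p.2) - u p.1) ^ 2) :=
    ENNReal.measurable_ofReal.comp
      (show Continuous fun p : Phase × Phase => (u (p.1 + p.2) - u p.1) ^ 2 by fun_prop).measurable
  rw [lintegral_lintegral_swap hmeas.aemeasurable]
  calc ∫⁻ w in Metric.closedBall 0 R, ∫⁻ z, ENNReal.ofReal ((u (z + w) - u z) ^ 2)
      ≤ ∫⁻ w in Metric.closedBall (0 : Phase) R, ENNReal.ofReal (R ^ 2) * D :=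
        setLIntegral_mono measurable_const fun w hw => (hD w).trans (by
          rw [mem_closedBall_zero_iff] at hw
          gcongr)
    _ = ENNReal.ofReal (R ^ 2) * D * ENNReal.ofReal (2 * R) ^ 3 := by
        rw [setLIntegral_const, volume_closedBall_phase]
    _ = _ := by
        rw [ENNReal.ofReal_mul (p := (2 * R) ^ 3) (by positivity),
          ENNReal.ofReal_pow (p := 2 * R) (by positivity) 3]
        ring

namespace PhaseMesh

variable {T α β : ℝ} {Ωv : Set (ℝ × ℝ)}

/-- Nodal values of the quasi-interpolant of `u`: averages over balls of radius `h`, replaced by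
zero at the nodes within distance `h` of the exterior. -/
noncomputable def nodalAverage (𝒯 : PhaseMesh T α β Ωv) (u : Phase → ℝ) (j : ℕ) (a : ℝ × ℝ) : ℝ := by
  classical
  exact if ∃ z ∉ phaseDomain α β Ωv, ‖z - (𝒯.x j, a)‖ ≤ 𝒯.h then 0
    else ⨍ y in Metric.ball (𝒯.x j, a) 𝒯.h, u y

theorem abs_nodalAverage_sub_le {𝒯 : PhaseMesh T α β Ωv} {u : Phase → ℝ} (hu : Continuous u)
    (hu0 : ∀ z ∉ phaseDomain α β Ωv, u z = 0) {ε : ℝ} (hε : 0 < ε) (hε1 : ε ≤ 1)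
    (hext : ∀ z ∈ phaseDomain α β Ωv, ∀ q ∉ phaseDomain α β Ωv, ‖z - q‖ ≤ 2 * 𝒯.h →
      ∃ p, Metric.ball p (ε * 𝒯.h) ⊆ (phaseDomain α β Ωv)ᶜ ∧ ‖p - z‖ ≤ 𝒯.h / ε)
    {z : Phase} (hz : z ∈ phaseDomain α β Ωv) {j : ℕ} {a : ℝ × ℝ} (hnode : ‖z - (𝒯.x j, a)‖ ≤ 𝒯.h) :
    |𝒯.nodalAverage u j a - u z| ≤ Real.sqrt (((2 * (ε * 𝒯.h)) ^ 3)⁻¹ *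
      ∫ y in Metric.closedBall z ((1 / ε + 1) * 𝒯.h), (u y - u z) ^ 2) := by
  have hh := 𝒯.h_pos
  apply Real.abs_le_sqrt
  have hdiv : (1 / ε + 1) * 𝒯.h = 𝒯.h / ε + 𝒯.h := by ring
  have hεh : ε * 𝒯.h ≤ 𝒯.h := by nlinarith
  have hhε : 𝒯.h ≤ 𝒯.h / ε := by
    rw [le_div_iff₀ hε]
    nlinarith
  unfold nodalAverage
  split_ifs with hcase
  · obtain ⟨q, hq, hqn⟩ := hcase
    obtain ⟨p, hp, hpz⟩ := hext z hz q hq (by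
      have h1 : z - q = (z - (𝒯.x j, a)) - (q - (𝒯.x j, a)) := by abel
      rw [h1]
      refine (norm_sub_le _ _).trans ?_
      linarith)
    have hsub : Metric.ball p (ε * 𝒯.h) ⊆ Metric.closedBall z ((1 / ε + 1) * 𝒯.h) := by
      intro y hy
      rw [Metric.mem_ball, dist_eq_norm] at hy
      rw [Metric.mem_closedBall, dist_eq_norm, ← sub_add_sub_cancel y p z]
      refine (norm_add_le _ _).trans ?_
      linarith
    have h1 := sq_average_sub_le hu (by positivity) hsub
    rwa [setAverage_eq, setIntegral_congr_fun measurableSet_ball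
      (fun y hy => hu0 y (hp hy) : EqOn u (fun _ => 0) _), integral_zero, smul_zero] at h1
  · have hsub : Metric.ball (𝒯.x j, a) 𝒯.h ⊆ Metric.closedBall z ((1 / ε + 1) * 𝒯.h) := by
      intro y hy
      rw [Metric.mem_ball, dist_eq_norm] at hy
      rw [Metric.mem_closedBall, dist_eq_norm, ← sub_sub_sub_cancel_right y z (𝒯.x j, a)]
      refine (norm_sub_le _ _).trans ?_
      linarith
    refine (sq_average_sub_le hu hh hsub).trans ?_
    refine mul_le_mul_of_nonneg_right ?_ (integral_nonneg fun y => sq_nonneg _)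
    gcongr

theorem exists_quasiInterp {σ ε : ℝ} {k : ℕ} (hk : 1 ≤ k) (hT : 0 < T) (hαβ : α < β)
    (hreg : Ωv = interior (closure Ωv)) (hσ : 0 < σ) (hε : 0 < ε) (hε1 : ε ≤ 1) :
    ∃ C : ℝ, 0 ≤ C ∧ ∀ 𝒯 : PhaseMesh T α β Ωv, 𝒯.ShapeRegular σ →
      (∀ z ∈ phaseDomain α β Ωv, ∀ q ∉ phaseDomain α β Ωv, ‖z - q‖ ≤ 2 * 𝒯.h →
        ∃ p, Metric.ball p (ε * 𝒯.h) ⊆ (phaseDomain α β Ωv)ᶜ ∧ ‖p - z‖ ≤ 𝒯.h / ε) →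
      ∀ u : Phase → ℝ, Continuous u → (∀ z ∉ phaseDomain α β Ωv, u z = 0) → ∀ D : ℝ≥0∞,
      (∀ w : Phase, ∫⁻ z, ENNReal.ofReal ((u (z + w) - u z) ^ 2) ≤ ENNReal.ofReal (‖w‖ ^ 2) * D) →
      ∃ g : Phase → ℝ, (𝒯.MemV k fun _ q => g q.2) ∧
        ∫⁻ z in phaseDomain α β Ωv, ENNReal.ofReal
          ((|g z - u z| + 𝒯.h * (|dX g z| + |dV₁ g z| + |dV₂ g z|)) ^ 2)
            ≤ ENNReal.ofReal (C * 𝒯.h ^ 2) * D := by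
  set A : ℝ := (1 + 9 / σ) ^ 2 * ((2 * ε) ^ 3)⁻¹
  set R : ℝ := 1 / ε + 1
  refine ⟨A * ((2 * R) ^ 3 * R ^ 2), by positivity, fun 𝒯 hsh hext u hu hu0 D hD => ?_⟩
  have hh := 𝒯.h_pos
  have hΩm : MeasurableSet (phaseDomain α β Ωv) := by
    have : IsOpen Ωv := by
      rw [hreg]
      exact isOpen_interior
    exact (isOpen_Ioo.prod this).measurableSet
  refine ⟨𝒯.interp (𝒯.nodalAverage u), memV_interp hk hT hαβ hreg hsh ?_, ?_⟩
  · intro i a z hz hza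
    rw [nodalAverage, if_pos ⟨z, hz, hza⟩]
  have hpt : ∀ᵐ z, z ∈ phaseDomain α β Ωv → ENNReal.ofReal ((|𝒯.interp (𝒯.nodalAverage u) z - u z|
      + 𝒯.h * (|dX (𝒯.interp (𝒯.nodalAverage u)) z| + |dV₁ (𝒯.interp (𝒯.nodalAverage u)) z|
        + |dV₂ (𝒯.interp (𝒯.nodalAverage u)) z|)) ^ 2)
      ≤ ENNReal.ofReal (A * (𝒯.h ^ 3)⁻¹) *
        ENNReal.ofReal (∫ y in Metric.closedBall z (R * 𝒯.h), (u y - u z) ^ 2) := by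
    filter_upwards [𝒯.ae_mem_elementInterior hαβ hreg] with z hzel hz
    obtain ⟨j, hj, s, hs, hzint⟩ := hzel hz
    have hx : z.1 ∈ Icc (𝒯.x j) (𝒯.x (j + 1)) := Ioo_subset_Icc_self hzint.1
    have hv : z.2 ∈ convexHull ℝ (s : Set (ℝ × ℝ)) := interior_subset hzint.2
    set I := ∫ y in Metric.closedBall z (R * 𝒯.h), (u y - u z) ^ 2
    have hI : 0 ≤ I := integral_nonneg fun y => sq_nonneg _
    set d := Real.sqrt (((2 * (ε * 𝒯.h)) ^ 3)⁻¹ * I)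
    have hd0 : 0 ≤ d := Real.sqrt_nonneg _
    have hd2 : d ^ 2 = ((2 * (ε * 𝒯.h)) ^ 3)⁻¹ * I := Real.sq_sqrt (by positivity)
    obtain ⟨b0, b1, b2, b3⟩ := interp_bounds hσ hsh hj hs hzint (U := 𝒯.nodalAverage u) (c := u z)
      (d := d) fun a ha => by
        obtain ⟨n1, n2⟩ := norm_sub_node_le hT hsh hj hs hx hv ha
        exact ⟨abs_nodalAverage_sub_le hu hu0 hε hε1 hext hz n1,
          abs_nodalAverage_sub_le hu hu0 hε hε1 hext hz n2⟩
    rw [← ENNReal.ofReal_mul (by positivity)]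
    apply ENNReal.ofReal_le_ofReal
    have e1 : A * (𝒯.h ^ 3)⁻¹ * I = ((1 + 9 / σ) * d) ^ 2 := by
      rw [mul_pow, hd2]
      simp only [A]
      field_simp
    rw [e1]
    refine pow_le_pow_left₀ (by positivity) ?_ 2
    have e2 : (1 + 9 / σ) * d = d + 𝒯.h * (3 * d / (σ * 𝒯.h) + 3 * d / (σ * 𝒯.h)
        + 3 * d / (σ * 𝒯.h)) := by
      field_simp
      ring
    rw [e2]
    gcongr
  calc _ ≤ ∫⁻ z in phaseDomain α β Ωv, ENNReal.ofReal (A * (𝒯.h ^ 3)⁻¹) *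
        ENNReal.ofReal (∫ y in Metric.closedBall z (R * 𝒯.h), (u y - u z) ^ 2) :=
        lintegral_mono_ae ((ae_restrict_iff' hΩm).2 hpt)
    _ ≤ ∫⁻ z, ENNReal.ofReal (A * (𝒯.h ^ 3)⁻¹) *
        ENNReal.ofReal (∫ y in Metric.closedBall z (R * 𝒯.h), (u y - u z) ^ 2) :=
        setLIntegral_le_lintegral _ _
    _ = ENNReal.ofReal (A * (𝒯.h ^ 3)⁻¹) *
        ∫⁻ z, ENNReal.ofReal (∫ y in Metric.closedBall z (R * 𝒯.h), (u y - u z) ^ 2) :=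
        lintegral_const_mul' _ _ ENNReal.ofReal_ne_top
    _ ≤ ENNReal.ofReal (A * (𝒯.h ^ 3)⁻¹) *
        (ENNReal.ofReal ((2 * (R * 𝒯.h)) ^ 3 * (R * 𝒯.h) ^ 2) * D) := by
        gcongr
        exact lintegral_local_oscillation_le hu hD (by positivity)
    _ = _ := by
        rw [← mul_assoc, ← ENNReal.ofReal_mul (by positivity)]
        congr 2
        field_simp

end PhaseMesh

/-! ### Extension of fields beyond a slab -/

theorem exists_isLipschitzField_extension {W : ℝ × ℝ → ℝ × ℝ × ℝ} {a b α β L : ℝ} (hab : a ≤ b)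
    (hαβ : α ≤ β) (hc : ContinuousOn W (Icc a b ×ˢ Icc α β)) (h0 : ∀ t ∈ Icc a b, W (t, α) = 0)
    (hL : ∀ t ∈ Icc a b, ∀ x ∈ Icc α β, ∀ y ∈ Icc α β, ‖W (t, x) - W (t, y)‖ ≤ L * |x - y|) :
    ∃ W', IsLipschitzField W' (|L| * (β - α)).toNNReal |L|.toNNReal ∧
      EqOn W' W (Icc a b ×ˢ Icc α β) := by
  have hL0 : 0 ≤ |L| := abs_nonneg L
  have hL' : ∀ t ∈ Icc a b, ∀ x ∈ Icc α β, ∀ y ∈ Icc α β, ‖W (t, x) - W (t, y)‖ ≤ |L| * |x - y| :=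
    fun t ht x hx y hy => (hL t ht x hx y hy).trans
      (mul_le_mul_of_nonneg_right (le_abs_self L) (abs_nonneg _))
  refine ⟨fun p => W (projIcc a b hab p.1, projIcc α β hαβ p.2), ⟨?_, fun p => ?_, fun t x y => ?_⟩,
    fun p hp => ?_⟩
  · refine hc.comp_continuous ?_ fun p => ⟨(projIcc a b hab p.1).2, (projIcc α β hαβ p.2).2⟩
    exact (continuous_subtype_val.comp (continuous_projIcc.comp continuous_fst)).prodMk
      (continuous_subtype_val.comp (continuous_projIcc.comp continuous_snd))
  · have h1 := hL' _ (projIcc a b hab p.1).2 _ (projIcc α β hαβ p.2).2 α ⟨le_rfl, hαβ⟩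
    rw [h0 _ (projIcc a b hab p.1).2, sub_zero] at h1
    rw [Real.coe_toNNReal _ (mul_nonneg hL0 (sub_nonneg.2 hαβ))]
    refine h1.trans (mul_le_mul_of_nonneg_left ?_ hL0)
    have h2 := (projIcc α β hαβ p.2).2
    rw [abs_of_nonneg (sub_nonneg.2 h2.1)]
    linarith [h2.2]
  · rw [Real.coe_toNNReal _ hL0]
    exact (hL' _ (projIcc a b hab t).2 _ (projIcc α β hαβ x).2 _ (projIcc α β hαβ y).2).trans
      (mul_le_mul_of_nonneg_left (abs_projIcc_sub_projIcc hαβ) hL0)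
  · simp only [projIcc_of_mem hab hp.1, projIcc_of_mem hαβ hp.2]

/-! ### The transport operator on discrete functions -/

theorem transport_eq_fderiv {F : ℝ × Phase → ℝ} {q : ℝ × Phase} (hF : DifferentiableAt ℝ F q)
    (G : ℝ × Phase → Phase) : transport G F q = fderiv ℝ F q (1, G q) := by
  obtain ⟨t, x, v, w⟩ := q
  have h := hF.hasFDerivAt
  have e1 : deriv (fun s => F (s, x, v, w)) t = fderiv ℝ F (t, x, v, w) (1, 0, 0, 0) :=
    (h.comp_hasDerivAt t (f := fun s => (s, x, v, w)) ((hasDerivAt_id t).prodMk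
      (hasDerivAt_const t (x, v, w)))).deriv
  have e2 : deriv (fun y => F (t, y, v, w)) x = fderiv ℝ F (t, x, v, w) (0, 1, 0, 0) :=
    (h.comp_hasDerivAt x (f := fun y => (t, y, v, w)) ((hasDerivAt_const x t).prodMk
      ((hasDerivAt_id x).prodMk (hasDerivAt_const x (v, w))))).deriv
  have e3 : deriv (fun y => F (t, x, y, w)) v = fderiv ℝ F (t, x, v, w) (0, 0, 1, 0) :=
    (h.comp_hasDerivAt v (f := fun y => (t, x, y, w)) ((hasDerivAt_const v t).prodMk
      ((hasDerivAt_const v x).prodMk ((hasDerivAt_id v).prodMk (hasDerivAt_const v w))))).deriv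
  have e4 : deriv (fun y => F (t, x, v, y)) w = fderiv ℝ F (t, x, v, w) (0, 0, 0, 1) :=
    (h.comp_hasDerivAt w (f := fun y => (t, x, v, y)) ((hasDerivAt_const w t).prodMk
      ((hasDerivAt_const w x).prodMk ((hasDerivAt_const w v).prodMk (hasDerivAt_id w))))).deriv
  unfold transport dX dV₁ dV₂
  simp only
  rw [e1, e2, e3, e4]
  have : ((1 : ℝ), G (t, x, v, w)) = (1, 0, 0, 0) + (G (t, x, v, w)).1 • ((0 : ℝ), (1 : ℝ), (0 : ℝ), (0 : ℝ))
      + (G (t, x, v, w)).2.1 • ((0 : ℝ), (0 : ℝ), (1 : ℝ), (0 : ℝ))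
      + (G (t, x, v, w)).2.2 • ((0 : ℝ), (0 : ℝ), (0 : ℝ), (1 : ℝ)) := by
    simp
  rw [this]
  simp only [map_add, map_smul, smul_eq_mul]

theorem transport_congr {F F' : ℝ × Phase → ℝ} {G G' : ℝ × Phase → Phase} {q : ℝ × Phase}
    (hF : F =ᶠ[nhds q] F') (hd : DifferentiableAt ℝ F' q) (hG : G q = G' q) :
    transport G F q = transport G' F' q := by
  rw [transport_eq_fderiv (hd.congr_of_eventuallyEq hF), transport_eq_fderiv hd, hF.fderiv_eq, hG]

namespace PhaseMesh

variable {T α β : ℝ} {Ωv : Set (ℝ × ℝ)} {𝒯 : PhaseMesh T α β Ωv} {k : ℕ} {w : ℕ → ℝ × Phase → ℝ}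

theorem isOpen_phaseDomain (hreg : Ωv = interior (closure Ωv)) : IsOpen (phaseDomain α β Ωv) := by
  rw [phaseDomain, hreg]
  exact isOpen_Ioo.prod isOpen_interior

theorem isCompact_closure_phaseDomain (hb : Bornology.IsBounded Ωv) :
    IsCompact (closure (phaseDomain α β Ωv)) :=
  ((Metric.isBounded_Ioo α β).prod hb).isCompact_closure

theorem volume_slab_lt_top (𝒯 : PhaseMesh T α β Ωv) (hb : Bornology.IsBounded Ωv) (m : ℕ) :
    volume (𝒯.slab m) < ∞ :=
  ((Metric.isBounded_Ioc _ _).prod ((Metric.isBounded_Ioo α β).prod hb)).measure_lt_top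

theorem finite_elements (𝒯 : PhaseMesh T α β Ωv) :
    {i : ℕ × Finset (ℝ × ℝ) | i.1 < 𝒯.N ∧ i.2 ∈ 𝒯.triangles}.Finite :=
  (finite_Iio 𝒯.N).prod 𝒯.triangles_finite

theorem MemV.exists_contDiff (hw : 𝒯.MemV k w) {m : ℕ} (hm : m < 𝒯.M) {j : ℕ} (hj : j < 𝒯.N)
    {s : Finset (ℝ × ℝ)} (hs : s ∈ 𝒯.triangles) :
    ∃ p : ℝ × Phase → ℝ, ContDiff ℝ 1 p ∧ EqOn (w m) p (Icc (𝒯.t m) (𝒯.t (m + 1)) ×ˢ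
      (Icc (𝒯.x j) (𝒯.x (j + 1)) ×ˢ convexHull ℝ (s : Set (ℝ × ℝ)))) := by
  obtain ⟨c, hc⟩ := (hw m hm).2.2 j hj s hs
  refine ⟨fun q => ∑ a ∈ Finset.range (k + 1), ∑ b ∈ Finset.range (k + 1),
      ∑ d ∈ Finset.range (k + 1), ∑ e ∈ Finset.range (k + 1 - d),
        c a b d e * (q.1 ^ a * q.2.1 ^ b * (q.2.2.1 ^ d * q.2.2.2 ^ e)), by fun_prop,
    fun q hq => hc q.1 hq.1 q.2.1 hq.2.1 q.2.2 hq.2.2⟩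

theorem MemV.exists_contDiff_open (hw : 𝒯.MemV k w) {m : ℕ} (hm : m < 𝒯.M) {j : ℕ} (hj : j < 𝒯.N)
    {s : Finset (ℝ × ℝ)} (hs : s ∈ 𝒯.triangles) :
    ∃ p : ℝ × Phase → ℝ, ContDiff ℝ 1 p ∧
      ∀ q ∈ Ioo (𝒯.t m) (𝒯.t (m + 1)) ×ˢ 𝒯.elementInterior j s, w m =ᶠ[nhds q] p := by
  obtain ⟨p, hp, he⟩ := hw.exists_contDiff hm hj hs
  refine ⟨p, hp, fun q hq => ?_⟩
  filter_upwards [(isOpen_Ioo.prod (𝒯.isOpen_elementInterior j s)).mem_nhds hq] with q' hq'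
  exact he ⟨Ioo_subset_Icc_self hq'.1, Ioo_subset_Icc_self hq'.2.1, interior_subset hq'.2.2⟩

theorem ae_mem_element (𝒯 : PhaseMesh T α β Ωv) (hαβ : α < β) (hreg : Ωv = interior (closure Ωv))
    (m : ℕ) : ∀ᵐ q ∂(volume.restrict (𝒯.slab m)), ∃ j < 𝒯.N, ∃ s ∈ 𝒯.triangles,
      q ∈ Ioo (𝒯.t m) (𝒯.t (m + 1)) ×ˢ 𝒯.elementInterior j s := by
  have hΩm := (isOpen_phaseDomain (α := α) (β := β) hreg).measurableSet
  rw [slab, ae_restrict_iff' (measurableSet_Ioc.prod hΩm)]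
  have h1 : ∀ᵐ q : ℝ × Phase, q.1 ≠ 𝒯.t (m + 1) := by
    rw [Measure.volume_eq_prod]
    exact Measure.quasiMeasurePreserving_fst.ae
      (show ∀ᵐ t : ℝ, t ≠ 𝒯.t (m + 1) by simp [ae_iff])
  have h2 : ∀ᵐ q : ℝ × Phase, q.2 ∈ phaseDomain α β Ωv →
      ∃ j < 𝒯.N, ∃ s ∈ 𝒯.triangles, q.2 ∈ 𝒯.elementInterior j s := by
    rw [Measure.volume_eq_prod]
    exact Measure.quasiMeasurePreserving_snd.ae (𝒯.ae_mem_elementInterior hαβ hreg)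
  filter_upwards [h1, h2] with q hq1 hq2 hq
  obtain ⟨j, hj, s, hs, hqs⟩ := hq2 hq.2
  exact ⟨j, hj, s, hs, ⟨hq.1.1, lt_of_le_of_ne hq.1.2 hq1⟩, hqs⟩

theorem MemV.ae_differentiableAt (hw : 𝒯.MemV k w) (hαβ : α < β)
    (hreg : Ωv = interior (closure Ωv)) {m : ℕ} (hm : m < 𝒯.M) :
    ∀ᵐ q ∂(volume.restrict (𝒯.slab m)), DifferentiableAt ℝ (w m) q := by
  filter_upwards [𝒯.ae_mem_element hαβ hreg m] with q hq
  obtain ⟨j, hj, s, hs, hqs⟩ := hq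
  obtain ⟨p, hp, he⟩ := hw.exists_contDiff_open hm hj hs
  exact (hp.differentiable one_ne_zero q).congr_of_eventuallyEq (he q hqs)

theorem MemV.memLp_transport (hw : 𝒯.MemV k w) (hb : Bornology.IsBounded Ωv) (hαβ : α < β)
    (hreg : Ωv = interior (closure Ωv)) {m : ℕ} (hm : m < 𝒯.M) {G : ℝ × Phase → Phase}
    (hG : Continuous G) : MemLp (transport G (w m)) ⊤ (volume.restrict (𝒯.slab m)) := by
  set I := {i : ℕ × Finset (ℝ × ℝ) | i.1 < 𝒯.N ∧ i.2 ∈ 𝒯.triangles}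
  have hI : I.Finite := 𝒯.finite_elements
  set O : ℕ × Finset (ℝ × ℝ) → Set (ℝ × Phase) := fun i =>
    Ioo (𝒯.t m) (𝒯.t (m + 1)) ×ˢ 𝒯.elementInterior i.1 i.2
  have hO : ∀ i, IsOpen (O i) := fun i => isOpen_Ioo.prod (𝒯.isOpen_elementInterior _ _)
  have hp : ∀ i ∈ I, ∃ p : ℝ × Phase → ℝ, Continuous p ∧ EqOn (transport G (w m)) p (O i) := by
    intro i hi
    obtain ⟨p, hp, he⟩ := hw.exists_contDiff_open hm hi.1 hi.2
    refine ⟨fun q => fderiv ℝ p q (1, G q),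
      (hp.continuous_fderiv one_ne_zero).clm_apply (continuous_const.prodMk hG), fun q hq => ?_⟩
    rw [transport_congr (he q hq) (hp.differentiable one_ne_zero q) rfl,
      transport_eq_fderiv (hp.differentiable one_ne_zero q)]
  have hcov : ∀ᵐ q ∂(volume.restrict (𝒯.slab m)), q ∈ ⋃ i ∈ I, O i := by
    filter_upwards [𝒯.ae_mem_element hαβ hreg m] with q ⟨j, hj, s, hs, hq⟩
    exact mem_iUnion₂.2 ⟨(j, s), ⟨hj, hs⟩, hq⟩
  have hcpt : IsCompact (Icc (𝒯.t m) (𝒯.t (m + 1)) ×ˢ closure (phaseDomain α β Ωv)) :=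
    isCompact_Icc.prod (isCompact_closure_phaseDomain hb)
  have hbd : ∃ C : ℝ, ∀ i ∈ I, ∀ q ∈ O i, ‖transport G (w m) q‖ ≤ C := by
    refine ((Filter.eventually_all_finite (l := Filter.atTop) hI).2 fun i hi => ?_).exists
    obtain ⟨p, hpc, he⟩ := hp i hi
    obtain ⟨C, hC⟩ := hcpt.exists_bound_of_continuousOn hpc.continuousOn
    filter_upwards [Filter.eventually_ge_atTop C] with C' hC' q hq
    rw [he hq]
    refine (hC q ⟨Ioo_subset_Icc_self hq.1, ?_⟩).trans hC'
    exact subset_closure (𝒯.elementInterior_subset hreg hi.1 hi.2 hq.2)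
  obtain ⟨C, hC⟩ := hbd
  refine memLp_top_of_bound ?_ C ?_
  · have h1 : AEStronglyMeasurable (transport G (w m)) (volume.restrict (⋃ i ∈ I, O i)) := by
      rw [biUnion_eq_iUnion]
      have : Countable I := hI.countable
      rw [aestronglyMeasurable_iUnion_iff]
      intro i
      obtain ⟨p, hpc, he⟩ := hp i i.2
      exact hpc.aestronglyMeasurable.congr
        ((ae_restrict_iff' (hO i).measurableSet).2 (Filter.Eventually.of_forall fun q hq => (he hq).symm))
    have h2 : volume.restrict (𝒯.slab m) = (volume.restrict (𝒯.slab m)).restrict (⋃ i ∈ I, O i) :=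
      (Measure.restrict_eq_self_of_ae_mem hcov).symm
    rw [h2, Measure.restrict_restrict (isOpen_biUnion fun i _ => hO i).measurableSet]
    exact h1.mono_measure (Measure.restrict_mono inter_subset_left le_rfl)
  · filter_upwards [hcov] with q hq
    obtain ⟨i, hi, hqi⟩ := mem_iUnion₂.1 hq
    exact hC i hi q hqi

theorem MemV.exists_lipschitzOnWith_path (hw : 𝒯.MemV k w) (hαβ : α < β)
    (hreg : Ωv = interior (closure Ωv)) {m : ℕ} (hm : m < 𝒯.M) (B : ℝ≥0) :
    ∃ Λ : ℝ≥0, ∀ γ : ℝ → Phase, LipschitzWith B γ →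
      (∀ t ∈ Icc (𝒯.t m) (𝒯.t (m + 1)), γ t ∈ closure (phaseDomain α β Ωv)) →
      LipschitzOnWith Λ (fun t => w m (t, γ t)) (Icc (𝒯.t m) (𝒯.t (m + 1))) := by
  set I := {i : ℕ × Finset (ℝ × ℝ) | i.1 < 𝒯.N ∧ i.2 ∈ 𝒯.triangles}
  have hI : I.Finite := 𝒯.finite_elements
  set J := Icc (𝒯.t m) (𝒯.t (m + 1))
  set E : ℕ × Finset (ℝ × ℝ) → Set Phase := fun i =>
    Icc (𝒯.x i.1) (𝒯.x (i.1 + 1)) ×ˢ convexHull ℝ (i.2 : Set (ℝ × ℝ))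
  have hE : ∀ i, IsCompact (E i) := fun i => isCompact_Icc.prod (isCompact_convexHull _)
  have hK : ∃ K : ℝ≥0, ∀ i ∈ I, LipschitzOnWith K (w m) (J ×ˢ E i) := by
    refine ((Filter.eventually_all_finite (l := Filter.atTop) hI).2 fun i hi => ?_).exists
    obtain ⟨p, hp, he⟩ := hw.exists_contDiff hm hi.1 hi.2
    obtain ⟨K, hK⟩ := hp.contDiffOn.exists_lipschitzOnWith one_ne_zero
      ((convex_Icc _ _).prod ((convex_Icc _ _).prod (convex_convexHull ℝ (i.2 : Set (ℝ × ℝ)))))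
      (isCompact_Icc.prod (hE i))
    filter_upwards [Filter.eventually_ge_atTop K] with K' hK' q hq q' hq'
    rw [he hq, he hq']
    exact (hK.weaken hK') hq hq'
  obtain ⟨K, hK⟩ := hK
  refine ⟨K * max 1 B, fun γ hγ hmem => ?_⟩
  have hc : ContinuousOn (fun t => w m (t, γ t)) J :=
    (hw m hm).1.comp (continuousOn_id.prodMk hγ.continuous.continuousOn)
      fun t ht => ⟨ht, hmem t ht⟩
  have : Finite I := hI
  have hpath : LipschitzWith (max 1 B) fun t => (t, γ t) := LipschitzWith.id.prodMk hγ
  refine LipschitzOnWith.of_dist_le_mul fun t ht t' ht' => ?_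
  rw [Real.dist_eq, Real.dist_eq]
  refine abs_sub_le_of_closed_cover hc (fun i : I => γ ⁻¹' E i)
    (fun i => (hE i).isClosed.preimage hγ.continuous) (fun r hr => ?_) (fun i r hr r' hr' => ?_) ht ht'
  · have := hmem r hr
    rw [closure_phaseDomain hαβ] at this
    obtain ⟨j, hj, hx⟩ := 𝒯.exists_interval_mem hαβ this.1
    obtain ⟨s, hs, hv⟩ := 𝒯.exists_triangle_mem hreg this.2
    exact mem_iUnion.2 ⟨⟨(j, s), hj, hs⟩, hx, hv⟩
  · have h1 := (hK i i.2).dist_le_mul (r, γ r) ⟨hr.2, hr.1⟩ (r', γ r') ⟨hr'.2, hr'.1⟩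
    have h2 := hpath.dist_le_mul r r'
    rw [Real.dist_eq] at h1 h2
    push_cast at h2 ⊢
    rw [mul_assoc]
    exact h1.trans (mul_le_mul_of_nonneg_left h2 K.2)

end PhaseMesh

/-! ### Integration along the flow -/

namespace IsFlow

variable {E : Type*} [NormedAddCommGroup E] [NormedSpace ℝ E] {v : ℝ → E → E} {K B : ℝ≥0}
  {φ : ℝ → ℝ → E → E}

/-- The flow between two fixed times. -/
def homeomorph (h : IsFlow v K B φ) (s t : ℝ) : E ≃ₜ E where
  toFun := φ s t
  invFun := φ t s
  left_inv z := h.comp_cancel t s z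
  right_inv z := h.comp_cancel s t z
  continuous_toFun := (h.lipschitz s t).continuous
  continuous_invFun := (h.lipschitz t s).continuous

/-- The space-time map that follows the flow from the initial time `a`. -/
def skewHomeomorph (h : IsFlow v K B φ) (a : ℝ) : ℝ × E ≃ₜ ℝ × E where
  toFun p := (p.1, φ a p.1 p.2)
  invFun p := (p.1, φ p.1 a p.2)
  left_inv p := by simp [h.comp_cancel]
  right_inv p := by simp [h.comp_cancel]
  continuous_toFun := _root_.continuous_fst.prodMk (h.continuous_snd a)
  continuous_invFun := _root_.continuous_fst.prodMk (h.continuous_fst a)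

end IsFlow

namespace IsLipschitzField

variable {W : ℝ × ℝ → ℝ × ℝ × ℝ} {b ℓ : ℝ≥0} {φ : ℝ → ℝ → Phase → Phase}

theorem measurePreserving_skew (h : IsLipschitzField W b ℓ) (hφ : IsDriftFlow W b ℓ φ) (s : ℝ)
    (I : Set ℝ) : MeasurePreserving (hφ.skewHomeomorph s)
      ((volume.restrict I).prod volume) ((volume.restrict I).prod volume) :=
  (MeasurePreserving.id _).skew_product (g := fun t z => φ s t z) (hφ.continuous_snd s).measurable
    (Filter.Eventually.of_forall fun t => (h.measurePreserving_flow hφ s t).map_eq)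

/-- The weak form of the transport equation on a time slab, tested with a solution of the dual
problem. -/
theorem integral_transport_mul (h : IsLipschitzField W b ℓ) (hφ : IsDriftFlow W b ℓ φ)
    {t₀ t₁ : ℝ} (ht : t₀ ≤ t₁) {Ω : Set Phase} (hΩ : MeasurableSet Ω) {F : ℝ × Phase → ℝ}
    {ψ : Phase → ℝ}
    (hpath : ∀ y, ψ (φ t₀ t₁ y) ≠ 0 → ∀ s ∈ Icc t₀ t₁, φ t₀ s y ∈ Ω)
    {Λ : ℝ≥0} (hF : ∀ y, (∀ s ∈ Icc t₀ t₁, φ t₀ s y ∈ Ω) →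
      LipschitzOnWith Λ (fun s => F (s, φ t₀ s y)) (Icc t₀ t₁))
    (hFd : ∀ᵐ q ∂(volume.restrict (Ioc t₀ t₁ ×ˢ Ω)), DifferentiableAt ℝ F q)
    (hint : IntegrableOn (fun q => transport (drift W) F q * ψ (φ q.1 t₁ q.2)) (Ioc t₀ t₁ ×ˢ Ω))
    (hint₀ : IntegrableOn (fun z => F (t₀, z) * ψ (φ t₀ t₁ z)) Ω)
    (hint₁ : IntegrableOn (fun z => F (t₁, z) * ψ z) Ω) :
    ∫ q in Ioc t₀ t₁ ×ˢ Ω, transport (drift W) F q * ψ (φ q.1 t₁ q.2)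
      = (∫ z in Ω, F (t₁, z) * ψ z) - ∫ z in Ω, F (t₀, z) * ψ (φ t₀ t₁ z) := by
  have hm₁ := h.measurePreserving_flow hφ t₀ t₁
  have hsk := h.measurePreserving_skew hφ t₀ (Ioc t₀ t₁)
  set μ := ((volume : Measure ℝ).restrict (Ioc t₀ t₁)).prod (volume : Measure Phase) with hμ
  set S : Set (ℝ × Phase) := univ ×ˢ Ω with hS
  have hSm : MeasurableSet S := MeasurableSet.univ.prod hΩ
  have hmeq : volume.restrict (Ioc t₀ t₁ ×ˢ Ω) = μ.restrict S := by
    rw [hμ, hS, ← Measure.prod_restrict, Measure.restrict_univ, Measure.volume_eq_prod,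
      Measure.prod_restrict]
  set f : ℝ × Phase → ℝ := fun q => transport (drift W) F q * ψ (φ q.1 t₁ q.2) with hf
  have hfi : Integrable (S.indicator f) μ := by
    rw [integrable_indicator_iff hSm, IntegrableOn, ← hmeq]
    exact hint
  have hfi' : Integrable (fun p => S.indicator f (hφ.skewHomeomorph t₀ p)) μ :=
    (hsk.integrable_comp_emb (hφ.skewHomeomorph t₀).measurableEmbedding).2 hfi
  have hd : ∀ᵐ y : Phase, ∀ᵐ s ∂((volume : Measure ℝ).restrict (Ioc t₀ t₁)),
      φ t₀ s y ∈ Ω → DifferentiableAt ℝ F (s, φ t₀ s y) := by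
    rw [hmeq, ae_restrict_iff' hSm] at hFd
    have h1 := hsk.quasiMeasurePreserving.ae hFd
    have h2 := (Measure.measurePreserving_swap (μ := (volume : Measure Phase))
      (ν := (volume : Measure ℝ).restrict (Ioc t₀ t₁))).quasiMeasurePreserving.ae h1
    filter_upwards [Measure.ae_ae_of_ae_prod h2] with y hy
    filter_upwards [hy] with s hs hsΩ
    exact hs ⟨trivial, hsΩ⟩
  have hinner : ∀ᵐ y : Phase, ∫ s in Ioc t₀ t₁, S.indicator f (s, φ t₀ s y)
      = Ω.indicator (fun z => F (t₁, z) * ψ z) (φ t₀ t₁ y)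
        - Ω.indicator (fun z => F (t₀, z) * ψ (φ t₀ t₁ z)) y := by
    filter_upwards [hd] with y hy
    have hfs : ∀ s, f (s, φ t₀ s y)
        = transport (drift W) F (s, φ t₀ s y) * ψ (φ t₀ t₁ y) := fun s => by
      simp only [hf, hφ.comp]
    by_cases hc : ψ (φ t₀ t₁ y) = 0
    · have h1 : ∀ s, S.indicator f (s, φ t₀ s y) = 0 := fun s => by
        rw [indicator_apply_eq_zero, hfs, hc]
        simp
      have h2 : Ω.indicator (fun z => F (t₁, z) * ψ z) (φ t₀ t₁ y) = 0 := by
        rw [indicator_apply_eq_zero, hc]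
        simp
      have h3 : Ω.indicator (fun z => F (t₀, z) * ψ (φ t₀ t₁ z)) y = 0 := by
        rw [indicator_apply_eq_zero, hc]
        simp
      simp only [h1, h2, h3, integral_zero, sub_zero]
    have hin := hpath y hc
    have h1Ω := hin t₁ ⟨ht, le_rfl⟩
    have h0Ω := hin t₀ ⟨le_rfl, ht⟩
    rw [hφ.self] at h0Ω
    rw [indicator_of_mem h1Ω, indicator_of_mem h0Ω]
    have hac := (hF y hin)
    rw [← uIcc_of_le ht] at hac
    have hftc := hac.absolutelyContinuousOnInterval.integral_deriv_eq_sub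
    simp only [hφ.self] at hftc
    rw [← sub_mul, ← hftc, intervalIntegral.integral_of_le ht, ← integral_mul_const]
    refine integral_congr_ae ?_
    filter_upwards [hy, ae_restrict_mem measurableSet_Ioc] with s hs hsI
    have hsΩ := hin s (Ioc_subset_Icc_self hsI)
    have hdF := hs hsΩ
    rw [indicator_of_mem (show (s, φ t₀ s y) ∈ S from ⟨trivial, hsΩ⟩), hfs,
      transport_eq_fderiv hdF]
    congr 1
    exact (hdF.hasFDerivAt.comp_hasDerivAt s (f := fun s => (s, φ t₀ s y))
      ((hasDerivAt_id s).prodMk (hφ.hasDerivAt t₀ s y))).deriv.symm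
  have hi₁ : Integrable (fun y => Ω.indicator (fun z => F (t₁, z) * ψ z) (φ t₀ t₁ y)) :=
    (hm₁.integrable_comp_emb (hφ.homeomorph t₀ t₁).measurableEmbedding).2
      ((integrable_indicator_iff hΩ).2 hint₁)
  have hi₀ := (integrable_indicator_iff hΩ).2 hint₀
  calc ∫ q in Ioc t₀ t₁ ×ˢ Ω, f q = ∫ q, S.indicator f q ∂μ := by
        rw [hmeq, integral_indicator hSm]
    _ = ∫ p, S.indicator f (hφ.skewHomeomorph t₀ p) ∂μ :=
        (hsk.integral_comp (hφ.skewHomeomorph t₀).measurableEmbedding _).symm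
    _ = ∫ y, ∫ s in Ioc t₀ t₁, S.indicator f (s, φ t₀ s y) := integral_prod_symm _ hfi'
    _ = _ := integral_congr_ae hinner
    _ = _ := by
        rw [integral_sub hi₁ hi₀, integral_indicator hΩ,
          hm₁.integral_comp (hφ.homeomorph t₀ t₁).measurableEmbedding
            (Ω.indicator fun z => F (t₁, z) * ψ z), integral_indicator hΩ]

end IsLipschitzField

instance : (volume : Measure (ℝ × ℝ)).IsAddHaarMeasure :=
  Measure.prod.instIsAddHaarMeasure volume volume

instance : (volume : Measure Phase).IsAddHaarMeasure :=
  Measure.prod.instIsAddHaarMeasure volume volume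

/-! ### Time levels -/

namespace PhaseMesh

variable {T α β : ℝ} {Ωv : Set (ℝ × ℝ)} (𝒯 : PhaseMesh T α β Ωv)

theorem t_mono {m n : ℕ} (hmn : m ≤ n) (hn : n ≤ 𝒯.M) : 𝒯.t m ≤ 𝒯.t n := by
  induction n, hmn using Nat.le_induction with
  | base => exact le_rfl
  | succ n _ ih => exact (ih (by omega)).trans (𝒯.t_lt n (by omega)).le

theorem t_nonneg {m : ℕ} (hm : m ≤ 𝒯.M) : 0 ≤ 𝒯.t m := 𝒯.t_zero ▸ 𝒯.t_mono (Nat.zero_le m) hm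

theorem t_le {m : ℕ} (hm : m ≤ 𝒯.M) : 𝒯.t m ≤ T := by
  simpa only [𝒯.t_last] using 𝒯.t_mono hm le_rfl

theorem Icc_subset {m : ℕ} (hm : m < 𝒯.M) : Icc (𝒯.t m) (𝒯.t (m + 1)) ⊆ Icc 0 T :=
  Icc_subset_Icc (𝒯.t_nonneg hm.le) (𝒯.t_le hm)

theorem eq_of_mem_Ioc {m n : ℕ} (hm : m < 𝒯.M) (hn : n < 𝒯.M) {s : ℝ}
    (hms : s ∈ Ioc (𝒯.t m) (𝒯.t (m + 1))) (hns : s ∈ Ioc (𝒯.t n) (𝒯.t (n + 1))) : m = n := by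
  by_contra hne
  rcases Nat.lt_or_gt_of_ne hne with h | h
  · exact (hms.2.trans (𝒯.t_mono h hn.le)).not_gt hns.1
  · exact (hns.2.trans (𝒯.t_mono h hm.le)).not_gt hms.1

theorem glue_of_mem {X Y : Type*} [AddCommMonoid Y] (u : ℕ → ℝ × X → Y) {m : ℕ} (hm : m < 𝒯.M)
    {q : ℝ × X} (hq : q.1 ∈ Ioc (𝒯.t m) (𝒯.t (m + 1))) : 𝒯.glue u q = u m q := by
  rw [glue, Finset.sum_eq_single_of_mem m (Finset.mem_range.2 hm), indicator_of_mem hq]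
  intro n hn hne
  rw [indicator_of_notMem]
  exact fun h => hne (𝒯.eq_of_mem_Ioc (Finset.mem_range.1 hn) hm h hq)

end PhaseMesh

/-! ### The dual solution -/

/-- Maps that follow the flows of all later slabs up to the final time. -/
structure IsTerminalMap (M : ℕ) (t : ℕ → ℝ) (φ : ℕ → ℝ → ℝ → Phase → Phase)
    (Z : ℕ → Phase ≃ₜ Phase) : Prop where
  last : ∀ z, Z M z = z
  step : ∀ m z, Z m z = Z (m + 1) (φ m (t m) (t (m + 1)) z)

theorem exists_isTerminalMap {W : ℕ → ℝ × ℝ → ℝ × ℝ × ℝ} {b ℓ : ℝ≥0}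
    {φ : ℕ → ℝ → ℝ → Phase → Phase} (hφ : ∀ m, IsDriftFlow (W m) b ℓ (φ m)) (M : ℕ) (t : ℕ → ℝ) :
    ∃ Z, IsTerminalMap M t φ Z := by
  let X : ℕ → Phase ≃ₜ Phase := fun n => Nat.rec (Homeomorph.refl Phase)
    (fun m Y => Y.trans ((hφ m).homeomorph (t m) (t (m + 1)))) n
  refine ⟨fun m => (X m).symm.trans (X M), fun z => (X M).apply_symm_apply z, fun m z => ?_⟩
  change X M ((X m).symm z) = X M ((X m).symm (((hφ m).homeomorph (t m) (t (m + 1))).symm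
    ((hφ m).homeomorph (t m) (t (m + 1)) z)))
  rw [Homeomorph.symm_apply_apply]

namespace IsTerminalMap

variable {W : ℕ → ℝ × ℝ → ℝ × ℝ × ℝ} {b ℓ : ℝ≥0} {φ : ℕ → ℝ → ℝ → Phase → Phase} {M : ℕ}
  {t : ℕ → ℝ} {Z : ℕ → Phase ≃ₜ Phase}

theorem lipschitzWith (hZ : IsTerminalMap M t φ Z) (hφ : ∀ m, IsDriftFlow (W m) b ℓ (φ m))
    (ht : ∀ m < M, t m < t (m + 1)) {m : ℕ} (hm : m ≤ M) :
    LipschitzWith (Real.exp ((2 + 2 * ℓ + 2 * b : ℝ≥0) * (t M - t m))).toNNReal (Z m) := by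
  induction hm using Nat.decreasingInduction with
  | self =>
    have : (Z M : Phase → Phase) = id := funext hZ.last
    rw [this, sub_self, mul_zero, Real.exp_zero, Real.toNNReal_one]
    exact LipschitzWith.id
  | of_succ m hm ih =>
    have h1 := ih.comp ((hφ m).lipschitz (t m) (t (m + 1)))
    have h2 : (Z (m + 1) : Phase → Phase) ∘ φ m (t m) (t (m + 1)) = Z m :=
      funext fun z => (hZ.step m z).symm
    rwa [h2, ← Real.toNNReal_mul (Real.exp_pos _).le, ← Real.exp_add,
      abs_of_nonneg (sub_nonneg.2 (ht m hm).le), ← mul_add, sub_add_sub_cancel] at h1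

theorem measurePreserving (hZ : IsTerminalMap M t φ Z) (hW : ∀ m, IsLipschitzField (W m) b ℓ)
    (hφ : ∀ m, IsDriftFlow (W m) b ℓ (φ m)) {m : ℕ} (hm : m ≤ M) :
    MeasurePreserving (Z m) volume volume := by
  induction hm using Nat.decreasingInduction with
  | self =>
    have : (Z M : Phase → Phase) = id := funext hZ.last
    rw [this]
    exact MeasurePreserving.id _
  | of_succ m hm ih =>
    have h2 : (Z (m + 1) : Phase → Phase) ∘ φ m (t m) (t (m + 1)) = Z m :=
      funext fun z => (hZ.step m z).symm
    exact h2 ▸ ih.comp ((hW m).measurePreserving_flow (hφ m) _ _)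

theorem lintegral_sq_translate_sub_le (hZ : IsTerminalMap M t φ Z)
    (hW : ∀ m, IsLipschitzField (W m) b ℓ) (hφ : ∀ m, IsDriftFlow (W m) b ℓ (φ m)) {m : ℕ}
    (hm : m ≤ M) {Λ : ℝ≥0} (hΛ : LipschitzWith Λ (Z m)) {χ : Phase → ℝ} (hχ : ContDiff ℝ 1 χ)
    (w : Phase) :
    ∫⁻ z, ENNReal.ofReal ((χ (Z m (z + w)) - χ (Z m z)) ^ 2)
      ≤ ENNReal.ofReal (‖w‖ ^ 2) * (ENNReal.ofReal (Λ ^ 2) *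
        ∫⁻ z, ENNReal.ofReal (‖fderiv ℝ χ z‖ ^ 2)) := by
  have h := lintegral_sq_comp_sub_le (μ := volume) hχ (ℓ := Λ * ‖w‖₊)
    (P := fun s z => Z m (z + s • w))
    ((Z m).continuous.comp (by fun_prop)) (fun z => ?_)
    (fun s => (hZ.measurePreserving hW hφ hm).comp (measurePreserving_add_right volume (s • w)))
  · simp only [one_smul, zero_smul, add_zero] at h
    refine h.trans_eq ?_
    push_cast
    rw [mul_pow, ENNReal.ofReal_mul (sq_nonneg _)]
    ring
  · refine hΛ.comp (LipschitzWith.of_dist_le_mul fun s s' => ?_)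
    rw [dist_add_left, dist_eq_norm, ← sub_smul, norm_smul, mul_comm, coe_nnnorm, dist_eq_norm]

theorem lintegral_sq_flow_sub_le (hZ : IsTerminalMap M t φ Z)
    (hW : ∀ m, IsLipschitzField (W m) b ℓ) (hφ : ∀ m, IsDriftFlow (W m) b ℓ (φ m)) {m : ℕ}
    (hm : m ≤ M) {Λ : ℝ≥0} (hΛ : LipschitzWith Λ (Z m)) {χ : Phase → ℝ} (hχ : ContDiff ℝ 1 χ)
    (s : ℝ) :
    ∫⁻ z, ENNReal.ofReal ((χ (Z (m + 1) (φ m s (t (m + 1)) z)) - χ (Z m z)) ^ 2)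
      ≤ ENNReal.ofReal ((Λ * (1 + 2 * b) * |s - t m|) ^ 2) *
        ∫⁻ z, ENNReal.ofReal (‖fderiv ℝ χ z‖ ^ 2) := by
  have h := lintegral_sq_comp_sub_le (μ := volume) hχ (ℓ := Λ * ((1 + 2 * b) * ‖s - t m‖₊))
    (P := fun r z => Z m (φ m s (s + r * (t m - s)) z))
    ((Z m).continuous.comp (((hφ m).continuous_snd s).comp
      (g := fun p : ℝ × Phase => φ m s p.1 p.2) (f := fun p : ℝ × Phase => (s + p.1 * (t m - s), p.2))
      (by fun_prop))) (fun z => ?_)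
    (fun r => (hZ.measurePreserving hW hφ hm).comp ((hW m).measurePreserving_flow (hφ m) _ _))
  · have h1 : ∀ z, Z m (φ m s (t m) z) = Z (m + 1) (φ m s (t (m + 1)) z) := fun z => by
      rw [hZ.step, (hφ m).comp]
    simp only [one_mul, zero_mul, add_zero, (hφ m).self, add_sub_cancel, h1] at h
    refine h.trans_eq ?_
    push_cast
    rw [← mul_assoc, Real.norm_eq_abs]
  · refine hΛ.comp (LipschitzWith.of_dist_le_mul fun r r' => ?_)
    rw [dist_eq_norm]
    refine ((hφ m).dist_le _ _ _ _).trans_eq ?_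
    have : s + r * (t m - s) - (s + r' * (t m - s)) = (r - r') * (t m - s) := by ring
    rw [this, abs_mul, Real.dist_eq, abs_sub_comm (t m) s]
    push_cast
    rw [Real.norm_eq_abs]
    ring

end IsTerminalMap

/-! ### Characteristics -/

namespace PhaseMesh

variable {T α β : ℝ} {Ωv : Set (ℝ × ℝ)} {𝒯 : PhaseMesh T α β Ωv} {W : ℕ → ℝ × ℝ → ℝ × ℝ × ℝ}
  {b ℓ : ℝ≥0} {φ : ℕ → ℝ → ℝ → Phase → Phase} {Z : ℕ → Phase ≃ₜ Phase}
  {G : ℕ → ℝ × Phase → Phase}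

theorem backwardDomain_subset (hT : 0 ≤ T) (Ω : Set Phase) (G : ℝ × Phase → Phase) :
    backwardDomain T Ω G ⊆ Ω := by
  rintro z ⟨γ, -, hγ⟩
  obtain ⟨h1, h2⟩ := hγ T ⟨hT, le_rfl⟩
  rw [intervalIntegral.integral_same, sub_zero] at h2
  exact h2 ▸ h1

theorem exists_characteristic (hT : 0 ≤ T) (hW : ∀ m, IsLipschitzField (W m) b ℓ)
    (hφ : ∀ m, IsDriftFlow (W m) b ℓ (φ m)) (hZ : IsTerminalMap 𝒯.M 𝒯.t φ Z)
    (hG : ∀ m < 𝒯.M, EqOn (G m) (drift (W m)) (𝒯.slab m)) {y : Phase}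
    (hy : y ∈ backwardDomain T (phaseDomain α β Ωv) (𝒯.glue G)) :
    ∃ γ : ℝ → Phase, (∀ m < 𝒯.M, ∀ s ∈ Icc (𝒯.t m) (𝒯.t (m + 1)), γ s ∈ phaseDomain α β Ωv ∧
      γ s = φ m (𝒯.t (m + 1)) s (γ (𝒯.t (m + 1)))) ∧ ∀ m ≤ 𝒯.M, Z m (γ (𝒯.t m)) = y := by
  obtain ⟨γ, hγc, hγ⟩ := hy
  have hcs : ∀ m, m < 𝒯.M → ContinuousOn γ (Icc (𝒯.t m) (𝒯.t (m + 1))) := fun m hm =>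
    hγc.mono (𝒯.Icc_subset hm)
  let c : ℕ → ℝ → Phase := fun m s => drift (W m) (s, γ s)
  have hcc : ∀ m, m < 𝒯.M → ContinuousOn (c m) (Icc (𝒯.t m) (𝒯.t (m + 1))) := fun m hm =>
    (hW m).continuous_drift.comp_continuousOn (continuousOn_id.prodMk (hcs m hm))
  have hglue : ∀ m, m < 𝒯.M → ∀ s ∈ Ioc (𝒯.t m) (𝒯.t (m + 1)), 𝒯.glue G (s, γ s) = c m s := by
    intro m hm s hs
    rw [𝒯.glue_of_mem G hm (q := (s, γ s)) hs]
    exact hG m hm ⟨hs, (hγ s (𝒯.Icc_subset hm (Ioc_subset_Icc_self hs))).1⟩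
  have hci : ∀ m < 𝒯.M, IntervalIntegrable (fun s => 𝒯.glue G (s, γ s)) volume (𝒯.t m)
      (𝒯.t (m + 1)) := by
    intro m hm
    have hle := (𝒯.t_lt m hm).le
    have h1 : IntervalIntegrable (c m) volume (𝒯.t m) (𝒯.t (m + 1)) :=
      ContinuousOn.intervalIntegrable (by rw [uIcc_of_le hle]; exact hcc m hm)
    refine h1.congr ?_
    rw [uIoc_of_le hle]
    exact fun s hs => (hglue m hm s hs).symm
  have hcT : IntervalIntegrable (fun s => 𝒯.glue G (s, γ s)) volume 0 T := by
    have := IntervalIntegrable.trans_iterate hci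
    rwa [𝒯.t_zero, 𝒯.t_last] at this
  have hflow : ∀ m < 𝒯.M, ∀ s ∈ Icc (𝒯.t m) (𝒯.t (m + 1)),
      γ s = φ m (𝒯.t (m + 1)) s (γ (𝒯.t (m + 1))) := by
    intro m hm
    have hle := (𝒯.t_lt m hm).le
    refine (hφ m).eqOn_of_hasDerivWithinAt (hW m).lipschitzWith_drift (hcs m hm) fun s hs => ?_
    let γ' : ℝ → Phase := fun r => γ (projIcc _ _ hle r)
    have hγ' : Continuous γ' := (hcs m hm).comp_continuous
      (continuous_subtype_val.comp continuous_projIcc) fun r => (projIcc _ _ hle r).2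
    have hc' : Continuous fun r => drift (W m) (r, γ' r) :=
      (hW m).continuous_drift.comp (continuous_id.prodMk hγ')
    have hγeq : ∀ r ∈ Icc (𝒯.t m) (𝒯.t (m + 1)), γ' r = γ r := fun r hr => by
      simp only [γ', projIcc_of_mem hle hr]
    have hrep : ∀ r ∈ Ioc (𝒯.t m) s, γ r = γ s - ∫ u in r..s, drift (W m) (u, γ' u) := by
      intro r hr
      have hrI : r ∈ Icc (𝒯.t m) (𝒯.t (m + 1)) := ⟨hr.1.le, hr.2.trans hs.2⟩
      have hsI := Ioc_subset_Icc_self hs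
      have hr0 := 𝒯.Icc_subset hm hrI
      have hs0 := 𝒯.Icc_subset hm hsI
      have i1 : IntervalIntegrable (fun s => 𝒯.glue G (s, γ s)) volume r s :=
        hcT.mono_set (by
          rw [uIcc_of_le hr.2, uIcc_of_le hT]
          exact Icc_subset_Icc hr0.1 hs0.2)
      have i2 : IntervalIntegrable (fun s => 𝒯.glue G (s, γ s)) volume s T :=
        hcT.mono_set (by
          rw [uIcc_of_le hs0.2, uIcc_of_le hT]
          exact Icc_subset_Icc hs0.1 le_rfl)
      have e1 := (hγ r hr0).2
      rw [← intervalIntegral.integral_add_adjacent_intervals i1 i2] at e1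
      have e2 := (hγ s hs0).2
      have e3 : ∫ u in r..s, 𝒯.glue G (u, γ u) = ∫ u in r..s, drift (W m) (u, γ' u) := by
        refine intervalIntegral.integral_congr_ae (Filter.Eventually.of_forall fun u hu => ?_)
        rw [uIoc_of_le hr.2] at hu
        have huI : u ∈ Ioc (𝒯.t m) (𝒯.t (m + 1)) := ⟨hr.1.trans hu.1, hu.2.trans hs.2⟩
        rw [hglue m hm u huI, hγeq u (Ioc_subset_Icc_self huI)]
      rw [← e3, e1, e2]
      abel
    have hd : HasDerivAt (fun r => γ s - ∫ u in r..s, drift (W m) (u, γ' u))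
        (drift (W m) (s, γ' s)) s := by
      have := (intervalIntegral.integral_hasDerivAt_left (hc'.intervalIntegrable s s)
        (hc'.stronglyMeasurableAtFilter _ _) hc'.continuousAt).const_sub (γ s)
      rwa [neg_neg] at this
    rw [hγeq s (Ioc_subset_Icc_self hs)] at hd
    refine hd.hasDerivWithinAt.congr_of_eventuallyEq ?_ (by simp)
    filter_upwards [Ioc_mem_nhdsLE hs.1] with r hr using hrep r hr
  refine ⟨γ, fun m hm s hs => ⟨(hγ s (𝒯.Icc_subset hm hs)).1, hflow m hm s hs⟩, fun m hm => ?_⟩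
  induction hm using Nat.decreasingInduction with
  | self =>
    have := (hγ T ⟨hT, le_rfl⟩).2
    rw [intervalIntegral.integral_same, sub_zero] at this
    rw [hZ.last, 𝒯.t_last, this]
  | of_succ m hm ih =>
    rw [hZ.step, hflow m hm (𝒯.t m) ⟨le_rfl, (𝒯.t_lt m hm).le⟩, (hφ m).comp_cancel, ih]

theorem flow_mem_of_ne_zero (hT : 0 ≤ T) (hW : ∀ m, IsLipschitzField (W m) b ℓ)
    (hφ : ∀ m, IsDriftFlow (W m) b ℓ (φ m)) (hZ : IsTerminalMap 𝒯.M 𝒯.t φ Z)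
    (hG : ∀ m < 𝒯.M, EqOn (G m) (drift (W m)) (𝒯.slab m)) {χ : Phase → ℝ}
    (hχ : tsupport χ ⊆ backwardDomain T (phaseDomain α β Ωv) (𝒯.glue G)) {m : ℕ} (hm : m < 𝒯.M)
    {z : Phase} (hz : χ (Z (m + 1) (φ m (𝒯.t m) (𝒯.t (m + 1)) z)) ≠ 0) {s : ℝ}
    (hs : s ∈ Icc (𝒯.t m) (𝒯.t (m + 1))) : φ m (𝒯.t m) s z ∈ phaseDomain α β Ωv := by
  obtain ⟨γ, h1, h2⟩ := exists_characteristic hT hW hφ hZ hG (hχ (subset_tsupport χ hz))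
  have h3 := (Z (m + 1)).injective (h2 (m + 1) hm)
  obtain ⟨h4, h5⟩ := h1 m hm s hs
  rw [h3, (hφ m).comp] at h5
  exact h5 ▸ h4

theorem comp_terminalMap_eq_zero (hT : 0 ≤ T) (hW : ∀ m, IsLipschitzField (W m) b ℓ)
    (hφ : ∀ m, IsDriftFlow (W m) b ℓ (φ m)) (hZ : IsTerminalMap 𝒯.M 𝒯.t φ Z)
    (hG : ∀ m < 𝒯.M, EqOn (G m) (drift (W m)) (𝒯.slab m)) {χ : Phase → ℝ}
    (hχ : tsupport χ ⊆ backwardDomain T (phaseDomain α β Ωv) (𝒯.glue G)) {m : ℕ} (hm : m ≤ 𝒯.M)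
    {z : Phase} (hz : z ∉ phaseDomain α β Ωv) : χ (Z m z) = 0 := by
  by_contra hne
  rcases hm.lt_or_eq with hm | rfl
  · have := flow_mem_of_ne_zero hT hW hφ hZ hG hχ hm (z := z) (by rwa [← hZ.step])
      (left_mem_Icc.2 (𝒯.t_lt m hm).le)
    rw [(hφ m).self] at this
    exact hz this
  · rw [hZ.last] at hne
    exact hz (backwardDomain_subset hT _ _ (hχ (subset_tsupport χ hne)))

end PhaseMesh

/-! ### Auxiliary estimates -/

theorem integral_le_of_lintegral_ofReal_le {X : Type*} [MeasurableSpace X] {μ : Measure X}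
    {f : X → ℝ} (hf : ∀ x, 0 ≤ f x) {c : ℝ} (hc : 0 ≤ c)
    (h : ∫⁻ x, ENNReal.ofReal (f x) ∂μ ≤ ENNReal.ofReal c) : ∫ x, f x ∂μ ≤ c := by
  by_cases hi : Integrable f μ
  · rw [integral_eq_lintegral_of_nonneg_ae (Filter.Eventually.of_forall hf) hi.1]
    exact ENNReal.toReal_le_of_le_ofReal hc h
  · rwa [integral_undef hi]

theorem abs_integral_mul_le {X : Type*} [MeasurableSpace X] {μ : Measure X} {f g : X → ℝ}
    (hf : MemLp f 2 μ) (hg : MemLp g 2 μ) {lam : ℝ} (hlam : 0 < lam) :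
    |∫ x, f x * g x ∂μ| ≤ lam / 2 * (∫ x, f x ^ 2 ∂μ) + 1 / (2 * lam) * ∫ x, g x ^ 2 ∂μ := by
  have hf2 := hf.integrable_sq
  have hg2 := hg.integrable_sq
  rw [← integral_const_mul, ← integral_const_mul, ← integral_add (hf2.const_mul _) (hg2.const_mul _),
    ← Real.norm_eq_abs]
  refine norm_integral_le_of_norm_le ((hf2.const_mul _).add (hg2.const_mul _))
    (Filter.Eventually.of_forall fun x => ?_)
  rw [Real.norm_eq_abs, abs_mul, ← sq_abs (f x), ← sq_abs (g x)]
  have h1 : 0 ≤ (lam * |f x| - |g x|) ^ 2 := sq_nonneg _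
  have h2 : lam / 2 * |f x| ^ 2 + 1 / (2 * lam) * |g x| ^ 2 - |f x| * |g x|
      = (lam * |f x| - |g x|) ^ 2 / (2 * lam) := by
    field_simp
    ring
  have h3 : 0 ≤ (lam * |f x| - |g x|) ^ 2 / (2 * lam) := by positivity
  linarith

theorem le_sqrt_mul_sqrt_of_forall {a p q : ℝ} (ha : 0 ≤ a) (hp : 0 ≤ p) (hq : 0 ≤ q)
    (h : ∀ lam : ℝ, 0 < lam → a ≤ lam / 2 * p + 1 / (2 * lam) * q) :
    a ≤ Real.sqrt p * Real.sqrt q := by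
  have h1 : ∀ x : ℝ, 0 ≤ p * (x * x) + (-2 * a) * x + q := by
    intro x
    rcases le_or_gt x 0 with hx | hx
    · nlinarith [mul_nonneg hp (mul_self_nonneg x), mul_nonneg ha (neg_nonneg.2 hx)]
    · have h2 := mul_le_mul_of_nonneg_left (h x hx) (show (0 : ℝ) ≤ 2 * x by positivity)
      have h3 : 2 * x * (x / 2 * p + 1 / (2 * x) * q) = x * x * p + q := by
        field_simp
      rw [h3] at h2
      linarith
  have h2 := discrim_le_zero h1
  rw [← Real.sqrt_mul hp]
  refine Real.le_sqrt_of_sq_le ?_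
  rw [discrim] at h2
  linarith

theorem memLp_top_of_continuousOn {X : Type*} [MetricSpace X] [MeasurableSpace X]
    [OpensMeasurableSpace X] [SecondCountableTopology X] {μ : Measure X} {u : X → ℝ} {K S : Set X}
    (hK : IsCompact K) (hu : ContinuousOn u K) (hS : MeasurableSet S) (hSK : S ⊆ K) :
    MemLp u ⊤ (μ.restrict S) := by
  obtain ⟨C, hC⟩ := hK.exists_bound_of_continuousOn hu
  refine memLp_top_of_bound ((hu.mono hSK).aestronglyMeasurable hS) C ?_
  filter_upwards [ae_restrict_mem hS] with x hx using hC x (hSK hx)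

/-! ### Partial derivatives -/

section

variable {χ : Phase → ℝ} {z : Phase}

theorem dX_eq_fderiv (h : DifferentiableAt ℝ χ z) : dX χ z = fderiv ℝ χ z (1, 0, 0) :=
  (h.hasFDerivAt.comp_hasDerivAt z.1 (f := fun y => (y, z.2)) ((hasDerivAt_id z.1).prodMk
    (hasDerivAt_const z.1 z.2))).deriv

theorem dV₁_eq_fderiv (h : DifferentiableAt ℝ χ z) : dV₁ χ z = fderiv ℝ χ z (0, 1, 0) :=
  (h.hasFDerivAt.comp_hasDerivAt z.2.1 (f := fun y => (z.1, y, z.2.2))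
    ((hasDerivAt_const z.2.1 z.1).prodMk ((hasDerivAt_id z.2.1).prodMk
      (hasDerivAt_const z.2.1 z.2.2)))).deriv

theorem dV₂_eq_fderiv (h : DifferentiableAt ℝ χ z) : dV₂ χ z = fderiv ℝ χ z (0, 0, 1) :=
  (h.hasFDerivAt.comp_hasDerivAt z.2.2 (f := fun y => (z.1, z.2.1, y))
    ((hasDerivAt_const z.2.2 z.1).prodMk ((hasDerivAt_const z.2.2 z.2.1).prodMk
      (hasDerivAt_id z.2.2)))).deriv

theorem norm_fderiv_le (h : DifferentiableAt ℝ χ z) :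
    ‖fderiv ℝ χ z‖ ≤ |dX χ z| + |dV₁ χ z| + |dV₂ χ z| := by
  refine ContinuousLinearMap.opNorm_le_bound _ (by positivity) fun w => ?_
  have e : w = w.1 • ((1 : ℝ), (0 : ℝ), (0 : ℝ)) + w.2.1 • ((0 : ℝ), (1 : ℝ), (0 : ℝ))
      + w.2.2 • ((0 : ℝ), (0 : ℝ), (1 : ℝ)) := by
    simp
  have h1 : |w.1| ≤ ‖w‖ := norm_fst_le w
  have h2 : |w.2.1| ≤ ‖w‖ := (norm_fst_le w.2).trans (norm_snd_le w)
  have h3 : |w.2.2| ≤ ‖w‖ := (norm_snd_le w.2).trans (norm_snd_le w)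
  have e2 : fderiv ℝ χ z w = w.1 * dX χ z + w.2.1 * dV₁ χ z + w.2.2 * dV₂ χ z := by
    conv_lhs => rw [e]
    simp only [map_add, map_smul, smul_eq_mul, dX_eq_fderiv h, dV₁_eq_fderiv h, dV₂_eq_fderiv h]
  rw [e2, Real.norm_eq_abs]
  calc |w.1 * dX χ z + w.2.1 * dV₁ χ z + w.2.2 * dV₂ χ z|
      ≤ |w.1 * dX χ z| + |w.2.1 * dV₁ χ z| + |w.2.2 * dV₂ χ z| := abs_add_three _ _ _
    _ = |w.1| * |dX χ z| + |w.2.1| * |dV₁ χ z| + |w.2.2| * |dV₂ χ z| := by simp only [abs_mul]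
    _ ≤ ‖w‖ * |dX χ z| + ‖w‖ * |dV₁ χ z| + ‖w‖ * |dV₂ χ z| := by gcongr
    _ = _ := by ring

theorem continuous_partials (h : ContDiff ℝ 1 χ) :
    Continuous (dX χ) ∧ Continuous (dV₁ χ) ∧ Continuous (dV₂ χ) := by
  have hc := h.continuous_fderiv one_ne_zero
  have hd := h.differentiable one_ne_zero
  refine ⟨?_, ?_, ?_⟩
  · rw [show dX χ = fun z => fderiv ℝ χ z (1, 0, 0) from funext fun z => dX_eq_fderiv (hd z)]
    fun_prop
  · rw [show dV₁ χ = fun z => fderiv ℝ χ z (0, 1, 0) from funext fun z => dV₁_eq_fderiv (hd z)]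
    fun_prop
  · rw [show dV₂ χ = fun z => fderiv ℝ χ z (0, 0, 1) from funext fun z => dV₂_eq_fderiv (hd z)]
    fun_prop

theorem partials_eq_zero (h : ContDiff ℝ 1 χ) (hz : z ∉ tsupport χ) :
    χ z = 0 ∧ dX χ z = 0 ∧ dV₁ χ z = 0 ∧ dV₂ χ z = 0 := by
  have hd := h.differentiable one_ne_zero z
  have h0 : fderiv ℝ χ z = 0 := image_eq_zero_of_notMem_tsupport
    fun hmem => hz (tsupport_fderiv_subset ℝ hmem)
  rw [dX_eq_fderiv hd, dV₁_eq_fderiv hd, dV₂_eq_fderiv hd, h0]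
  exact ⟨image_eq_zero_of_notMem_tsupport hz, by simp⟩

theorem integrable_h1_density (h : ContDiff ℝ 1 χ) (hc : HasCompactSupport χ) :
    Integrable fun z => χ z ^ 2 + dX χ z ^ 2 + dV₁ χ z ^ 2 + dV₂ χ z ^ 2 := by
  obtain ⟨c1, c2, c3⟩ := continuous_partials h
  have c0 := h.continuous
  refine Continuous.integrable_of_hasCompactSupport (by fun_prop)
    (HasCompactSupport.intro hc fun z hz => ?_)
  obtain ⟨e0, e1, e2, e3⟩ := partials_eq_zero h hz
  rw [e0, e1, e2, e3]
  norm_num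

theorem integrable_sq_norm_fderiv (h : ContDiff ℝ 1 χ) (hc : HasCompactSupport χ) :
    Integrable fun z => ‖fderiv ℝ χ z‖ ^ 2 := by
  have hcf := h.continuous_fderiv one_ne_zero
  exact Continuous.integrable_of_hasCompactSupport (by fun_prop)
    (HasCompactSupport.intro hc fun z hz => by
      rw [image_eq_zero_of_notMem_tsupport fun hmem => hz (tsupport_fderiv_subset ℝ hmem)]
      simp)

theorem sq_h1Norm (χ : Phase → ℝ) :
    h1Norm χ ^ 2 = ∫ z, (χ z ^ 2 + dX χ z ^ 2 + dV₁ χ z ^ 2 + dV₂ χ z ^ 2) :=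
  Real.sq_sqrt (integral_nonneg fun z => by positivity)

theorem integral_sq_norm_fderiv_le (h : ContDiff ℝ 1 χ) (hc : HasCompactSupport χ) :
    ∫ z, ‖fderiv ℝ χ z‖ ^ 2 ≤ 3 * h1Norm χ ^ 2 := by
  rw [sq_h1Norm, ← integral_const_mul]
  refine integral_mono (integrable_sq_norm_fderiv h hc) ((integrable_h1_density h hc).const_mul 3)
    fun z => ?_
  have h1 := norm_fderiv_le (h.differentiable one_ne_zero z)
  have h2 := pow_le_pow_left₀ (norm_nonneg _) h1 2
  simp only
  rw [← sq_abs (dX χ z), ← sq_abs (dV₁ χ z), ← sq_abs (dV₂ χ z)]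
  nlinarith [sq_nonneg (|dX χ z| - |dV₁ χ z|), sq_nonneg (|dX χ z| - |dV₂ χ z|),
    sq_nonneg (|dV₁ χ z| - |dV₂ χ z|), sq_nonneg (χ z)]

end

/-! ### The estimate on one slab -/

theorem transport_congr_drift {G G' : ℝ × Phase → Phase} {q : ℝ × Phase} (h : G q = G' q)
    (F : ℝ × Phase → ℝ) : transport G F q = transport G' F q := by
  simp only [transport, h]

theorem abs_transport_steady_le {G : ℝ × Phase → Phase} {q : ℝ × Phase} {B : ℝ} (hB : ‖G q‖ ≤ B)
    (g : Phase → ℝ) :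
    |transport G (fun q => g q.2) q| ≤ B * (|dX g q.2| + |dV₁ g q.2| + |dV₂ g q.2|) := by
  obtain ⟨h1, h23⟩ := norm_prod_le_iff.1 hB
  obtain ⟨h2, h3⟩ := norm_prod_le_iff.1 h23
  rw [Real.norm_eq_abs] at h1 h2 h3
  simp only [transport, deriv_const, zero_add]
  calc _ ≤ |(G q).1 * dX g q.2| + |(G q).2.1 * dV₁ g q.2| + |(G q).2.2 * dV₂ g q.2| :=
        abs_add_three _ _ _
    _ = |(G q).1| * |dX g q.2| + |(G q).2.1| * |dV₁ g q.2| + |(G q).2.2| * |dV₂ g q.2| := by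
        simp only [abs_mul]
    _ ≤ B * |dX g q.2| + B * |dV₁ g q.2| + B * |dV₂ g q.2| := by gcongr
    _ = _ := by ring

namespace PhaseMesh

variable {T α β : ℝ} {Ωv : Set (ℝ × ℝ)} {𝒯 : PhaseMesh T α β Ωv} {W : ℕ → ℝ × ℝ → ℝ × ℝ × ℝ}
  {b ℓ : ℝ≥0} {φ : ℕ → ℝ → ℝ → Phase → Phase} {Z : ℕ → Phase ≃ₜ Phase} {χ : Phase → ℝ} {k m : ℕ}
  {d c C : ℝ} {Λ : ℝ≥0} {g : Phase → ℝ}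

theorem volume_restrict_slab (𝒯 : PhaseMesh T α β Ωv) (m : ℕ) :
    volume.restrict (𝒯.slab m) = ((volume : Measure ℝ).restrict (Ioc (𝒯.t m) (𝒯.t (m + 1)))).prod
      ((volume : Measure Phase).restrict (phaseDomain α β Ωv)) := by
  rw [Measure.prod_restrict, slab, Measure.volume_eq_prod]

theorem integral_slab_sq_le (hW : ∀ m, IsLipschitzField (W m) b ℓ)
    (hφ : ∀ m, IsDriftFlow (W m) b ℓ (φ m)) (hZ : IsTerminalMap 𝒯.M 𝒯.t φ Z) (hm : m < 𝒯.M)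
    (hΛ : LipschitzWith Λ (Z m)) (hχ : ContDiff ℝ 1 χ) (hd0 : 0 ≤ d)
    (hd : ∫⁻ z, ENNReal.ofReal (‖fderiv ℝ χ z‖ ^ 2) = ENNReal.ofReal d)
    (hτ : 𝒯.t (m + 1) - 𝒯.t m ≤ 𝒯.h) (hc : 0 ≤ c) (hC : 0 ≤ C)
    (hg : ∫⁻ z in phaseDomain α β Ωv, ENNReal.ofReal
      ((|g z - χ (Z m z)| + 𝒯.h * (|dX g z| + |dV₁ g z| + |dV₂ g z|)) ^ 2)
        ≤ ENNReal.ofReal (C * 𝒯.h ^ 2 * (Λ ^ 2 * d))) :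
    ∫ q in 𝒯.slab m, (χ (Z (m + 1) (φ m q.1 (𝒯.t (m + 1)) q.2)) - g q.2
        - c * 𝒯.h * transport (drift (W m)) (fun q => g q.2) q) ^ 2
      ≤ (𝒯.t (m + 1) - 𝒯.t m) * (𝒯.h ^ 2 * (Λ ^ 2 * d *
          (2 * (1 + 2 * b) ^ 2 + 2 * (1 + c * (1 + 2 * b)) ^ 2 * C))) := by
  set τ := 𝒯.t (m + 1) - 𝒯.t m with hτdef
  have hh := 𝒯.h_pos
  have hb : (0 : ℝ) ≤ b := b.2
  have hτ0 : 0 ≤ τ := sub_nonneg.2 (𝒯.t_lt m hm).le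
  set Ψ : ℝ × Phase → ℝ := fun q => χ (Z (m + 1) (φ m q.1 (𝒯.t (m + 1)) q.2)) with hΨ
  set u : Phase → ℝ := fun z => χ (Z m z) with hu
  set Y : Phase → ℝ := fun z => |g z - u z| + 𝒯.h * (|dX g z| + |dV₁ g z| + |dV₂ g z|) with hY
  have hΨc : Continuous Ψ :=
    hχ.continuous.comp ((Z (m + 1)).continuous.comp ((hφ m).continuous_fst (𝒯.t (m + 1))))
  have huc : Continuous u := hχ.continuous.comp (Z m).continuous
  refine integral_le_of_lintegral_ofReal_le (fun q => sq_nonneg _) (by positivity) ?_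
  have hpt : ∀ q : ℝ × Phase, ENNReal.ofReal ((Ψ q - g q.2
        - c * 𝒯.h * transport (drift (W m)) (fun q => g q.2) q) ^ 2)
      ≤ ENNReal.ofReal 2 * ENNReal.ofReal ((Ψ q - u q.2) ^ 2)
        + ENNReal.ofReal (2 * (1 + c * (1 + 2 * b)) ^ 2) * ENNReal.ofReal (Y q.2 ^ 2) := by
    intro q
    rw [← ENNReal.ofReal_mul (by positivity), ← ENNReal.ofReal_mul (by positivity),
      ← ENNReal.ofReal_add (by positivity) (by positivity)]
    refine ENNReal.ofReal_le_ofReal ?_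
    have hB := (hW m).norm_drift_le q
    push_cast at hB
    have h1 := abs_transport_steady_le hB g
    set S := |dX g q.2| + |dV₁ g q.2| + |dV₂ g q.2| with hS
    have hS0 : 0 ≤ S := by positivity
    set A := |Ψ q - u q.2|
    have hY0 : 0 ≤ Y q.2 := by positivity
    have h2 : |Ψ q - g q.2 - c * 𝒯.h * transport (drift (W m)) (fun q => g q.2) q|
        ≤ A + (1 + c * (1 + 2 * b)) * Y q.2 := by
      have e : Ψ q - g q.2 - c * 𝒯.h * transport (drift (W m)) (fun q => g q.2) q
          = (Ψ q - u q.2) - (g q.2 - u q.2)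
            - c * 𝒯.h * transport (drift (W m)) (fun q => g q.2) q := by ring
      rw [e]
      have h3 : |c * 𝒯.h * transport (drift (W m)) (fun q => g q.2) q|
          ≤ c * 𝒯.h * ((1 + 2 * b) * S) := by
        rw [abs_mul, abs_of_nonneg (show 0 ≤ c * 𝒯.h by positivity)]
        gcongr
      have h4 : 0 ≤ c * (1 + 2 * b) * |g q.2 - u q.2| := by positivity
      have h5 : 0 ≤ 𝒯.h * S := by positivity
      have h6 : (1 + c * (1 + 2 * b)) * Y q.2 = |g q.2 - u q.2| + 𝒯.h * S
          + c * (1 + 2 * b) * |g q.2 - u q.2| + c * 𝒯.h * ((1 + 2 * b) * S) := by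
        simp only [hY, hS]
        ring
      rw [h6]
      refine (abs_sub _ _).trans ?_
      refine (add_le_add (abs_sub _ _) h3).trans ?_
      linarith
    calc _ = |Ψ q - g q.2 - c * 𝒯.h * transport (drift (W m)) (fun q => g q.2) q| ^ 2 :=
          (sq_abs _).symm
      _ ≤ (A + (1 + c * (1 + 2 * b)) * Y q.2) ^ 2 := by gcongr
      _ ≤ 2 * A ^ 2 + 2 * ((1 + c * (1 + 2 * b)) * Y q.2) ^ 2 := by
          nlinarith [sq_nonneg (A - (1 + c * (1 + 2 * b)) * Y q.2)]
      _ = _ := by rw [sq_abs]; ring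
  have hmeas : Measurable fun q : ℝ × Phase =>
      ENNReal.ofReal 2 * ENNReal.ofReal ((Ψ q - u q.2) ^ 2) :=
    (ENNReal.measurable_ofReal.comp
      (show Continuous fun q : ℝ × Phase => (Ψ q - u q.2) ^ 2 by fun_prop).measurable).const_mul _
  have hpart1 : ∫⁻ q in 𝒯.slab m, ENNReal.ofReal 2 * ENNReal.ofReal ((Ψ q - u q.2) ^ 2)
      ≤ ENNReal.ofReal (2 * ((Λ * (1 + 2 * b) * 𝒯.h) ^ 2 * d) * τ) := by
    rw [volume_restrict_slab]
    refine (lintegral_prod_le _).trans ?_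
    calc _ ≤ ∫⁻ s in Ioc (𝒯.t m) (𝒯.t (m + 1)),
          ENNReal.ofReal (2 * ((Λ * (1 + 2 * b) * 𝒯.h) ^ 2 * d)) := by
          refine setLIntegral_mono measurable_const fun s hs => ?_
          rw [lintegral_const_mul' _ _ ENNReal.ofReal_ne_top,
            ENNReal.ofReal_mul (p := 2) zero_le_two]
          refine mul_le_mul_right ((setLIntegral_le_lintegral _ _).trans
            ((hZ.lintegral_sq_flow_sub_le hW hφ hm.le hΛ hχ s).trans ?_)) _
          rw [hd, ← ENNReal.ofReal_mul (by positivity)]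
          refine ENNReal.ofReal_le_ofReal ?_
          have h1 : |s - 𝒯.t m| ≤ 𝒯.h := by
            rw [abs_of_pos (sub_pos.2 hs.1)]
            linarith [hs.2]
          gcongr
      _ = _ := by
          rw [setLIntegral_const, Real.volume_Ioc, ← ENNReal.ofReal_mul (by positivity)]
  have hpart2 : ∫⁻ q in 𝒯.slab m,
        ENNReal.ofReal (2 * (1 + c * (1 + 2 * b)) ^ 2) * ENNReal.ofReal (Y q.2 ^ 2)
      ≤ ENNReal.ofReal (2 * (1 + c * (1 + 2 * b)) ^ 2 * (C * 𝒯.h ^ 2 * (Λ ^ 2 * d)) * τ) := by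
    rw [volume_restrict_slab]
    refine (lintegral_prod_le _).trans ?_
    calc _ ≤ ∫⁻ s in Ioc (𝒯.t m) (𝒯.t (m + 1)),
          ENNReal.ofReal (2 * (1 + c * (1 + 2 * b)) ^ 2 * (C * 𝒯.h ^ 2 * (Λ ^ 2 * d))) := by
          refine setLIntegral_mono measurable_const fun s hs => ?_
          rw [lintegral_const_mul' _ _ ENNReal.ofReal_ne_top,
            ENNReal.ofReal_mul (p := 2 * (1 + c * (1 + 2 * b)) ^ 2) (by positivity)]
          exact mul_le_mul_right hg _
      _ = _ := by
          rw [setLIntegral_const, Real.volume_Ioc, ← ENNReal.ofReal_mul (by positivity)]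
  refine (lintegral_mono hpt).trans ?_
  rw [lintegral_add_left hmeas]
  refine (add_le_add hpart1 hpart2).trans ?_
  rw [← ENNReal.ofReal_add (by positivity) (by positivity)]
  refine ENNReal.ofReal_le_ofReal (le_of_eq ?_)
  ring

end PhaseMesh

namespace PhaseMesh

variable {T α β : ℝ} {Ωv : Set (ℝ × ℝ)} {𝒯 : PhaseMesh T α β Ωv} {W : ℕ → ℝ × ℝ → ℝ × ℝ × ℝ}
  {b ℓ : ℝ≥0} {φ : ℕ → ℝ → ℝ → Phase → Phase} {Z : ℕ → Phase ≃ₜ Phase} {χ : Phase → ℝ} {k m : ℕ}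
  {d c C σ : ℝ} {Λ : ℝ≥0} {g B : Phase → ℝ} {G : ℕ → ℝ × Phase → Phase}
  {w : ℕ → ℝ × Phase → ℝ}

theorem slab_subset (𝒯 : PhaseMesh T α β Ωv) (m : ℕ) :
    𝒯.slab m ⊆ Icc (𝒯.t m) (𝒯.t (m + 1)) ×ˢ closure (phaseDomain α β Ωv) :=
  prod_mono Ioc_subset_Icc_self subset_closure

theorem measurableSet_slab (𝒯 : PhaseMesh T α β Ωv) (hreg : Ωv = interior (closure Ωv)) (m : ℕ) :
    MeasurableSet (𝒯.slab m) :=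
  measurableSet_Ioc.prod (isOpen_phaseDomain hreg).measurableSet

theorem isFiniteMeasure_slab (𝒯 : PhaseMesh T α β Ωv) (hb : Bornology.IsBounded Ωv) (m : ℕ) :
    IsFiniteMeasure (volume.restrict (𝒯.slab m)) :=
  isFiniteMeasure_restrict.2 (𝒯.volume_slab_lt_top hb m).ne

theorem isFiniteMeasure_phaseDomain (hb : Bornology.IsBounded Ωv) :
    IsFiniteMeasure ((volume : Measure Phase).restrict (phaseDomain α β Ωv)) :=
  isFiniteMeasure_restrict.2 ((Metric.isBounded_Ioo α β).prod hb).measure_lt_top.ne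

theorem memLp_slab (𝒯 : PhaseMesh T α β Ωv) (hb : Bornology.IsBounded Ωv)
    (hreg : Ωv = interior (closure Ωv)) (m : ℕ) {u : ℝ × Phase → ℝ}
    (hu : ContinuousOn u (Icc (𝒯.t m) (𝒯.t (m + 1)) ×ˢ closure (phaseDomain α β Ωv))) :
    MemLp u 2 (volume.restrict (𝒯.slab m)) := by
  have := 𝒯.isFiniteMeasure_slab hb m
  exact (memLp_top_of_continuousOn (isCompact_Icc.prod (isCompact_closure_phaseDomain hb)) hu
    (𝒯.measurableSet_slab hreg m) (𝒯.slab_subset m)).mono_exponent le_top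

theorem memLp_phaseDomain (hb : Bornology.IsBounded Ωv) (hreg : Ωv = interior (closure Ωv))
    {u : Phase → ℝ} (hu : ContinuousOn u (closure (phaseDomain α β Ωv))) :
    MemLp u 2 (volume.restrict (phaseDomain α β Ωv)) := by
  have := isFiniteMeasure_phaseDomain (α := α) (β := β) hb
  exact (memLp_top_of_continuousOn (isCompact_closure_phaseDomain hb) hu
    (isOpen_phaseDomain hreg).measurableSet subset_closure).mono_exponent le_top

theorem MemV.memLp_transport_two (hw : 𝒯.MemV k w) (hb : Bornology.IsBounded Ωv) (hαβ : α < β)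
    (hreg : Ωv = interior (closure Ωv)) (hm : m < 𝒯.M) {G : ℝ × Phase → Phase}
    (hG : Continuous G) : MemLp (transport G (w m)) 2 (volume.restrict (𝒯.slab m)) := by
  have := 𝒯.isFiniteMeasure_slab hb m
  exact (hw.memLp_transport hb hαβ hreg hm hG).mono_exponent le_top

theorem integrable_mul_of_memLp {X : Type*} [MeasurableSpace X] {μ : Measure X} {f g : X → ℝ}
    (hf : MemLp f 2 μ) (hg : MemLp g 2 μ) : Integrable (fun x => f x * g x) μ :=
  hf.integrable_mul hg

theorem continuousOn_slice {u : ℝ × Phase → ℝ} {t₀ t₁ : ℝ} {K : Set Phase}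
    (hu : ContinuousOn u (Icc t₀ t₁ ×ˢ K)) {s : ℝ} (hs : s ∈ Icc t₀ t₁) :
    ContinuousOn (fun z => u (s, z)) K :=
  hu.comp (by fun_prop) fun z hz => ⟨hs, hz⟩

/-- The change of the discrete solution over one slab, tested with the dual solution. -/
theorem abs_step_le (hT : 0 ≤ T) (hb : Bornology.IsBounded Ωv) (hαβ : α < β)
    (hreg : Ωv = interior (closure Ωv)) (hW : ∀ m, IsLipschitzField (W m) b ℓ)
    (hφ : ∀ m, IsDriftFlow (W m) b ℓ (φ m)) (hZ : IsTerminalMap 𝒯.M 𝒯.t φ Z)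
    (hG : ∀ m < 𝒯.M, EqOn (G m) (drift (W m)) (𝒯.slab m)) (hm : m < 𝒯.M)
    (hΛ : LipschitzWith Λ (Z m)) (hχ : ContDiff ℝ 1 χ)
    (hχs : tsupport χ ⊆ backwardDomain T (phaseDomain α β Ωv) (𝒯.glue G)) (hd0 : 0 ≤ d)
    (hd : ∫⁻ z, ENNReal.ofReal (‖fderiv ℝ χ z‖ ^ 2) = ENNReal.ofReal d)
    (hτ : 𝒯.t (m + 1) - 𝒯.t m ≤ 𝒯.h) (hσ : 0 < σ) (hστ : σ * 𝒯.h ≤ 𝒯.t (m + 1) - 𝒯.t m)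
    (hc : 0 ≤ c) (hC : 0 ≤ C) (hgV : 𝒯.MemV k fun _ q => g q.2)
    (hg : ∫⁻ z in phaseDomain α β Ωv, ENNReal.ofReal
      ((|g z - χ (Z m z)| + 𝒯.h * (|dX g z| + |dV₁ g z| + |dV₂ g z|)) ^ 2)
        ≤ ENNReal.ofReal (C * 𝒯.h ^ 2 * (Λ ^ 2 * d)))
    (hw : 𝒯.MemV k w) (hB : ContinuousOn B (closure (phaseDomain α β Ωv)))
    (hgal : (∫ q in 𝒯.slab m, transport (G m) (w m) q *
        (g q.2 + c * 𝒯.h * transport (G m) (fun q => g q.2) q))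
      + (∫ z in phaseDomain α β Ωv, w m (𝒯.t m, z) * g z) = ∫ z in phaseDomain α β Ωv, B z * g z)
    {lam : ℝ} (hlam : 0 < lam) :
    |(∫ z in phaseDomain α β Ωv, w m (𝒯.t (m + 1), z) * χ (Z (m + 1) z))
        - ∫ z in phaseDomain α β Ωv, B z * χ (Z m z)|
      ≤ lam / 2 * ((∫ q in 𝒯.slab m, (𝒯.h * transport (G m) (w m) q) ^ 2)
          + 1 / σ * ∫ q in 𝒯.slab m, (w m (𝒯.t m, q.2) - B q.2) ^ 2)
        + 1 / (2 * lam) * ((𝒯.t (m + 1) - 𝒯.t m) * (Λ ^ 2 * d * (2 * (1 + 2 * b) ^ 2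
          + 2 * (1 + c * (1 + 2 * b)) ^ 2 * C + C / σ))) := by
  set τ := 𝒯.t (m + 1) - 𝒯.t m with hτdef
  set Ω := phaseDomain α β Ωv with hΩ
  set S := 𝒯.slab m with hS
  have hh := 𝒯.h_pos
  have ht01 := 𝒯.t_lt m hm
  have hτ0 : 0 < τ := sub_pos.2 ht01
  have hΩm : MeasurableSet Ω := (isOpen_phaseDomain hreg).measurableSet
  have hSm : MeasurableSet S := 𝒯.measurableSet_slab hreg m
  set R := transport (drift (W m)) (w m) with hR
  set Tg := transport (drift (W m)) (fun q => g q.2) with hTg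
  set Ψ : ℝ × Phase → ℝ := fun q => χ (Z (m + 1) (φ m q.1 (𝒯.t (m + 1)) q.2)) with hΨ
  set u : Phase → ℝ := fun z => χ (Z m z) with hu
  have hΨc : Continuous Ψ :=
    hχ.continuous.comp ((Z (m + 1)).continuous.comp ((hφ m).continuous_fst (𝒯.t (m + 1))))
  have huc : Continuous u := hχ.continuous.comp (Z m).continuous
  have hu1c : Continuous fun z => χ (Z (m + 1) z) := hχ.continuous.comp (Z (m + 1)).continuous
  have hcd := (hW m).continuous_drift
  have hRL : MemLp R 2 (volume.restrict S) := hw.memLp_transport_two hb hαβ hreg hm hcd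
  have hTgL : MemLp Tg 2 (volume.restrict S) := hgV.memLp_transport_two hb hαβ hreg hm hcd
  have hgL : MemLp (fun q : ℝ × Phase => g q.2) 2 (volume.restrict S) :=
    𝒯.memLp_slab hb hreg m (hgV m hm).1
  have hΨL : MemLp Ψ 2 (volume.restrict S) := 𝒯.memLp_slab hb hreg m hΨc.continuousOn
  have hwc := (hw m hm).1
  have hw0 := continuousOn_slice hwc (left_mem_Icc.2 ht01.le)
  have hw1 := continuousOn_slice hwc (right_mem_Icc.2 ht01.le)
  have hg0 : ContinuousOn g (closure Ω) :=
    continuousOn_slice (hgV m hm).1 (left_mem_Icc.2 ht01.le)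
  have hw0L := memLp_phaseDomain (α := α) (β := β) hb hreg hw0
  have hw1L := memLp_phaseDomain (α := α) (β := β) hb hreg hw1
  have hg0L := memLp_phaseDomain (α := α) (β := β) hb hreg hg0
  have hBL := memLp_phaseDomain (α := α) (β := β) hb hreg hB
  have huL := memLp_phaseDomain (α := α) (β := β) hb hreg huc.continuousOn
  have hu1L := memLp_phaseDomain (α := α) (β := β) hb hreg hu1c.continuousOn
  obtain ⟨Λw, hΛw⟩ := hw.exists_lipschitzOnWith_path hαβ hreg hm (1 + 2 * b)
  have hid := (hW m).integral_transport_mul (hφ m) ht01.le hΩm (F := w m)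
    (ψ := fun z => χ (Z (m + 1) z)) (Λ := Λw)
    (fun y hy s hs => flow_mem_of_ne_zero hT hW hφ hZ hG hχs hm hy hs)
    (fun y hy => hΛw _ (LipschitzWith.of_dist_le_mul fun s s' => by
      rw [dist_eq_norm, dist_eq_norm]
      exact (hφ m).dist_le _ _ _ _) fun s hs => subset_closure (hy s hs))
    (hw.ae_differentiableAt hαβ hreg hm) (integrable_mul_of_memLp hRL hΨL)
    (by
      simp only [← hZ.step]
      exact integrable_mul_of_memLp hw0L huL) (integrable_mul_of_memLp hw1L hu1L)
  simp only [← hZ.step] at hid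
  have hcongr : ∀ F, EqOn (transport (G m) F) (transport (drift (W m)) F) S := fun F q hq =>
    transport_congr_drift (hG m hm hq) F
  have hgal' : (∫ q in S, R q * (g q.2 + c * 𝒯.h * Tg q))
      + (∫ z in Ω, w m (𝒯.t m, z) * g z) = ∫ z in Ω, B z * g z := by
    rw [← hgal]
    congr 1
    refine setIntegral_congr_fun hSm fun q hq => ?_
    simp only [hcongr _ hq, hR, hTg]
  have hX : MemLp (fun q => Ψ q - g q.2 - c * 𝒯.h * Tg q) 2 (volume.restrict S) :=
    (hΨL.sub hgL).sub (hTgL.const_mul _)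
  have hrep : (∫ z in Ω, w m (𝒯.t (m + 1), z) * χ (Z (m + 1) z)) - ∫ z in Ω, B z * u z
      = (∫ q in S, (𝒯.h * R q) * (1 / 𝒯.h * (Ψ q - g q.2 - c * 𝒯.h * Tg q)))
        + ∫ z in Ω, (w m (𝒯.t m, z) - B z) * (u z - g z) := by
    have hgT : MemLp (fun q => g q.2 + c * 𝒯.h * Tg q) 2 (volume.restrict S) :=
      hgL.add (hTgL.const_mul (c * 𝒯.h))
    have e1 : ∫ q in S, (𝒯.h * R q) * (1 / 𝒯.h * (Ψ q - g q.2 - c * 𝒯.h * Tg q))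
        = (∫ q in S, R q * Ψ q) - ∫ q in S, R q * (g q.2 + c * 𝒯.h * Tg q) := by
      rw [← integral_sub (integrable_mul_of_memLp hRL hΨL)
        (integrable_mul_of_memLp hRL hgT)]
      refine integral_congr_ae (Filter.Eventually.of_forall fun q => ?_)
      simp only
      field_simp
      ring
    have e2 : ∫ z in Ω, (w m (𝒯.t m, z) - B z) * (u z - g z)
        = ((∫ z in Ω, w m (𝒯.t m, z) * u z) - ∫ z in Ω, w m (𝒯.t m, z) * g z)
          - ((∫ z in Ω, B z * u z) - ∫ z in Ω, B z * g z) := by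
      have hJ : MemLp (fun z => w m (𝒯.t m, z) - B z) 2 (volume.restrict Ω) := hw0L.sub hBL
      rw [sub_sub_sub_comm, ← integral_sub (integrable_mul_of_memLp hw0L huL)
        (integrable_mul_of_memLp hBL huL), ← integral_sub (integrable_mul_of_memLp hw0L hg0L)
        (integrable_mul_of_memLp hBL hg0L)]
      simp only [← sub_mul]
      rw [← integral_sub (integrable_mul_of_memLp hJ huL) (integrable_mul_of_memLp hJ hg0L)]
      simp only [mul_sub]
    rw [e1, e2]
    have e3 : ∫ q in S, R q * Ψ q = (∫ z in Ω, w m (𝒯.t (m + 1), z) * χ (Z (m + 1) z))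
      - ∫ z in Ω, w m (𝒯.t m, z) * u z := hid
    linarith
  have hin := integral_slab_sq_le hW hφ hZ hm hΛ hχ hd0 hd hτ hc hC hg
  have hY : ∫ z in Ω, (u z - g z) ^ 2 ≤ C * 𝒯.h ^ 2 * (Λ ^ 2 * d) := by
    refine integral_le_of_lintegral_ofReal_le (fun z => sq_nonneg _) (by positivity)
      ((lintegral_mono fun z => ENNReal.ofReal_le_ofReal ?_).trans hg)
    rw [← sq_abs, abs_sub_comm]
    have : 0 ≤ 𝒯.h * (|dX g z| + |dV₁ g z| + |dV₂ g z|) := by positivity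
    gcongr
    linarith
  have b1 := abs_integral_mul_le (hRL.const_mul 𝒯.h) (hX.const_mul (1 / 𝒯.h)) hlam
  have b2 := abs_integral_mul_le (hw0L.sub hBL) (huL.sub hg0L)
    (show 0 < lam * τ / σ by positivity)
  simp only [Pi.sub_apply] at b2
  have hjump : ∫ q in S, (w m (𝒯.t m, q.2) - B q.2) ^ 2
      = τ * ∫ z in Ω, (w m (𝒯.t m, z) - B z) ^ 2 := by
    rw [hS, volume_restrict_slab, integral_fun_snd fun z => (w m (𝒯.t m, z) - B z) ^ 2]
    simp only [Measure.real, Measure.restrict_apply_univ, Real.volume_Ioc, smul_eq_mul]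
    rw [ENNReal.toReal_ofReal hτ0.le]
  have hRG : ∫ q in S, (𝒯.h * transport (G m) (w m) q) ^ 2 = ∫ q in S, (𝒯.h * R q) ^ 2 :=
    setIntegral_congr_fun hSm fun q hq => by simp only [hcongr _ hq, hR]
  have hXs : ∫ q in S, (1 / 𝒯.h * (Ψ q - g q.2 - c * 𝒯.h * Tg q)) ^ 2
      ≤ τ * (Λ ^ 2 * d * (2 * (1 + 2 * b) ^ 2 + 2 * (1 + c * (1 + 2 * b)) ^ 2 * C)) := by
    simp only [mul_pow]
    rw [integral_const_mul]
    calc _ ≤ (1 / 𝒯.h) ^ 2 * (τ * (𝒯.h ^ 2 * (Λ ^ 2 * d *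
          (2 * (1 + 2 * b) ^ 2 + 2 * (1 + c * (1 + 2 * b)) ^ 2 * C)))) := by
          gcongr
      _ = _ := by field_simp
  have hYs : 1 / (2 * (lam * τ / σ)) * ∫ z in Ω, (u z - g z) ^ 2
      ≤ 1 / (2 * lam) * (τ * (Λ ^ 2 * d * (C / σ))) := by
    have h1 : (σ * 𝒯.h) ^ 2 ≤ τ ^ 2 := by gcongr
    calc _ ≤ 1 / (2 * (lam * τ / σ)) * (C * 𝒯.h ^ 2 * (Λ ^ 2 * d)) := by gcongr
      _ = 1 / (2 * lam) * (C * (Λ ^ 2 * d) / (σ * τ)) * (σ * 𝒯.h) ^ 2 := by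
          field_simp
      _ ≤ 1 / (2 * lam) * (C * (Λ ^ 2 * d) / (σ * τ)) * τ ^ 2 := by gcongr
      _ = _ := by
          field_simp
  rw [hrep, hRG, hjump]
  refine (abs_add_le _ _).trans ((add_le_add b1 b2).trans ?_)
  have h5 : 1 / (2 * lam) * ∫ q in S, (1 / 𝒯.h * (Ψ q - g q.2 - c * 𝒯.h * Tg q)) ^ 2
      ≤ 1 / (2 * lam) *
        (τ * (Λ ^ 2 * d * (2 * (1 + 2 * b) ^ 2 + 2 * (1 + c * (1 + 2 * b)) ^ 2 * C))) := by
    gcongr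
  have h6 : lam * τ / σ / 2 * ∫ z in Ω, (w m (𝒯.t m, z) - B z) ^ 2
      = lam / 2 * (1 / σ * (τ * ∫ z in Ω, (w m (𝒯.t m, z) - B z) ^ 2)) := by ring
  rw [h6]
  have h7 : 1 / (2 * lam) * (τ * (Λ ^ 2 * d * (2 * (1 + 2 * b) ^ 2
      + 2 * (1 + c * (1 + 2 * b)) ^ 2 * C + C / σ)))
      = 1 / (2 * lam) *
        (τ * (Λ ^ 2 * d * (2 * (1 + 2 * b) ^ 2 + 2 * (1 + c * (1 + 2 * b)) ^ 2 * C)))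
        + 1 / (2 * lam) * (τ * (Λ ^ 2 * d * (C / σ))) := by ring
  rw [h7, mul_add (lam / 2)]
  linarith

/-- The exact solution, tested with the dual solution, is constant in time. -/
theorem integral_exact_step (hT : 0 ≤ T) (hb : Bornology.IsBounded Ωv)
    (hreg : Ωv = interior (closure Ωv)) (hW : ∀ m, IsLipschitzField (W m) b ℓ)
    (hφ : ∀ m, IsDriftFlow (W m) b ℓ (φ m)) (hZ : IsTerminalMap 𝒯.M 𝒯.t φ Z)
    (hG : ∀ m < 𝒯.M, EqOn (G m) (drift (W m)) (𝒯.slab m)) (hm : m < 𝒯.M) (hχ : Continuous χ)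
    (hχs : tsupport χ ⊆ backwardDomain T (phaseDomain α β Ωv) (𝒯.glue G))
    {f : ℝ × Phase → ℝ} {K : ℝ≥0} (hf : LipschitzWith K f)
    (hf0 : ∀ᵐ q ∂(volume.restrict (𝒯.slab m)), transport (drift (W m)) f q = 0) :
    ∫ z in phaseDomain α β Ωv, f (𝒯.t (m + 1), z) * χ (Z (m + 1) z)
      = ∫ z in phaseDomain α β Ωv, f (𝒯.t m, z) * χ (Z m z) := by
  have ht01 := 𝒯.t_lt m hm
  have hΩm : MeasurableSet (phaseDomain α β Ωv) := (isOpen_phaseDomain hreg).measurableSet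
  have hfc := hf.continuous
  have : (volume : Measure (ℝ × Phase)).IsAddHaarMeasure :=
    Measure.prod.instIsAddHaarMeasure volume volume
  have huc : Continuous fun z => χ (Z m z) := hχ.comp (Z m).continuous
  have hu1c : Continuous fun z => χ (Z (m + 1) z) := hχ.comp (Z (m + 1)).continuous
  have hz : ∀ᵐ q ∂(volume.restrict (𝒯.slab m)),
      transport (drift (W m)) f q * χ (Z (m + 1) (φ m q.1 (𝒯.t (m + 1)) q.2)) = 0 := by
    filter_upwards [hf0] with q hq
    rw [hq, zero_mul]
  have hL : ∀ u : Phase → ℝ, Continuous u → MemLp u 2 (volume.restrict (phaseDomain α β Ωv)) :=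
    fun u hu => memLp_phaseDomain hb hreg hu.continuousOn
  have hid := (hW m).integral_transport_mul (hφ m) ht01.le hΩm (F := f)
    (ψ := fun z => χ (Z (m + 1) z)) (Λ := K * max 1 (1 + 2 * b))
    (fun y hy s hs => flow_mem_of_ne_zero hT hW hφ hZ hG hχs hm hy hs)
    (fun y hy => (hf.comp (LipschitzWith.id.prodMk (LipschitzWith.of_dist_le_mul fun s s' => by
      rw [dist_eq_norm, dist_eq_norm]
      exact (hφ m).dist_le _ _ _ _))).lipschitzOnWith)
    (ae_restrict_of_ae hf.ae_differentiableAt)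
    ((integrable_zero _ _ _).congr (hz.mono fun q hq => hq.symm))
    (by
      simp only [← hZ.step]
      exact integrable_mul_of_memLp (hL _ (by fun_prop)) (hL _ huc))
    (integrable_mul_of_memLp (hL _ (by fun_prop)) (hL _ hu1c))
  simp only [← hZ.step] at hid
  have h0 : ∫ q in Ioc (𝒯.t m) (𝒯.t (m + 1)) ×ˢ phaseDomain α β Ωv,
      transport (drift (W m)) f q * χ (Z (m + 1) (φ m q.1 (𝒯.t (m + 1)) q.2)) = 0 :=
    integral_eq_zero_of_ae hz
  rw [h0] at hid
  linarith

end PhaseMesh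

/-! ### The error estimate for test functions supported in the backward domain -/

namespace PhaseMesh

variable {T α β : ℝ} {Ωv : Set (ℝ × ℝ)} {𝒯 : PhaseMesh T α β Ωv} {σ : ℝ}

theorem ShapeRegular.step_le (hsh : 𝒯.ShapeRegular σ) (hαβ : α < β)
    (hreg : Ωv = interior (closure Ωv)) (hne : Ωv.Nonempty) {m : ℕ} (hm : m < 𝒯.M) :
    𝒯.t (m + 1) - 𝒯.t m ≤ 𝒯.h := by
  obtain ⟨v, hv⟩ := hne
  obtain ⟨s, hs, -⟩ := 𝒯.exists_triangle_mem hreg (subset_closure hv)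
  obtain ⟨j, hj, -⟩ := 𝒯.exists_interval_mem hαβ (left_mem_Icc.2 hαβ.le)
  have hsne : s.Nonempty := Finset.card_pos.1 (by rw [hs.2]; norm_num)
  obtain ⟨p, hp⟩ := hsne
  have h1 := hsh.1 m hm j hj s hs p hp p hp
  refine le_of_sq_le_sq ?_ 𝒯.h_pos.le
  nlinarith [sq_nonneg (𝒯.x (j + 1) - 𝒯.x j)]

theorem ShapeRegular.h_le (hsh : 𝒯.ShapeRegular σ) (hσ : 0 < σ) (hT : 0 < T) : 𝒯.h ≤ T / σ := by
  rw [le_div_iff₀ hσ]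
  have h1 := hsh.2.1 0 (M_pos hT)
  have h2 := 𝒯.t_le (M_pos hT)
  have h3 := 𝒯.t_nonneg (Nat.zero_le 𝒯.M)
  rw [zero_add] at h1
  linarith [mul_comm σ 𝒯.h]

theorem ofReal_sqrt_sum_le_eLpNorm (hreg : Ωv = interior (closure Ωv)) {F : ℕ → ℝ × Phase → ℝ}
    (hF : ∀ m < 𝒯.M, MemLp (F m) 2 (volume.restrict (𝒯.slab m))) {v : ℝ × Phase → ℝ}
    (hv : ∀ m < 𝒯.M, EqOn v (F m) (𝒯.slab m)) :
    ENNReal.ofReal (Real.sqrt (∑ m ∈ Finset.range 𝒯.M, ∫ q in 𝒯.slab m, F m q ^ 2))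
      ≤ eLpNorm v 2 (volume.restrict (cylinder T α β Ωv)) := by
  have hnn : 0 ≤ ∑ m ∈ Finset.range 𝒯.M, ∫ q in 𝒯.slab m, F m q ^ 2 :=
    Finset.sum_nonneg fun m _ => integral_nonneg fun q => sq_nonneg _
  rw [← ENNReal.pow_le_pow_left_iff (n := 2) two_ne_zero, ← ENNReal.ofReal_pow (Real.sqrt_nonneg _),
    Real.sq_sqrt hnn]
  have h2 : eLpNorm v 2 (volume.restrict (cylinder T α β Ωv)) ^ 2
      = ∫⁻ q in cylinder T α β Ωv, ‖v q‖ₑ ^ 2 := by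
    have := eLpNorm_nnreal_pow_eq_lintegral (f := v) (μ := volume.restrict (cylinder T α β Ωv))
      (p := 2) two_ne_zero
    simpa using this
  have hdisj : Set.PairwiseDisjoint (Finset.range 𝒯.M : Set ℕ) 𝒯.slab := by
    intro m hm n hn hne
    rw [Function.onFun, Set.disjoint_left]
    intro q hq hq'
    exact hne (𝒯.eq_of_mem_Ioc (by simpa using hm) (by simpa using hn) hq.1 hq'.1)
  have hsub : (⋃ m ∈ Finset.range 𝒯.M, 𝒯.slab m) ⊆ cylinder T α β Ωv := by
    refine iUnion₂_subset fun m hm => prod_mono ?_ subset_rfl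
    exact Ioc_subset_Icc_self.trans (𝒯.Icc_subset (Finset.mem_range.1 hm))
  rw [h2, ENNReal.ofReal_sum_of_nonneg fun m _ => integral_nonneg fun q => sq_nonneg _]
  refine le_trans (le_of_eq ?_) (lintegral_mono_set hsub)
  rw [lintegral_biUnion_finset hdisj fun m _ => 𝒯.measurableSet_slab hreg m]
  refine Finset.sum_congr rfl fun m hm => ?_
  have hm' := Finset.mem_range.1 hm
  rw [ofReal_integral_eq_lintegral_ofReal (hF m hm').integrable_sq
    (Filter.Eventually.of_forall fun q => sq_nonneg _)]
  refine setLIntegral_congr_fun (𝒯.measurableSet_slab hreg m) fun q hq => ?_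
  rw [hv m hm' hq, ← sq_abs, ENNReal.ofReal_pow (abs_nonneg _), ← Real.enorm_eq_ofReal_abs]

theorem continuousOn_traceBelow {k : ℕ} {w : ℕ → ℝ × Phase → ℝ} (hw : 𝒯.MemV k w) {f₀ : Phase → ℝ}
    (hf₀ : Continuous f₀) {m : ℕ} (hm : m ≤ 𝒯.M) :
    ContinuousOn (𝒯.traceBelow f₀ w m) (closure (phaseDomain α β Ωv)) := by
  cases m with
  | zero => exact hf₀.continuousOn
  | succ m => exact continuousOn_slice (hw m hm).1 (right_mem_Icc.2 (𝒯.t_lt m hm).le)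

theorem exists_field_extension {k : ℕ} {W : ℕ → ℝ × ℝ → ℝ × ℝ × ℝ} (hW : 𝒯.MemFieldV k W)
    (hαβ : α ≤ β) {L : ℝ} (hL : ∀ m < 𝒯.M, ∀ t ∈ Icc (𝒯.t m) (𝒯.t (m + 1)), ∀ x ∈ Icc α β,
      ∀ y ∈ Icc α β, ‖W m (t, x) - W m (t, y)‖ ≤ L * |x - y|) :
    ∃ W' : ℕ → ℝ × ℝ → ℝ × ℝ × ℝ, (∀ m, IsLipschitzField (W' m) (|L| * (β - α)).toNNReal |L|.toNNReal) ∧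
      ∀ m < 𝒯.M, EqOn (drift (W m)) (drift (W' m)) (𝒯.slab m) := by
  have : ∀ m, ∃ W' : ℝ × ℝ → ℝ × ℝ × ℝ, IsLipschitzField W' (|L| * (β - α)).toNNReal |L|.toNNReal ∧
      (m < 𝒯.M → EqOn (drift (W m)) (drift W') (𝒯.slab m)) := by
    intro m
    by_cases hm : m < 𝒯.M
    · obtain ⟨W', h1, h2⟩ := exists_isLipschitzField_extension (𝒯.t_lt m hm).le hαβ (hW m hm).1
        (fun t ht => ((hW m hm).2.1 t ht).1) (hL m hm)
      refine ⟨W', h1, fun _ q hq => ?_⟩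
      simp only [drift, h2 (show (q.1, q.2.1) ∈ _ from
        ⟨Ioc_subset_Icc_self hq.1, Ioo_subset_Icc_self hq.2.1⟩)]
    · exact ⟨fun _ => 0, ⟨continuous_const, by simp, fun t x y => by
        rw [sub_self, norm_zero]
        positivity⟩, fun h => absurd h hm⟩
  choose W' h1 h2 using this
  exact ⟨W', h1, h2⟩

theorem exists_lipschitz_exact (hreg : Ωv = interior (closure Ωv)) {G : ℕ → ℝ × Phase → Phase}
    {f₀ : Phase → ℝ} {f : ℝ × Phase → ℝ} (hf : IsExactVlasov T α β Ωv (𝒯.glue G) f₀ f) :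
    ∃ (f' : ℝ × Phase → ℝ) (K : ℝ≥0), LipschitzWith K f' ∧ EqOn f f' (cylinder T α β Ωv) ∧
      ∀ m < 𝒯.M, ∀ᵐ q ∂(volume.restrict (𝒯.slab m)), transport (G m) f' q = 0 := by
  obtain ⟨⟨K, hK⟩, -, -, hpde⟩ := hf
  obtain ⟨f', hf', heq⟩ := hK.extend_real
  refine ⟨f', K, hf', heq, fun m hm => ?_⟩
  have : (volume : Measure (ℝ × Phase)).IsAddHaarMeasure :=
    Measure.prod.instIsAddHaarMeasure volume volume
  have hsub : 𝒯.slab m ⊆ cylinder T α β Ωv :=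
    prod_mono (Ioc_subset_Icc_self.trans (𝒯.Icc_subset hm)) subset_rfl
  have h1 : ∀ᵐ q : ℝ × Phase, q.1 ≠ 𝒯.t (m + 1) := by
    rw [Measure.volume_eq_prod]
    exact Measure.quasiMeasurePreserving_fst.ae
      (show ∀ᵐ t : ℝ, t ≠ 𝒯.t (m + 1) by simp [ae_iff])
  filter_upwards [ae_restrict_of_ae_restrict_of_subset hsub hpde,
    ae_restrict_of_ae hf'.ae_differentiableAt, ae_restrict_of_ae h1,
    ae_restrict_mem (𝒯.measurableSet_slab hreg m)] with q hq hd hqt hqs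
  have hopen : IsOpen (Ioo (𝒯.t m) (𝒯.t (m + 1)) ×ˢ phaseDomain α β Ωv) :=
    isOpen_Ioo.prod (isOpen_phaseDomain hreg)
  have hev : f =ᶠ[nhds q] f' := by
    filter_upwards [hopen.mem_nhds ⟨⟨hqs.1.1, lt_of_le_of_ne hqs.1.2 hqt⟩, hqs.2⟩] with q' hq'
    exact heq (hsub ⟨Ioo_subset_Ioc_self hq'.1, hq'.2⟩)
  rw [← hq]
  exact (transport_congr hev hd (𝒯.glue_of_mem G hm hqs.1)).symm

theorem exists_integral_finalError_mul_le (hT : 0 < T) (hαβ : α < β)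
    (hb : Bornology.IsBounded Ωv) (hreg : Ωv = interior (closure Ωv)) {k : ℕ} (hk : 1 ≤ k)
    {σ c : ℝ} (L : ℝ) (hσ : 0 < σ) (hc : 0 < c) :
    ∃ C : ℝ, 0 ≤ C ∧ ∀ 𝒯 : PhaseMesh T α β Ωv, 𝒯.ShapeRegular σ →
      ∀ f₀ : Phase → ℝ, Continuous f₀ → ∀ W : ℕ → ℝ × ℝ → ℝ × ℝ × ℝ, 𝒯.MemFieldV k W →
      (∀ m < 𝒯.M, ∀ t ∈ Icc (𝒯.t m) (𝒯.t (m + 1)), ∀ x ∈ Icc α β, ∀ y ∈ Icc α β,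
        ‖W m (t, x) - W m (t, y)‖ ≤ L * |x - y|) →
      ∀ w : ℕ → ℝ × Phase → ℝ,
      𝒯.SolvesVlasovSD k (c * 𝒯.h) (fun m => drift (W m)) f₀ w →
      ∀ f : ℝ × Phase → ℝ, IsExactVlasov T α β Ωv (𝒯.glue fun m => drift (W m)) f₀ f →
      ∀ χ : Phase → ℝ, ContDiff ℝ 1 χ → HasCompactSupport χ →
      tsupport χ ⊆ backwardDomain T (phaseDomain α β Ωv) (𝒯.glue fun m => drift (W m)) →
      ENNReal.ofReal (∫ z, 𝒯.finalError f w z * χ z)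
        ≤ ENNReal.ofReal C * 𝒯.errorBound (fun m => drift (W m)) f₀ w
          * ENNReal.ofReal (h1Norm χ) := by
  by_cases hmesh : Nonempty (PhaseMesh T α β Ωv)
  swap
  · exact ⟨0, le_rfl, fun 𝒯 => absurd ⟨𝒯⟩ hmesh⟩
  obtain ⟨ε, hε, hε1, hext⟩ :=
    hmesh.some.exists_exterior_ball_phase hb hreg (show 0 < T / σ by positivity)
  obtain ⟨Cq, hCq, hquasi⟩ := exists_quasiInterp hk hT hαβ hreg hσ hε hε1
  set b : ℝ≥0 := (|L| * (β - α)).toNNReal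
  set ℓ : ℝ≥0 := |L|.toNNReal
  set Λ : ℝ≥0 := (Real.exp ((2 + 2 * ℓ + 2 * b : ℝ≥0) * T)).toNNReal
  have hb0 : (0 : ℝ) ≤ b := b.2
  set C₁ : ℝ := Λ ^ 2 * (2 * (1 + 2 * b) ^ 2 + 2 * (1 + c * (1 + 2 * b)) ^ 2 * Cq + Cq / σ)
  have hC₁ : 0 ≤ C₁ := by positivity
  refine ⟨(1 + Real.sqrt (1 / σ)) * Real.sqrt (T * C₁ * 3), by positivity, ?_⟩
  intro 𝒯 hsh f₀ hf₀ Wd hWd hL w hw f hf χ hχ hχc hχs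
  have hh := 𝒯.h_pos
  rcases Ωv.eq_empty_or_nonempty with hemp | hne
  · have h0 : ∀ z, χ z = 0 := fun z => by
      refine image_eq_zero_of_notMem_tsupport fun hz => ?_
      have := backwardDomain_subset hT.le _ _ (hχs hz)
      rw [phaseDomain, hemp, prod_empty] at this
      exact this
    simp [h0]
  set G : ℕ → ℝ × Phase → Phase := fun m => drift (Wd m) with hGdef
  set Ω := phaseDomain α β Ωv with hΩ
  obtain ⟨W, hW, hG⟩ := exists_field_extension hWd hαβ.le hL
  choose φ hφ using fun m => (hW m).exists_isDriftFlow
  obtain ⟨Z, hZ⟩ := exists_isTerminalMap hφ 𝒯.M 𝒯.t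
  obtain ⟨f', Kf, hf', hff', hpde⟩ := exists_lipschitz_exact hreg hf
  set d := ∫ z, ‖fderiv ℝ χ z‖ ^ 2 with hd
  have hd0 : 0 ≤ d := integral_nonneg fun z => sq_nonneg _
  have hdl : ∫⁻ z, ENNReal.ofReal (‖fderiv ℝ χ z‖ ^ 2) = ENNReal.ofReal d :=
    (ofReal_integral_eq_lintegral_ofReal (integrable_sq_norm_fderiv hχ hχc)
      (Filter.Eventually.of_forall fun z => sq_nonneg _)).symm
  have hΛ : ∀ m ≤ 𝒯.M, LipschitzWith Λ (Z m) := by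
    intro m hm
    refine (hZ.lipschitzWith hφ 𝒯.t_lt hm).weaken (Real.toNNReal_le_toNNReal ?_)
    have := 𝒯.t_nonneg hm
    rw [𝒯.t_last]
    gcongr
    linarith
  set A : ℕ → ℝ := fun m => ∫ z in Ω, 𝒯.traceBelow f₀ w m z * χ (Z m z) with hA
  set P₁ : ℕ → ℝ := fun m => ∫ q in 𝒯.slab m, (𝒯.h * transport (G m) (w m) q) ^ 2 with hP₁
  set P₂ : ℕ → ℝ := fun m => ∫ q in 𝒯.slab m, (w m (𝒯.t m, q.2) - 𝒯.traceBelow f₀ w m q.2) ^ 2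
    with hP₂
  have hstep : ∀ lam : ℝ, 0 < lam → ∀ m < 𝒯.M, |A (m + 1) - A m|
      ≤ lam / 2 * (P₁ m + 1 / σ * P₂ m)
        + 1 / (2 * lam) * ((𝒯.t (m + 1) - 𝒯.t m) * (C₁ * d)) := by
    intro lam hlam m hm
    obtain ⟨g, hgV, hg⟩ := hquasi 𝒯 hsh (hext 𝒯.h hh (hsh.h_le hσ hT)) (fun z => χ (Z m z))
      (hχ.continuous.comp (Z m).continuous)
      (fun z hz => comp_terminalMap_eq_zero hT.le hW hφ hZ hG hχs hm.le hz)
      (ENNReal.ofReal (Λ ^ 2 * d)) (fun v => by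
        rw [ENNReal.ofReal_mul (sq_nonneg _), ← hdl]
        exact hZ.lintegral_sq_translate_sub_le hW hφ hm.le (hΛ m hm.le) hχ v)
    rw [← ENNReal.ofReal_mul (by positivity)] at hg
    refine (abs_step_le hT.le hb hαβ hreg hW hφ hZ hG hm (hΛ m hm.le) hχ hχs hd0 hdl
      (hsh.step_le hαβ hreg hne hm) hσ (hsh.2.1 m hm) hc.le hCq hgV hg hw.1
      (continuousOn_traceBelow hw.1 hf₀ hm.le) (hw.2 m hm _ hgV) hlam).trans (le_of_eq ?_)
    simp only [hP₁, hP₂, C₁]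
    ring
  have hexact : ∀ m ≤ 𝒯.M, ∫ z in Ω, f' (𝒯.t m, z) * χ (Z m z) = A 0 := by
    intro m hm
    induction m with
    | zero =>
      refine setIntegral_congr_fun (isOpen_phaseDomain hreg).measurableSet fun z hz => ?_
      have h1 := hff' (show ((0 : ℝ), z) ∈ cylinder T α β Ωv from ⟨⟨le_rfl, hT.le⟩, hz⟩)
      simp only [𝒯.t_zero, ← h1, hf.2.1 z hz, traceBelow]
    | succ m ih =>
      rw [← ih (by omega)]
      refine integral_exact_step hT.le hb hreg hW hφ hZ hG hm hχ.continuous hχs hf' ?_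
      filter_upwards [hpde m hm, ae_restrict_mem (𝒯.measurableSet_slab hreg m)] with q hq hqs
      rw [← hq]
      exact transport_congr_drift (hG m hm hqs).symm _
  have hχ0 : ∀ z ∉ Ω, χ z = 0 := fun z hz =>
    image_eq_zero_of_notMem_tsupport fun h => hz (backwardDomain_subset hT.le _ _ (hχs h))
  have herr : ∫ z, 𝒯.finalError f w z * χ z = A 0 - A 𝒯.M := by
    obtain ⟨n, hn⟩ : ∃ n, 𝒯.M = n + 1 := Nat.exists_eq_succ_of_ne_zero (M_pos hT).ne'
    have hnM : n < 𝒯.M := by omega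
    have htn : 𝒯.t (n + 1) = T := hn ▸ 𝒯.t_last
    rw [← setIntegral_eq_integral_of_forall_compl_eq_zero
      (s := Ω) fun z hz => by rw [hχ0 z hz, mul_zero], ← hexact 𝒯.M le_rfl]
    have hL2 : ∀ u : Phase → ℝ, ContinuousOn u (closure Ω) → MemLp u 2 (volume.restrict Ω) :=
      fun u hu => memLp_phaseDomain hb hreg hu
    have hfc := hf'.continuous
    simp only [hA, hZ.last]
    rw [← integral_sub (integrable_mul_of_memLp (hL2 _ (by fun_prop))
        (hL2 _ hχ.continuous.continuousOn))
      (integrable_mul_of_memLp (hL2 _ (continuousOn_traceBelow hw.1 hf₀ le_rfl))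
        (hL2 _ hχ.continuous.continuousOn))]
    refine setIntegral_congr_fun (isOpen_phaseDomain hreg).measurableSet fun z hz => ?_
    have h1 := hff' (show (T, z) ∈ cylinder T α β Ωv from ⟨⟨hT.le, le_rfl⟩, hz⟩)
    have h2 : 𝒯.glue w (T, z) = w n (T, z) :=
      𝒯.glue_of_mem w hnM ⟨(𝒯.t_lt n hnM).trans_eq htn, htn.ge⟩
    have h3 : 𝒯.traceBelow f₀ w 𝒯.M z = w n (T, z) := by
      rw [hn]
      change w n (𝒯.t (n + 1), z) = _
      rw [htn]
    simp only [finalError]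
    rw [h2, h3, h1, 𝒯.t_last, sub_mul]
  set Q₁ := ∑ m ∈ Finset.range 𝒯.M, P₁ m with hQ₁
  set Q₂ := ∑ m ∈ Finset.range 𝒯.M, P₂ m with hQ₂
  have hQ₁0 : 0 ≤ Q₁ := Finset.sum_nonneg fun m _ => integral_nonneg fun q => sq_nonneg _
  have hQ₂0 : 0 ≤ Q₂ := Finset.sum_nonneg fun m _ => integral_nonneg fun q => sq_nonneg _
  have hsum : |A 0 - A 𝒯.M| ≤ Real.sqrt (Q₁ + 1 / σ * Q₂) * Real.sqrt (T * C₁ * d) := by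
    refine le_sqrt_mul_sqrt_of_forall (abs_nonneg _) (by positivity) (by positivity)
      fun lam hlam => ?_
    rw [abs_sub_comm, ← Finset.sum_range_sub A 𝒯.M]
    refine (Finset.abs_sum_le_sum_abs _ _).trans ?_
    refine (Finset.sum_le_sum fun m hm => hstep lam hlam m (Finset.mem_range.1 hm)).trans
      (le_of_eq ?_)
    rw [Finset.sum_add_distrib, ← Finset.mul_sum, ← Finset.mul_sum, Finset.sum_add_distrib,
      ← Finset.mul_sum, ← Finset.sum_mul, Finset.sum_range_sub, 𝒯.t_last, 𝒯.t_zero, sub_zero]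
    ring
  have hsqrt : Real.sqrt (Q₁ + 1 / σ * Q₂)
      ≤ (1 + Real.sqrt (1 / σ)) * (Real.sqrt Q₁ + Real.sqrt Q₂) := by
    have h2 : 0 ≤ 1 / σ * Q₂ := by positivity
    have h1 : Real.sqrt (Q₁ + 1 / σ * Q₂) ≤ Real.sqrt Q₁ + Real.sqrt (1 / σ * Q₂) := by
      refine Real.sqrt_le_iff.2 ⟨by positivity, ?_⟩
      nlinarith [Real.sq_sqrt hQ₁0, Real.sq_sqrt h2,
        mul_nonneg (Real.sqrt_nonneg Q₁) (Real.sqrt_nonneg (1 / σ * Q₂))]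
    rw [Real.sqrt_mul (by positivity)] at h1
    nlinarith [Real.sqrt_nonneg Q₁, Real.sqrt_nonneg Q₂, Real.sqrt_nonneg (1 / σ),
      mul_nonneg (Real.sqrt_nonneg (1 / σ)) (Real.sqrt_nonneg Q₁)]
  have hdsqrt : Real.sqrt (T * C₁ * d) ≤ Real.sqrt (T * C₁ * 3) * h1Norm χ := by
    have h1 := integral_sq_norm_fderiv_le hχ hχc
    have h2 : T * C₁ * d ≤ T * C₁ * 3 * h1Norm χ ^ 2 := by
      rw [mul_assoc (T * C₁)]
      gcongr
    refine (Real.sqrt_le_sqrt h2).trans_eq ?_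
    rw [Real.sqrt_mul (by positivity), Real.sqrt_sq (show 0 ≤ h1Norm χ from Real.sqrt_nonneg _)]
  have hE₁ : ENNReal.ofReal (Real.sqrt Q₁) ≤ eLpNorm (fun q => 𝒯.h * 𝒯.residual₁ G w q) 2
      (volume.restrict (cylinder T α β Ωv)) := by
    refine ofReal_sqrt_sum_le_eLpNorm hreg (F := fun m q => 𝒯.h * transport (G m) (w m) q)
      (fun m hm => ?_) fun m hm q hq => ?_
    · refine (MemLp.ae_eq ?_
        (hw.1.memLp_transport_two hb hαβ hreg hm (hW m).continuous_drift)).const_mul _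
      filter_upwards [ae_restrict_mem (𝒯.measurableSet_slab hreg m)] with q hq
      exact transport_congr_drift (hG m hm hq).symm _
    · simp only [residual₁, 𝒯.glue_of_mem _ hm hq.1]
  have hE₂ : ENNReal.ofReal (Real.sqrt Q₂) ≤ eLpNorm (fun q => 𝒯.h * 𝒯.residual₂ f₀ w q) 2
      (volume.restrict (cylinder T α β Ωv)) := by
    refine ofReal_sqrt_sum_le_eLpNorm hreg
      (F := fun m q => w m (𝒯.t m, q.2) - 𝒯.traceBelow f₀ w m q.2)
      (fun m hm => ?_) fun m hm q hq => ?_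
    · have h1 : ContinuousOn (fun z => w m (𝒯.t m, z) - 𝒯.traceBelow f₀ w m z) (closure Ω) :=
        (continuousOn_slice (hw.1 m hm).1 (left_mem_Icc.2 (𝒯.t_lt m hm).le)).sub
          (continuousOn_traceBelow hw.1 hf₀ hm.le)
      exact 𝒯.memLp_slab hb hreg m (h1.comp continuousOn_snd fun q hq => hq.2)
    · simp only [residual₂, 𝒯.glue_of_mem _ hm hq.1]
      field_simp
  have hE : ENNReal.ofReal (Real.sqrt Q₁ + Real.sqrt Q₂) ≤ 𝒯.errorBound G f₀ w := by
    rw [ENNReal.ofReal_add (Real.sqrt_nonneg _) (Real.sqrt_nonneg _), errorBound]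
    refine add_le_add (hE₁.trans ?_) hE₂
    exact le_mul_of_one_le_right zero_le (le_add_right one_le_two)
  have hfin : ∫ z, 𝒯.finalError f w z * χ z ≤ (1 + Real.sqrt (1 / σ)) * Real.sqrt (T * C₁ * 3)
      * (Real.sqrt Q₁ + Real.sqrt Q₂) * h1Norm χ := by
    rw [herr]
    refine (le_abs_self _).trans (hsum.trans ?_)
    refine (mul_le_mul hsqrt hdsqrt (Real.sqrt_nonneg _) (by positivity)).trans (le_of_eq ?_)
    ring
  refine (ENNReal.ofReal_le_ofReal hfin).trans ?_
  rw [ENNReal.ofReal_mul (by positivity), ENNReal.ofReal_mul (by positivity)]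
  gcongr

end PhaseMesh

/-! ### Cutoff functions -/

theorem exists_cutoff {r : ℝ} (hr : 0 < r) :
    ∃ C : ℝ, 0 ≤ C ∧ ∀ A : Set Phase, ∃ η : Phase → ℝ,
      ContDiff ℝ ((⊤ : ℕ∞) : WithTop ℕ∞) η ∧ (∀ z, |η z| ≤ 1) ∧ (∀ z ∈ A, η z = 1) ∧
      tsupport η ⊆ Metric.thickening r A ∧ ∀ z, ‖fderiv ℝ η z‖ ≤ C := by
  let φ : ContDiffBump (0 : Phase) := ⟨r / 8, r / 4, by positivity, by linarith⟩
  set ρ : Phase → ℝ := φ.normed volume with hρ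
  have hρs : ContDiff ℝ ((⊤ : ℕ∞) : WithTop ℕ∞) ρ := φ.contDiff_normed
  have hρc : HasCompactSupport ρ := φ.hasCompactSupport_normed
  have hρ0 : ∀ z, 0 ≤ ρ z := φ.nonneg_normed
  have hρi : Integrable ρ := φ.integrable_normed
  let L : ℝ →L[ℝ] ℝ →L[ℝ] ℝ := ContinuousLinearMap.lsmul ℝ ℝ
  have hρd : Integrable fun z => ‖fderiv ℝ ρ z‖ :=
    ((hρs.continuous_fderiv (by simp)).integrable_of_hasCompactSupport (hρc.fderiv ℝ)).norm
  refine ⟨∫ z, ‖fderiv ℝ ρ z‖, integral_nonneg fun z => norm_nonneg _, fun A => ?_⟩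
  set N := Metric.thickening (r / 2) A with hN
  set g : Phase → ℝ := N.indicator fun _ => 1 with hg
  have hg1 : ∀ z, |g z| ≤ 1 := fun z => by
    by_cases hz : z ∈ N <;> simp [hg, hz]
  have hgl : LocallyIntegrable g volume :=
    (locallyIntegrable_const (1 : ℝ)).indicator Metric.isOpen_thickening.measurableSet
  set η : Phase → ℝ := convolution ρ g L volume with hη
  have hone : ∀ z ∈ A, η z = 1 := by
    intro z hz
    have hzN : ∀ x ∈ Metric.ball z (r / 4), x ∈ N := fun x hx =>
      Metric.mem_thickening_iff.2 ⟨z, hz, (Metric.mem_ball.1 hx).trans (by linarith)⟩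
    have hzz := hzN z (Metric.mem_ball_self (by positivity))
    have := φ.normed_convolution_eq_right (μ := volume) (g := g) (x₀ := z) fun x hx => by
      simp [hg, hzN x hx, hzz]
    rw [hη, this]
    simp [hg, hzz]
  have hzero : ∀ z, z ∉ Metric.thickening (3 * r / 4) A → η z = 0 := by
    intro z hz
    have hzN : ∀ x ∈ Metric.ball z (r / 4), x ∉ N := fun x hx hxN => by
      obtain ⟨a, ha, hxa⟩ := Metric.mem_thickening_iff.1 hxN
      refine hz (Metric.mem_thickening_iff.2 ⟨a, ha, ?_⟩)
      have := dist_triangle z x a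
      rw [Metric.mem_ball, dist_comm] at hx
      linarith
    have hzz := hzN z (Metric.mem_ball_self (by positivity))
    have := φ.normed_convolution_eq_right (μ := volume) (g := g) (x₀ := z) fun x hx => by
      simp [hg, hzN x hx, hzz]
    rw [hη, this]
    simp [hg, hzz]
  refine ⟨η, hρc.contDiff_convolution_left L hρs hgl, fun z => ?_, hone, ?_, fun z => ?_⟩
  · have h1 : ∀ t, ‖L (ρ t) (g (z - t))‖ ≤ ρ t := fun t => by
      change |ρ t * g (z - t)| ≤ ρ t
      rw [abs_mul, abs_of_nonneg (hρ0 t)]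
      exact mul_le_of_le_one_right (hρ0 t) (hg1 _)
    refine (norm_integral_le_of_norm_le hρi (Filter.Eventually.of_forall h1)).trans_eq ?_
    exact φ.integral_normed
  · have h1 : Function.support η ⊆ Metric.thickening (3 * r / 4) A := fun z hz => by
      by_contra hcon
      exact hz (hzero z hcon)
    exact (closure_mono h1).trans ((Metric.closure_thickening_subset_cthickening _ _).trans
      (Metric.cthickening_subset_thickening' hr (by linarith) _))
  · have hd := hρc.hasFDerivAt_convolution_left L (hρs.of_le (by simp)) hgl z
    rw [hd.fderiv]
    refine norm_integral_le_of_norm_le hρd (Filter.Eventually.of_forall fun t => ?_)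
    refine ContinuousLinearMap.opNorm_le_bound _ (norm_nonneg _) fun y => ?_
    change ‖fderiv ℝ ρ t y * g (z - t)‖ ≤ _
    rw [norm_mul]
    exact (mul_le_of_le_one_right (norm_nonneg _) (hg1 _)).trans ((fderiv ℝ ρ t).le_opNorm y)

theorem h1Norm_mul_le {η χ : Phase → ℝ} {C : ℝ} (hη : ContDiff ℝ 1 η) (hχ : ContDiff ℝ 1 χ)
    (hχc : HasCompactSupport χ) (h1 : ∀ z, |η z| ≤ 1) (hC : ∀ z, ‖fderiv ℝ η z‖ ≤ C) :
    h1Norm (fun z => η z * χ z) ≤ Real.sqrt (2 + 6 * C ^ 2) * h1Norm χ := by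
  have hηd := hη.differentiable one_ne_zero
  have hχd := hχ.differentiable one_ne_zero
  have hprod : ContDiff ℝ 1 fun z => η z * χ z := hη.mul hχ
  have hpd := hprod.differentiable one_ne_zero
  have key : ∀ z (e : Phase), ‖e‖ ≤ 1 → (fderiv ℝ (fun z => η z * χ z) z e) ^ 2
      ≤ 2 * (fderiv ℝ χ z e) ^ 2 + 2 * C ^ 2 * χ z ^ 2 := by
    intro z e he
    have e1 : fderiv ℝ (fun z => η z * χ z) z e = η z * fderiv ℝ χ z e + χ z * fderiv ℝ η z e := by
      rw [fderiv_fun_mul (hηd z) (hχd z)]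
      simp
    have e2 : |fderiv ℝ η z e| ≤ C := by
      refine ((fderiv ℝ η z).le_opNorm e).trans ?_
      exact (mul_le_of_le_one_right (norm_nonneg _) he).trans (hC z)
    have e3 : (η z * fderiv ℝ χ z e) ^ 2 ≤ (fderiv ℝ χ z e) ^ 2 := by
      rw [mul_pow]
      exact mul_le_of_le_one_left (sq_nonneg _) ((sq_le_one_iff_abs_le_one _).2 (h1 z))
    have e4 : (χ z * fderiv ℝ η z e) ^ 2 ≤ C ^ 2 * χ z ^ 2 := by
      rw [mul_pow, mul_comm, ← sq_abs (fderiv ℝ η z e)]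
      gcongr
    rw [e1]
    nlinarith [sq_nonneg (η z * fderiv ℝ χ z e - χ z * fderiv ℝ η z e)]
  have n1 : ‖((1 : ℝ), (0 : ℝ), (0 : ℝ))‖ ≤ 1 := by simp [Prod.norm_def]
  have n2 : ‖((0 : ℝ), (1 : ℝ), (0 : ℝ))‖ ≤ 1 := by simp [Prod.norm_def]
  have n3 : ‖((0 : ℝ), (0 : ℝ), (1 : ℝ))‖ ≤ 1 := by simp [Prod.norm_def]
  have hle : h1Norm (fun z => η z * χ z) ^ 2 ≤ (2 + 6 * C ^ 2) * h1Norm χ ^ 2 := by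
    rw [sq_h1Norm, sq_h1Norm, ← integral_const_mul]
    refine integral_mono (integrable_h1_density hprod hχc.mul_left)
      ((integrable_h1_density hχ hχc).const_mul _) fun z => ?_
    have k1 := key z _ n1
    have k2 := key z _ n2
    have k3 := key z _ n3
    rw [← dX_eq_fderiv (hpd z), ← dX_eq_fderiv (hχd z)] at k1
    rw [← dV₁_eq_fderiv (hpd z), ← dV₁_eq_fderiv (hχd z)] at k2
    rw [← dV₂_eq_fderiv (hpd z), ← dV₂_eq_fderiv (hχd z)] at k3
    have k0 : (η z * χ z) ^ 2 ≤ χ z ^ 2 := by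
      rw [mul_pow]
      exact mul_le_of_le_one_left (sq_nonneg _) ((sq_le_one_iff_abs_le_one _).2 (h1 z))
    simp only
    nlinarith [mul_nonneg (sq_nonneg C) (sq_nonneg (dX χ z)),
      mul_nonneg (sq_nonneg C) (sq_nonneg (dV₁ χ z)),
      mul_nonneg (sq_nonneg C) (sq_nonneg (dV₂ χ z)), sq_nonneg (χ z)]
  have h0 : 0 ≤ h1Norm χ := Real.sqrt_nonneg _
  refine le_of_sq_le_sq ?_ (by positivity)
  rwa [mul_pow, Real.sq_sqrt (by positivity)]

theorem mainTheorem3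
    (T α β : ℝ) (hT : 0 < T) (hαβ : α < β)
    (Ωv : Set (ℝ × ℝ)) (hΩv_bdd : Bornology.IsBounded Ωv)
    (hΩv_reg : Ωv = interior (closure Ωv))
    (k : ℕ) (hk : 1 ≤ k) (σ c L r : ℝ) (hσ : 0 < σ) (hc : 0 < c) (hr : 0 < r) :
    ∃ C : ℝ, ∀ (𝒯 : PhaseMesh T α β Ωv), 𝒯.ShapeRegular σ →
      ∀ (δ' : ℝ) (f₀ : Phase → ℝ) (ρb E₂₀ B₀ : ℝ → ℝ), IsAdmissibleData α β Ωv f₀ ρb E₂₀ B₀ →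
      ∀ (fh : ℕ → ℕ → ℝ × Phase → ℝ) (Wh : ℕ → ℕ → ℝ × ℝ → ℝ × ℝ × ℝ),
      𝒯.IsIteration k (c * 𝒯.h) δ' f₀ ρb E₂₀ B₀ fh Wh →
      ∀ i : ℕ, 1 ≤ i →
      (∀ m < 𝒯.M, ∀ t ∈ Set.Icc (𝒯.t m) (𝒯.t (m + 1)), ∀ x ∈ Set.Icc α β, ∀ y ∈ Set.Icc α β,
        ‖Wh i m (t, x) - Wh i m (t, y)‖ ≤ L * |x - y|) →
      ∀ G : ℕ → ℝ × Phase → Phase, (G = fun m => drift (Wh i m)) →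
      ∀ f : ℝ × Phase → ℝ, IsExactVlasov T α β Ωv (𝒯.glue G) f₀ f →
      hMinusOneNorm (backwardDomain T (phaseDomain α β Ωv) (𝒯.glue G)) (𝒯.finalError f (fh i))
          ≤ ENNReal.ofReal C * 𝒯.errorBound G f₀ (fh i) ∧
      ((∀ z ∈ phaseDomain α β Ωv, 𝒯.finalError f (fh i) z ≠ 0 →
          Metric.ball z r ⊆ backwardDomain T (phaseDomain α β Ωv) (𝒯.glue G)) →
        hMinusOneNorm (phaseDomain α β Ωv) (𝒯.finalError f (fh i))
          ≤ ENNReal.ofReal C * 𝒯.errorBound G f₀ (fh i)) := by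
  obtain ⟨C, hC, hest⟩ := PhaseMesh.exists_integral_finalError_mul_le hT hαβ hΩv_bdd hΩv_reg hk
    L hσ hc
  obtain ⟨Cη, -, hcut⟩ := exists_cutoff hr
  set D : ℝ := Real.sqrt (2 + 6 * Cη ^ 2) with hD
  have hD1 : 1 ≤ D := Real.one_le_sqrt.2 (by nlinarith [sq_nonneg Cη])
  refine ⟨C * D, ?_⟩
  intro 𝒯 hsh δ' f₀ ρb E₂₀ B₀ hdata fh Wh hit i hi hL G hG f hf
  obtain ⟨i, rfl⟩ : ∃ j, i = j + 1 := Nat.exists_eq_succ_of_ne_zero (by omega)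
  subst hG
  obtain ⟨hmax, hvl⟩ := hit.2 i
  have hmain := hest 𝒯 hsh f₀ hdata.f_smooth.continuous (Wh (i + 1)) hmax.1 hL (fh (i + 1)) hvl f hf
  constructor
  · refine iSup_le fun χ => iSup_le fun hχ => iSup_le fun hχc => iSup_le fun hχs => ?_
    refine ENNReal.div_le_of_le_mul ((hmain χ (hχ.of_le (by simp)) hχc hχs).trans ?_)
    gcongr
    exact le_mul_of_one_le_right hC hD1
  · intro hball
    refine iSup_le fun χ => iSup_le fun hχ => iSup_le fun hχc => iSup_le fun hχs => ?_
    refine ENNReal.div_le_of_le_mul ?_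
    set e := 𝒯.finalError f (fh (i + 1)) with he
    obtain ⟨η, hη, hη1, hηA, hηs, hηd⟩ := hcut {z | z ∈ phaseDomain α β Ωv ∧ e z ≠ 0}
    have hηC : ContDiff ℝ 1 η := hη.of_le (by simp)
    have hχC : ContDiff ℝ 1 χ := hχ.of_le (by simp)
    have hint : ∫ z, e z * χ z = ∫ z, e z * (η z * χ z) := by
      congr 1
      funext z
      by_cases hz : z ∈ phaseDomain α β Ωv
      · by_cases hez : e z = 0
        · rw [hez, zero_mul, zero_mul]
        · rw [hηA z ⟨hz, hez⟩, one_mul]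
      · rw [image_eq_zero_of_notMem_tsupport fun h => hz (hχs h), mul_zero, mul_zero, mul_zero]
    have hsupp : tsupport (fun z => η z * χ z)
        ⊆ backwardDomain T (phaseDomain α β Ωv) (𝒯.glue fun m => drift (Wh (i + 1) m)) := by
      intro z hz
      obtain ⟨a, ha, hza⟩ := Metric.mem_thickening_iff.1 (hηs (tsupport_mul_subset_left hz))
      exact hball a ha.1 ha.2 hza
    rw [hint]
    refine (hmain _ (hηC.mul hχC) hχc.mul_left hsupp).trans ?_
    have hn := ENNReal.ofReal_le_ofReal (h1Norm_mul_le hηC hχC hχc hη1 hηd)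
    rw [ENNReal.ofReal_mul (Real.sqrt_nonneg _)] at hn
    rw [ENNReal.ofReal_mul hC]
    calc _ ≤ ENNReal.ofReal C * 𝒯.errorBound (fun m => drift (Wh (i + 1) m)) f₀ (fh (i + 1))
          * (ENNReal.ofReal D * ENNReal.ofReal (h1Norm χ)) := by gcongr
      _ = _ := by ring
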